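/- **Theorem (One dimension; reduced spectrum).** Let $S\subset\mathbb C$ be a set, $D(\tilde W):=\mathbb C\setminus S$, and let $\tilde W_\pm:D(\tilde W)\to\mathbb C$ be arbitrary functions. Put $W_\pm(\omega):=\omega^2\tilde W_\pm(\omega)$, and let $\tilde W(\cdot,\omega)$, $W(\cdot,\omega)$ be the functions on $\mathbb R$ equal to $\tilde W_\pm(\omega)$, $W_\pm(\omega)$ for $\pm x>0$. Let $k\in\mathbb R$ and $\nabla_k:=(\partial_x,\mathrm i k,0)^T$. With all derivatives taken in the sense of distributions on $\mathbb R$, let $$\mathcal D_{k,\omega}:=\{u\in L^2(\mathbb R,\mathbb C^3):\ \nabla_k\times u,\ \nabla_k\times\nabla_k\times u\in L^2(\mathbb R,\mathbb C^3),\ \nabla_k\cdot(\tilde W(\cdot,\omega)u)=0\},$$ $$\mathcal R_k:=\{f\in L^2(\mathbb R,\mathbb C^3):\ \nabla_k\cdot f=0\}$$ (with the $L^2$ norm), and for $\omega\in D(\tilde W)$, $\lambda\in\mathbb C$ let $$L_k(\omega;\lambda):=A(\omega)-\lambda B(\omega):\ L^2(\mathbb R,\mathbb C^3)\supset\mathcal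 D_{k,\omega}\to\mathcal R_k,\qquad A(\omega)u:=\nabla_k\times\nabla_k\times u,\quad B(\omega)u:=W(\cdot,\omega)u.$$ Write $\mathcal L_k$ for this pencil and $L_k(\omega):=L_k(\omega;1)$. *Spectra.* For fixed $\omega$, the resolvent set of $L_k(\omega;\cdot)$ is the set of all $\lambda\in\mathbb C$ for which $L_k(\omega;\lambda):\mathcal D_{k,\omega}\to\mathcal R_k$ is bijective with a bounded inverse. The following are subsets of $D(\tilde W)$. - $\sigma(\mathcal L_k)$: all $\omega$ such that $1$ is not in the resolvent set of $L_k(\omega;\cdot)$. - $\sigma_p(\mathcal L_k)$ (the eigenvalues): all $\omega$ with $\ker L_k(\omega)\neq\{0\}$. - $\sigma_p^{(<\infty)}(\mathcal L_k)$: all $\omega\in\sigma_p(\mathcal L_k)$ of finite algebraic multiplicity, that is, such that $\dim\ker L_k(\omega)<\infty$ and there is no sequence $(u_n)_{n\ge0}$ of linearly independent elements of $\mathcal D_{k,\omega}$ with $0\ne u_0\in\ker L_k(\omega)$ and $L_k(\omega)u_{n+1}=B(\omega)u_n$ for all $n\ge 0$. - An eigenvalue $\omega$ is geometrically simple if $\dim\ker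 L_k(\omega)=1$. It is algebraically simple if moreover for no $v\in\ker L_k(\omega)\setminus\{0\}$ there is a $u\in\mathcal D_{k,\omega}$ with $L_k(\omega)u=B(\omega)v$ and $u,v$ linearly independent. - $\sigma_d(\mathcal L_k)$: all $\omega\in\sigma_p^{(<\infty)}(\mathcal L_k)$ such that, for some $\delta>0$, every $\lambda$ with $0<|\lambda-1|<\delta$ is in the resolvent set of $L_k(\omega;\cdot)$. - $\sigma_{\mathrm{Weyl}}(\mathcal L_k)$: all $\omega$ for which there are $u^{(n)}\in\mathcal D_{k,\omega}$ with $\|u^{(n)}\|_{L^2}=1$, $u^{(n)}\rightharpoonup0$ in $L^2(\mathbb R,\mathbb C^3)$ and $\|L_k(\omega)u^{(n)}\|_{L^2}\to0$. - $\sigma_{e,j}(\mathcal L_k)$, $j=1,\dots,5$: all $\omega$ such that $L_k(\omega)$ is not semi-Fredholm, i.e. does not have closed range together with a finite-dimensional kernel or cokernel ($j=1$); does not have closed range together with a finite-dimensional kernel ($j=2$); is not Fredholm, i.e. does not have closed range together with a finite-dimensional kernel and cokernel ($j=3$); is not Fredholm with index $0$ ($j=4$); respectively such that $1\notin\Delta(\omega)$,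 where $\Delta(\omega)$ is the union of those connected components of $\{\lambda\in\mathbb C: L_k(\omega;\lambda)\text{ is semi-Fredholm}\}$ that contain a point of the resolvent set of $L_k(\omega;\cdot)$ ($j=5$). Let $\Omega_0:=\{\omega\in D(\tilde W): W_+(\omega)=0\text{ or }W_-(\omega)=0\}$, and let the superscript "red" denote the removal of $\Omega_0$ from a set, e.g. $\sigma^{\rm red}(\mathcal L_k):=\sigma(\mathcal L_k)\setminus\Omega_0$. Finally let $$M_\pm^{(k)}:=\{\omega\in D(\tilde W)\setminus\Omega_0: W_\pm(\omega)\in[k^2,\infty)\}\ (k\neq0),\qquad M_\pm^{(0)}:=\{\omega\in D(\tilde W)\setminus\Omega_0: W_\pm(\omega)\in(0,\infty)\},$$ $$N^{(k)}:=\{\omega\in D(\tilde W)\setminus\Omega_0:\ W_+(\omega),W_-(\omega)\notin[k^2,\infty),\ k^2(W_+(\omega)+W_-(\omega))=W_+(\omega)W_-(\omega)\}\quad(k\in\mathbb R).$$ Then, for every $k\in\mathbb R$: 1. $\sigma^{\rm red}(\mathcal L_k)=(M_+^{(k)}\cup M_-^{(k)})\cup N^{(k)}$, and $M_+^{(k)}\cup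 M_-^{(k)}$ and $N^{(k)}$ are disjoint. 2. $\sigma_p^{\rm red}(\mathcal L_k)=\sigma_p^{(<\infty)\,\rm red}(\mathcal L_k)=N^{(k)}$, and $N^{(0)}=\emptyset$. All eigenvalues in $\sigma_p^{\rm red}(\mathcal L_k)$ are algebraically and geometrically simple. Moreover $\sigma_d^{\rm red}(\mathcal L_k)=N^{(k)}$. 3. $\sigma_{e,j}^{\rm red}(\mathcal L_k)=\sigma_{\mathrm{Weyl}}^{\rm red}(\mathcal L_k)=M_+^{(k)}\cup M_-^{(k)}$ for $j=1,\dots,5$. -/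

import Mathlib

open MeasureTheory Filter Topology

/-! ### Spectra of operator pencils -/

/-- A pencil `P(ω; l) = A(ω) - l B(ω)` of operators `H ⊇ dom ω → R`, `ω ∈ Ω`, `l ∈ ℂ`. Only the
values at `ω ∈ Ω` of the functions `dom`, `A`, `B` are ever used. Closedness of `A(ω)` and
boundedness of `B(ω)` are not needed to define the spectra below, hence not recorded. -/
structure OperatorPencil (H R : Type*) [NormedAddCommGroup H] [InnerProductSpace ℂ H]
    [NormedAddCommGroup R] [InnerProductSpace ℂ R] where
  Ω : Set ℂ
  dom : ℂ → Submodule ℂ H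
  A : (ω : ℂ) → dom ω →ₗ[ℂ] R
  B : (ω : ℂ) → dom ω →ₗ[ℂ] R

namespace OperatorPencil

variable {H R : Type*} [NormedAddCommGroup H] [InnerProductSpace ℂ H]
  [NormedAddCommGroup R] [InnerProductSpace ℂ R] (P : OperatorPencil H R)

/-- The operator `P(ω; l) = A(ω) - l B(ω)`. -/
def op (ω l : ℂ) : P.dom ω →ₗ[ℂ] R := P.A ω - l • P.B ω

/-- The resolvent set of `P(ω; ·)` for a fixed `ω`: all `l` such that `P(ω; l)` is bijective with a
bounded inverse. -/
def innerResolventSet (ω : ℂ) : Set ℂ :=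
  {l | Function.Bijective (P.op ω l) ∧ ∃ C : ℝ, ∀ u : P.dom ω, ‖(u : H)‖ ≤ C * ‖P.op ω l u‖}

def resolventSet : Set ℂ := {ω | ω ∈ P.Ω ∧ 1 ∈ P.innerResolventSet ω}

def spectrum : Set ℂ := P.Ω \ P.resolventSet

def pointSpectrum : Set ℂ := {ω | ω ∈ P.Ω ∧ ∃ u : P.dom ω, u ≠ 0 ∧ P.op ω 1 u = 0}

/-- `l`, as an eigenvalue of `P(ω; ·)`, has infinite algebraic multiplicity: its eigenspace is
infinite dimensional, or there is an infinite chain of linearly independent generalized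
eigenvectors. -/
def HasInfiniteAlgMult (ω l : ℂ) : Prop :=
  ¬ FiniteDimensional ℂ (LinearMap.ker (P.op ω l)) ∨
    ∃ u : ℕ → P.dom ω, LinearIndependent ℂ u ∧ u 0 ≠ 0 ∧ P.op ω l (u 0) = 0 ∧
      ∀ n, P.op ω l (u (n + 1)) = P.B ω (u n)

/-- Eigenvalues of finite algebraic multiplicity. -/
def finPointSpectrum : Set ℂ := {ω | ω ∈ P.pointSpectrum ∧ ¬ P.HasInfiniteAlgMult ω 1}

/-- `l` is a geometrically simple eigenvalue of `P(ω; ·)`. -/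
def IsGeomSimple (ω l : ℂ) : Prop := Module.finrank ℂ (LinearMap.ker (P.op ω l)) = 1

/-- `l` is an algebraically simple eigenvalue of `P(ω; ·)`. -/
def IsAlgSimple (ω l : ℂ) : Prop :=
  P.IsGeomSimple ω l ∧
    ∀ v : P.dom ω, P.op ω l v = 0 → v ≠ 0 →
      ¬ ∃ u : P.dom ω, P.op ω l u = P.B ω v ∧ LinearIndependent ℂ ![u, v]

/-- `l = 1` is an eigenvalue of finite algebraic multiplicity of `P(ω; ·)` and is isolated from
the rest of the spectrum of `P(ω; ·)`, as a subset of the `l`-plane. -/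
def discreteSpectrum : Set ℂ :=
  {ω | ω ∈ P.finPointSpectrum ∧
    ∃ δ : ℝ, 0 < δ ∧ ∀ l : ℂ, l ≠ 1 → ‖l - 1‖ < δ → l ∈ P.innerResolventSet ω}

/-- `ω` belongs to the Weyl spectrum if there is a Weyl sequence at `ω`: normalized in `H`, weakly
convergent to `0` in `H`, with images under `P(ω; 1)` tending to `0`. -/
def weylSpectrum : Set ℂ :=
  {ω | ω ∈ P.Ω ∧ ∃ u : ℕ → P.dom ω, (∀ n, ‖(u n : H)‖ = 1) ∧
    (∀ η : H, Tendsto (fun n => inner ℂ η (u n : H)) atTop (𝓝 0)) ∧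
    Tendsto (fun n => ‖P.op ω 1 (u n)‖) atTop (𝓝 0)}

def HasClosedRange (ω l : ℂ) : Prop := IsClosed (LinearMap.range (P.op ω l) : Set R)

def HasFinKer (ω l : ℂ) : Prop := FiniteDimensional ℂ (LinearMap.ker (P.op ω l))

def HasFinCoker (ω l : ℂ) : Prop := FiniteDimensional ℂ (R ⧸ LinearMap.range (P.op ω l))

def IsSemiFredholm (ω l : ℂ) : Prop :=
  P.HasClosedRange ω l ∧ (P.HasFinKer ω l ∨ P.HasFinCoker ω l)

def IsFredholm (ω l : ℂ) : Prop :=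
  P.HasClosedRange ω l ∧ P.HasFinKer ω l ∧ P.HasFinCoker ω l

/-- The index; meaningful for Fredholm operators only. -/
noncomputable def index (ω l : ℂ) : ℤ :=
  (Module.finrank ℂ (LinearMap.ker (P.op ω l)) : ℤ) -
    (Module.finrank ℂ (R ⧸ LinearMap.range (P.op ω l)) : ℤ)

/-- The union of all connected components of `{l | P(ω; l) is semi-Fredholm}` that contain a point
of the resolvent set of `P(ω; ·)`. -/
def Delta (ω : ℂ) : Set ℂ :=
  {l | P.IsSemiFredholm ω l ∧
    (connectedComponentIn {m | P.IsSemiFredholm ω m} l ∩ P.innerResolventSet ω).Nonempty}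

/-- The five essential spectra `σ_{e,1}, …, σ_{e,5}`, indexed here by `0, …, 4`. -/
def essSpectrum : Fin 5 → Set ℂ :=
  ![{ω | ω ∈ P.Ω ∧ ¬ P.IsSemiFredholm ω 1},
    {ω | ω ∈ P.Ω ∧ ¬ (P.HasClosedRange ω 1 ∧ P.HasFinKer ω 1)},
    {ω | ω ∈ P.Ω ∧ ¬ P.IsFredholm ω 1},
    {ω | ω ∈ P.Ω ∧ ¬ (P.IsFredholm ω 1 ∧ P.index ω 1 = 0)},
    {ω | ω ∈ P.Ω ∧ 1 ∉ P.Delta ω}]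

end OperatorPencil

/-! ### Weak differential operators built from `∇_k = (∂, i k, 0)` -/

namespace Maxwell1D

/-- `L²(ℝ, ℂ³)`. -/
abbrev L2C3 : Type := Lp (EuclideanSpace ℂ (Fin 3)) 2 (volume : Measure ℝ)

/-- `∇_k φ` for a scalar function `φ`. -/
noncomputable def gradK (k : ℝ) (φ : ℝ → ℂ) : ℝ → Fin 3 → ℂ :=
  fun x => ![deriv φ x, Complex.I * k * φ x, 0]

/-- `∇_k × φ` for a vector valued function `φ`. -/
noncomputable def curlK (k : ℝ) (φ : ℝ → Fin 3 → ℂ) : ℝ → Fin 3 → ℂ :=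
  fun x => ![Complex.I * k * φ x 2, - deriv (fun y => φ y 2) x,
    deriv (fun y => φ y 1) x - Complex.I * k * φ x 0]

/-- Test functions `C_c^∞(ℝ, E)`. -/
def IsTest {E : Type*} [NormedAddCommGroup E] [NormedSpace ℝ E] (φ : ℝ → E) : Prop :=
  ContDiff ℝ ((⊤ : ℕ∞) : WithTop ℕ∞) φ ∧ HasCompactSupport φ

/-- The bilinear pairing `∫ u · φ dx` (no complex conjugation). -/
noncomputable def pair (u : L2C3) (φ : ℝ → Fin 3 → ℂ) : ℂ := ∫ x, ∑ i, u x i * φ x i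

/-- `v ∈ L²` is the weak `∇_k × u`. -/
def IsWeakCurl (k : ℝ) (u v : L2C3) : Prop :=
  ∀ φ : ℝ → Fin 3 → ℂ, IsTest φ → pair u (curlK (-k) φ) = pair v φ

/-- `∇_k · u = 0` in the sense of distributions. -/
def IsDivFree (k : ℝ) (u : L2C3) : Prop :=
  ∀ φ : ℝ → ℂ, IsTest φ → pair u (gradK (-k) φ) = 0

/-! #### Auxiliary facts -/

lemma IsTest.comp_apply {φ : ℝ → Fin 3 → ℂ} (h : IsTest φ) (i : Fin 3) :
    IsTest (fun x => φ x i) :=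
  ⟨contDiff_pi.1 h.1 i, h.2.comp_left (g := fun v : Fin 3 → ℂ => v i) rfl⟩

lemma IsTest.of_apply {φ : ℝ → Fin 3 → ℂ} (h : ∀ i, IsTest (fun x => φ x i)) : IsTest φ := by
  refine ⟨contDiff_pi.2 fun i => (h i).1, ?_⟩
  have hK : IsCompact (⋃ i, tsupport fun x => φ x i) := isCompact_iUnion fun i => (h i).2
  refine HasCompactSupport.intro hK fun x hx => ?_
  funext i
  have : x ∉ tsupport fun x => φ x i := fun hx' => hx (Set.mem_iUnion.2 ⟨i, hx'⟩)
  exact image_eq_zero_of_notMem_tsupport (f := fun x => φ x i) this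

lemma IsTest.deriv {φ : ℝ → ℂ} (h : IsTest φ) : IsTest (deriv φ) :=
  ⟨((contDiff_infty_iff_deriv (𝕜 := ℝ)).1 h.1).2, h.2.deriv⟩

lemma IsTest.const_mul {φ : ℝ → ℂ} (h : IsTest φ) (c : ℂ) : IsTest (fun x => c * φ x) :=
  ⟨contDiff_const.mul h.1, h.2.mul_left (f := fun _ => c)⟩

lemma IsTest.neg {φ : ℝ → ℂ} (h : IsTest φ) : IsTest (fun x => - φ x) :=
  by simpa using h.const_mul (-1)

lemma IsTest.sub {φ ψ : ℝ → ℂ} (h : IsTest φ) (h' : IsTest ψ) : IsTest (fun x => φ x - ψ x) := by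
  refine ⟨h.1.sub h'.1, ?_⟩
  have := h.2.add h'.neg.2
  simpa [Pi.add_def, sub_eq_add_neg] using this

lemma isTest_zero : IsTest (fun _ : ℝ => (0 : ℂ)) :=
  ⟨contDiff_const, HasCompactSupport.zero⟩

lemma IsTest.curlK {φ : ℝ → Fin 3 → ℂ} (h : IsTest φ) (k : ℝ) : IsTest (curlK k φ) := by
  refine IsTest.of_apply fun i => ?_
  fin_cases i
  · exact (h.comp_apply 2).const_mul _
  · exact (h.comp_apply 2).deriv.neg
  · exact (h.comp_apply 1).deriv.sub ((h.comp_apply 0).const_mul _)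

lemma IsTest.gradK {φ : ℝ → ℂ} (h : IsTest φ) (k : ℝ) : IsTest (gradK k φ) := by
  refine IsTest.of_apply fun i => ?_
  fin_cases i
  · exact h.deriv
  · exact h.const_mul _
  · exact isTest_zero

lemma curlK_gradK {φ : ℝ → ℂ} (h : IsTest φ) (k : ℝ) : curlK k (gradK k φ) = 0 := by
  have hd : Differentiable ℝ φ := h.1.differentiable (by simp)
  funext x i
  fin_cases i
  · simp [curlK, gradK]
  · simp [curlK, gradK]
  · have : deriv (fun y => Complex.I * (k : ℂ) * φ y) x = Complex.I * k * deriv φ x :=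
      deriv_const_mul_field _
    simp [curlK, gradK, this]

lemma memLp_apply (u : L2C3) (i : Fin 3) : MemLp (fun x => u x i) 2 (volume : Measure ℝ) :=
  (Lp.memLp u).continuousLinearMap_comp (EuclideanSpace.proj (𝕜 := ℂ) i)

lemma integrable_pair (u : L2C3) {φ : ℝ → Fin 3 → ℂ} (h : IsTest φ) (i : Fin 3) :
    Integrable (fun x => u x i * φ x i) := by
  have h2 : MemLp (fun x => φ x i) 2 (volume : Measure ℝ) :=
    (h.comp_apply i).1.continuous.memLp_of_hasCompactSupport (h.comp_apply i).2
  exact (memLp_apply u i).integrable_mul h2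

lemma pair_eq_sum (u : L2C3) {φ : ℝ → Fin 3 → ℂ} (h : IsTest φ) :
    pair u φ = ∑ i, ∫ x, u x i * φ x i :=
  integral_finsetSum _ fun i _ => integrable_pair u h i

lemma pair_add (u v : L2C3) {φ : ℝ → Fin 3 → ℂ} (h : IsTest φ) :
    pair (u + v) φ = pair u φ + pair v φ := by
  have hi (w : L2C3) : Integrable (fun x => ∑ i, w x i * φ x i) :=
    integrable_finsetSum _ fun i _ => integrable_pair w h i
  unfold pair
  rw [← integral_add (hi u) (hi v)]
  refine integral_congr_ae ?_
  filter_upwards [Lp.coeFn_add u v] with x hx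
  rw [hx, ← Finset.sum_add_distrib]
  exact Finset.sum_congr rfl fun i _ => by rw [Pi.add_apply, PiLp.add_apply, add_mul]

lemma pair_smul (c : ℂ) (u : L2C3) (φ : ℝ → Fin 3 → ℂ) : pair (c • u) φ = c * pair u φ := by
  unfold pair
  rw [← integral_const_mul]
  refine integral_congr_ae ?_
  filter_upwards [Lp.coeFn_smul c u] with x hx
  simp [hx, mul_assoc, Finset.mul_sum]

lemma pair_zero_left (φ : ℝ → Fin 3 → ℂ) : pair 0 φ = 0 := by
  simpa using pair_smul 0 0 φ

lemma IsWeakCurl.add {k : ℝ} {u v u' v' : L2C3} (h : IsWeakCurl k u v) (h' : IsWeakCurl k u' v') :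
    IsWeakCurl k (u + u') (v + v') := fun φ hφ => by
  rw [pair_add _ _ (hφ.curlK _), pair_add _ _ hφ, h φ hφ, h' φ hφ]

lemma IsWeakCurl.smul {k : ℝ} {u v : L2C3} (c : ℂ) (h : IsWeakCurl k u v) :
    IsWeakCurl k (c • u) (c • v) := fun φ hφ => by
  rw [pair_smul, pair_smul, h φ hφ]

lemma isWeakCurl_zero (k : ℝ) : IsWeakCurl k 0 0 := fun φ _ => by
  rw [pair_zero_left, pair_zero_left]

lemma eq_zero_of_pair {v : L2C3} (h : ∀ φ, IsTest φ → pair v φ = 0) : v = 0 := by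
  have key (i : Fin 3) : ∀ᵐ x, v x i = 0 := by
    refine ae_eq_zero_of_integral_contDiff_smul_eq_zero
      ((memLp_apply v i).locallyIntegrable (by norm_num)) fun g hg hgc => ?_
    have hg1 : IsTest (fun x => (g x : ℂ)) :=
      ⟨Complex.ofRealCLM.contDiff.comp hg, hgc.comp_left (g := fun r : ℝ => (r : ℂ)) (by simp)⟩
    have ht : IsTest (fun x => (Pi.single i (g x : ℂ) : Fin 3 → ℂ)) := by
      refine IsTest.of_apply fun j => ?_
      by_cases hj : j = i
      · subst hj; simpa using hg1
      · simpa [Pi.single_apply, hj] using isTest_zero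
    have := h _ ht
    unfold pair at this
    rw [← this]
    refine integral_congr_ae (Eventually.of_forall fun x => ?_)
    simp [Pi.single_apply, mul_comm]
  rw [Lp.eq_zero_iff_ae_eq_zero]
  filter_upwards [ae_all_iff.2 key] with x hx
  ext i
  simpa using hx i

lemma IsWeakCurl.unique {k : ℝ} {u v w : L2C3} (h : IsWeakCurl k u v) (h' : IsWeakCurl k u w) :
    v = w := by
  rw [← sub_eq_zero]
  refine eq_zero_of_pair fun φ hφ => ?_
  have := (h.add (h'.smul (-1))) φ hφ
  have h0 : u + (-1 : ℂ) • u = 0 := by simp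
  have h1 : v + (-1 : ℂ) • w = v - w := by simp [sub_eq_add_neg]
  rw [h0, h1, pair_zero_left] at this
  exact this.symm

lemma IsWeakCurl.isDivFree {k : ℝ} {u v : L2C3} (h : IsWeakCurl k u v) : IsDivFree k v :=
  fun φ hφ => by
    rw [← h _ (hφ.gradK _), curlK_gradK hφ]
    simp [pair]

/-! ### The function spaces and the operators -/

/-- The range space `R_k = {f ∈ L²(ℝ, ℂ³) : ∇_k · f = 0}`, with the `L²` inner product. -/
def rangeSpace (k : ℝ) : Submodule ℂ L2C3 where
  carrier := {f | IsDivFree k f}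
  zero_mem' := fun φ _ => pair_zero_left _
  add_mem' := fun {f g} hf hg φ hφ => by
    rw [pair_add _ _ (hφ.gradK _), hf φ hφ, hg φ hφ, add_zero]
  smul_mem' := fun c f hf φ hφ => by rw [pair_smul, hf φ hφ, mul_zero]

/-- The piecewise constant function with value `a` on `x > 0` and `b` on `x < 0` (the value at the
null set `x = 0` plays no role). -/
noncomputable def pwConst (a b : ℂ) : ℝ → ℂ := fun x => if 0 < x then a else b

lemma memLp_pwConst_smul (a b : ℂ) (u : L2C3) :
    MemLp (fun x => pwConst a b x • u x) 2 (volume : Measure ℝ) := by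
  have hm : Measurable (pwConst a b) :=
    Measurable.ite measurableSet_Ioi measurable_const measurable_const
  refine MemLp.of_le_mul (c := ‖a‖ + ‖b‖) (Lp.memLp u)
    (hm.aestronglyMeasurable.smul (Lp.aestronglyMeasurable u)) (Eventually.of_forall fun x => ?_)
  rw [norm_smul]
  refine mul_le_mul_of_nonneg_right ?_ (norm_nonneg _)
  unfold pwConst
  split_ifs
  · linarith [norm_nonneg b]
  · linarith [norm_nonneg a]

/-- Multiplication by the piecewise constant function with values `a` on `x > 0`, `b` on `x < 0`. -/
noncomputable def mulPW (a b : ℂ) : L2C3 →ₗ[ℂ] L2C3 where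
  toFun u := (memLp_pwConst_smul a b u).toLp
  map_add' u v := by
    rw [← MemLp.toLp_add, MemLp.toLp_eq_toLp_iff]
    filter_upwards [Lp.coeFn_add u v] with x hx
    rw [hx, Pi.add_apply, Pi.add_apply, smul_add]
  map_smul' c u := by
    rw [RingHom.id_apply, ← MemLp.toLp_const_smul, MemLp.toLp_eq_toLp_iff]
    filter_upwards [Lp.coeFn_smul c u] with x hx
    simp [hx, smul_comm c]

lemma mulPW_mul (c a b : ℂ) (u : L2C3) : mulPW (c * a) (c * b) u = c • mulPW a b u := by
  change (memLp_pwConst_smul _ _ u).toLp = c • (memLp_pwConst_smul _ _ u).toLp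
  rw [← MemLp.toLp_const_smul, MemLp.toLp_eq_toLp_iff]
  refine Eventually.of_forall fun x => ?_
  by_cases hx : 0 < x <;> simp [pwConst, hx, mul_smul]

/-- The domain
`{u ∈ L² : ∇_k × u ∈ L², ∇_k × ∇_k × u ∈ L², ∇_k · (W̃ u) = 0}`,
where `W̃` equals `a` on `x > 0` and `b` on `x < 0`. -/
def domSpace (k : ℝ) (a b : ℂ) : Submodule ℂ L2C3 where
  carrier := {u | (∃ v w : L2C3, IsWeakCurl k u v ∧ IsWeakCurl k v w) ∧ IsDivFree k (mulPW a b u)}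
  zero_mem' := ⟨⟨0, 0, isWeakCurl_zero k, isWeakCurl_zero k⟩, by
    rw [map_zero]; exact (rangeSpace k).zero_mem⟩
  add_mem' := by
    rintro u u' ⟨⟨v, w, hv, hw⟩, hd⟩ ⟨⟨v', w', hv', hw'⟩, hd'⟩
    refine ⟨⟨v + v', w + w', hv.add hv', hw.add hw'⟩, ?_⟩
    rw [map_add]
    exact (rangeSpace k).add_mem hd hd'
  smul_mem' := by
    rintro c u ⟨⟨v, w, hv, hw⟩, hd⟩
    refine ⟨⟨c • v, c • w, hv.smul c, hw.smul c⟩, ?_⟩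
    rw [map_smul]
    exact (rangeSpace k).smul_mem c hd

lemma exists_curlCurl {k : ℝ} {a b : ℂ} (u : domSpace k a b) :
    ∃ w : L2C3, ∃ v : L2C3, IsWeakCurl k u v ∧ IsWeakCurl k v w :=
  let ⟨v, w, h⟩ := u.2.1
  ⟨w, v, h⟩

/-- `∇_k × ∇_k × u`, the unique `w` with `w = ∇_k × v`, `v = ∇_k × u` weakly. -/
noncomputable def curlCurl {k : ℝ} {a b : ℂ} (u : domSpace k a b) : L2C3 :=
  (exists_curlCurl u).choose

lemma curlCurl_eq {k : ℝ} {a b : ℂ} (u : domSpace k a b) {v w : L2C3}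
    (hv : IsWeakCurl k u v) (hw : IsWeakCurl k v w) : curlCurl u = w := by
  obtain ⟨v', hv', hw'⟩ := (exists_curlCurl u).choose_spec
  have : v' = v := hv'.unique hv
  subst this
  exact hw'.unique hw

lemma curlCurl_mem {k : ℝ} {a b : ℂ} (u : domSpace k a b) : curlCurl u ∈ rangeSpace k := by
  obtain ⟨v', _, hw'⟩ := (exists_curlCurl u).choose_spec
  exact hw'.isDivFree

/-- `∇_k × ∇_k ×` as an operator into the range space. -/
noncomputable def opA (k : ℝ) (a b : ℂ) : domSpace k a b →ₗ[ℂ] rangeSpace k where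
  toFun u := ⟨curlCurl u, curlCurl_mem u⟩
  map_add' u u' := by
    obtain ⟨v, hv, hw⟩ := (exists_curlCurl u).choose_spec
    obtain ⟨v', hv', hw'⟩ := (exists_curlCurl u').choose_spec
    exact Subtype.ext (curlCurl_eq (u + u') (hv.add hv') (hw.add hw'))
  map_smul' c u := by
    obtain ⟨v, hv, hw⟩ := (exists_curlCurl u).choose_spec
    exact Subtype.ext (curlCurl_eq (c • u) (hv.smul c) (hw.smul c))

/-- Multiplication by `W = c W̃` as an operator into the range space, where `W̃` equals `a` on
`x > 0` and `b` on `x < 0`. -/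
noncomputable def opB (k : ℝ) (c a b : ℂ) : domSpace k a b →ₗ[ℂ] rangeSpace k :=
  LinearMap.codRestrict (rangeSpace k) (mulPW (c * a) (c * b) ∘ₗ (domSpace k a b).subtype)
    fun u => by
      rw [LinearMap.comp_apply, Submodule.subtype_apply, mulPW_mul]
      exact (rangeSpace k).smul_mem c u.2.2

/-! ### The Maxwell pencil -/

/-- Two homogeneous, dispersive media in the half-lines `x > 0` and `x < 0`: the set `S` of
singular frequencies and the functions `W̃₊`, `W̃₋` on `ℂ \ S` (their values on `S` are never
used). -/
structure Media where
  S : Set ℂ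
  WtPlus : ℂ → ℂ
  WtMinus : ℂ → ℂ

namespace Media

variable (m : Media)

/-- `D(W̃) = ℂ \ S`. -/
def D : Set ℂ := m.Sᶜ

/-- `W₊(ω) = ω² W̃₊(ω)`. -/
def WPlus (ω : ℂ) : ℂ := ω ^ 2 * m.WtPlus ω

/-- `W₋(ω) = ω² W̃₋(ω)`. -/
def WMinus (ω : ℂ) : ℂ := ω ^ 2 * m.WtMinus ω

/-- The exceptional set `Ω₀`. -/
def Omega0 : Set ℂ := {ω | ω ∈ m.D ∧ (m.WPlus ω = 0 ∨ m.WMinus ω = 0)}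

/-- The pencil `L_k(ω; l) u = ∇_k × ∇_k × u - l W(x, ω) u`, `ω ∈ D(W̃)`. -/
noncomputable def pencil (k : ℝ) : OperatorPencil L2C3 (rangeSpace k) where
  Ω := m.D
  dom ω := domSpace k (m.WtPlus ω) (m.WtMinus ω)
  A ω := opA k (m.WtPlus ω) (m.WtMinus ω)
  B ω := opB k (ω ^ 2) (m.WtPlus ω) (m.WtMinus ω)

/-- `[k², ∞)` as a subset of `ℂ`. -/
def ray (k : ℝ) : Set ℂ := Complex.ofReal '' Set.Ici (k ^ 2)

open Classical in
/-- `[k², ∞)` if `k ≠ 0`, and `(0, ∞)` if `k = 0`, as a subset of `ℂ`. -/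
noncomputable def rayM (k : ℝ) : Set ℂ :=
  if k = 0 then Complex.ofReal '' Set.Ioi 0 else ray k

/-- `M₊^{(k)}`. -/
def MPlus (k : ℝ) : Set ℂ := {ω | ω ∈ m.D \ m.Omega0 ∧ m.WPlus ω ∈ rayM k}

/-- `M₋^{(k)}`. -/
def MMinus (k : ℝ) : Set ℂ := {ω | ω ∈ m.D \ m.Omega0 ∧ m.WMinus ω ∈ rayM k}

/-- `N^{(k)}`. -/
def N (k : ℝ) : Set ℂ :=
  {ω | ω ∈ m.D \ m.Omega0 ∧ m.WPlus ω ∉ ray k ∧ m.WMinus ω ∉ ray k ∧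
    (k : ℂ) ^ 2 * (m.WPlus ω + m.WMinus ω) = m.WPlus ω * m.WMinus ω}

end Media

end Maxwell1D

/-! Write the equation as a first order system: `v = ∇_k × u`, `∇_k × v = f + W u`. One row of each
curl contains no derivative, so for `W ≠ 0` the components `u 0` and `v 0` are eliminated
algebraically and two decoupled 2×2 systems `y' = α Y + F`, `Y' = β y + G` remain: the TM pair `(v
2, -u 1)` with `α = W` (`SolvesMaxwell.exists_tm`) and the TE pair `(u 2, -v 1)` with `α = 1`
(`SolvesMaxwell.exists_te`). In both `α β = k² - W`, a constant on each half-line. The divergence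
constraint costs nothing: away from `Ω₀` it follows from `div curl = 0`
(`exists_dom_of_solvesMaxwell`).

If `W₊` and `W₋` are off `[k², ∞)`, then `k² - W± = μ±²` with `Re μ± > 0`, and energy identities for
the diagonalized system control an `L²` solution on each half-line, up to its values at the
interface. These values solve a 2×2 linear system whose determinant is, up to sign, `D = μ₊ α₋ + μ₋
α₊` (`SolvesSystem.estimate`). The estimate makes the range closed, and its orthogonal complement
consists of solutions of the same homogeneous system, which is a Fredholm alternative
(`SolvesSystem.exists_of_orthogonal`). For TE, `D = μ₊ + μ₋ ≠ 0`. For TM, `D = 0` is exactly the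
relation defining `N` (`dispersion_iff`).

When `D ≠ 0` the point is in the resolvent set. When `D = 0` the kernel is spanned by an exponential
interface mode `u₀`, and the range is the kernel of the Green functional `Λ` of that mode; an
explicit integral shows `Λ (W u₀) ≠ 0`, which gives index zero and algebraic simplicity
(`SolvesMaxwell.resonant`). Replacing `W` by `l W` turns the relation into `k² (W₊ + W₋) = l W₊ W₋`,
which fails for `l ≠ 1`, so the eigenvalue is isolated.

If `W₊` or `W₋` lies on the ray, a conserved nonnegative energy excludes `L²` solutions
(`SolvesMaxwell.eq_zero_of_ray`), whereas TE wave packets escaping to infinity form a Weyl sequence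
(`mem_weylSpectrum`). For an injective operator a closed range would give a lower bound by the open
mapping theorem (`exists_bound_of_hasClosedRange`), which the Weyl sequence contradicts. Hence the
range is not closed, and the point lies in all five essential spectra. -/

namespace Maxwell1D

/-! ### Primitives of locally integrable functions -/

/-- `y` is a primitive of the locally integrable function `f`. -/
def IsPrimitive (y f : ℝ → ℂ) : Prop :=
  LocallyIntegrable f ∧ ∀ a b, y b - y a = ∫ x in a..b, f x

lemma intervalIntegrable_of_locallyIntegrable {f : ℝ → ℂ} (hf : LocallyIntegrable f) (a b : ℝ) :
    IntervalIntegrable f volume a b :=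
  (hf.integrableOn_isCompact isCompact_uIcc).intervalIntegrable

lemma absolutelyContinuousOnInterval_of_dist_le {F : Type*} [PseudoMetricSpace F] {y : ℝ → F}
    {g : ℝ → ℝ} {a b : ℝ} (hg : AbsolutelyContinuousOnInterval g a b)
    (h : ∀ s t, dist (y s) (y t) ≤ dist (g s) (g t)) : AbsolutelyContinuousOnInterval y a b := by
  rw [absolutelyContinuousOnInterval_iff] at hg ⊢
  intro ε hε
  obtain ⟨δ, hδ, H⟩ := hg ε hε
  exact ⟨δ, hδ, fun E hE hE' =>
    (Finset.sum_le_sum fun i _ => h _ _).trans_lt (H E hE hE')⟩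

namespace IsPrimitive

variable {y z f g : ℝ → ℂ}

lemma intervalIntegrable (h : IsPrimitive y f) (a b : ℝ) : IntervalIntegrable f volume a b :=
  intervalIntegrable_of_locallyIntegrable h.1 a b

lemma eq_add (h : IsPrimitive y f) (a x : ℝ) : y x = y a + ∫ t in a..x, f t := by
  rw [← h.2]; ring

lemma of_locallyIntegrable (hf : LocallyIntegrable f) (c : ℝ) :
    IsPrimitive (fun x => ∫ t in c..x, f t) f :=
  ⟨hf, fun a b => intervalIntegral.integral_interval_sub_left
    (intervalIntegrable_of_locallyIntegrable hf c b) (intervalIntegrable_of_locallyIntegrable hf c a)⟩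

/-- The increments of `y` are dominated by those of the primitive of `‖f‖`. -/
lemma ac (h : IsPrimitive y f) (a b : ℝ) : AbsolutelyContinuousOnInterval y a b := by
  have hn : ∀ a b, IntervalIntegrable (fun x => ‖f x‖) volume a b :=
    fun a b => (h.intervalIntegrable a b).norm
  refine absolutelyContinuousOnInterval_of_dist_le
    ((hn a b).absolutelyContinuousOnInterval_intervalIntegral (c := a) Set.left_mem_uIcc) ?_
  intro s t
  rw [dist_eq_norm, h.2, dist_eq_norm,
    intervalIntegral.integral_interval_sub_left (hn a s) (hn a t), Real.norm_eq_abs]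
  exact intervalIntegral.norm_integral_le_abs_integral_norm

lemma continuous (h : IsPrimitive y f) : Continuous y := by
  have : y = fun x => y 0 + ∫ t in (0 : ℝ)..x, f t := funext fun x => h.eq_add 0 x
  rw [this]
  exact continuous_const.add (intervalIntegral.continuous_primitive h.intervalIntegrable 0)

lemma ae_hasDerivAt (h : IsPrimitive y f) : ∀ᵐ x, HasDerivAt y (f x) x := by
  filter_upwards [_root_.LocallyIntegrable.ae_hasDerivAt_integral h.1] with x hx
  have : y = fun x => y 0 + ∫ t in (0 : ℝ)..x, f t := funext fun x => h.eq_add 0 x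
  rw [this]
  exact (hx 0).const_add _

/-- The difference of `y` and the primitive of `f` is absolutely continuous with derivative zero
almost everywhere, hence constant. -/
lemma of_ac (hf : LocallyIntegrable f) (hac : ∀ a b, AbsolutelyContinuousOnInterval y a b)
    (hd : ∀ᵐ x, HasDerivAt y (f x) x) : IsPrimitive y f := by
  refine ⟨hf, fun a b => ?_⟩
  have hP := of_locallyIntegrable hf a
  obtain ⟨C, hC⟩ := ((hac a b).sub (hP.ac a b)).const_of_ae_hasDerivAt_zero (by
    filter_upwards [hd, hP.ae_hasDerivAt] with x h1 h2 _
    simpa using h1.sub h2)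
  have h1 := hC a Set.left_mem_uIcc
  have h2 := hC b Set.right_mem_uIcc
  simp only [Pi.sub_apply, intervalIntegral.integral_same, sub_zero] at h1 h2
  rw [← h1] at h2
  linear_combination h2

/-- All integrations by parts below rest on this product rule, which needs no more than locally
integrable derivatives. -/
lemma mul (hy : IsPrimitive y f) (hz : IsPrimitive z g) :
    IsPrimitive (fun x => y x * z x) (fun x => f x * z x + y x * g x) := by
  refine of_ac ?_ (fun a b => (hy.ac a b).smul (hz.ac a b)) ?_
  · refine LocallyIntegrable.add ?_ ?_
    · rw [← locallyIntegrableOn_univ] at *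
      exact (locallyIntegrableOn_univ.2 hy.1).mul_continuousOn hz.continuous.continuousOn isOpen_univ.isLocallyClosed
    · rw [← locallyIntegrableOn_univ] at *
      exact (locallyIntegrableOn_univ.2 hz.1).continuousOn_mul hy.continuous.continuousOn isOpen_univ.isLocallyClosed
  · filter_upwards [hy.ae_hasDerivAt, hz.ae_hasDerivAt] with x h1 h2
    exact h1.mul h2

lemma add (hy : IsPrimitive y f) (hz : IsPrimitive z g) :
    IsPrimitive (fun x => y x + z x) (fun x => f x + g x) := by
  refine ⟨hy.1.add hz.1, fun a b => ?_⟩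
  rw [intervalIntegral.integral_add (hy.intervalIntegrable a b) (hz.intervalIntegrable a b),
    ← hy.2, ← hz.2]
  ring

lemma const_mul (c : ℂ) (hy : IsPrimitive y f) :
    IsPrimitive (fun x => c * y x) (fun x => c * f x) := by
  refine ⟨hy.1.smul c, fun a b => ?_⟩
  rw [intervalIntegral.integral_const_mul, ← hy.2]
  ring

lemma conj (hy : IsPrimitive y f) :
    IsPrimitive (fun x => starRingEnd ℂ (y x)) (fun x => starRingEnd ℂ (f x)) := by
  refine ⟨?_, fun a b => ?_⟩
  · intro x
    obtain ⟨s, hs, h⟩ := hy.1 x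
    exact ⟨s, hs, (Complex.conjCLE : ℂ →L[ℝ] ℂ).integrable_comp h⟩
  · rw [← map_sub, hy.2]
    exact (((Complex.conjCLE : ℂ →L[ℝ] ℂ)).intervalIntegral_comp_comm
      (hy.intervalIntegrable a b)).symm

lemma congr (hy : IsPrimitive y f) (h : f =ᵐ[volume] g) : IsPrimitive y g :=
  ⟨hy.1.congr h, fun a b => by
    rw [hy.2]
    exact intervalIntegral.integral_congr_ae (h.mono fun x hx _ => hx)⟩

lemma comp_neg (hy : IsPrimitive y f) : IsPrimitive (fun x => y (-x)) (fun x => -f (-x)) := by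
  refine ⟨?_, fun a b => ?_⟩
  · refine LocallyIntegrable.neg ?_
    intro x
    obtain ⟨s, hs, h⟩ := hy.1 (-x)
    refine ⟨Neg.neg ⁻¹' s, continuous_neg.continuousAt.preimage_mem_nhds hs, ?_⟩
    exact ((Measure.measurePreserving_neg (volume : Measure ℝ)).integrableOn_comp_preimage
      (Homeomorph.neg ℝ).measurableEmbedding).2 h
  · rw [intervalIntegral.integral_neg, intervalIntegral.integral_comp_neg, ← hy.2]
    ring

/-- The exceptional point is the interface, where the exponential mode has a kink. -/
lemma of_hasDerivAt_off (hc : Continuous y) (hf : LocallyIntegrable f)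
    (hd : ∀ x, x ≠ 0 → HasDerivAt y (f x) x) : IsPrimitive y f :=
  ⟨hf, fun a b => (integral_eq_of_hasDerivAt_off_countable y f (Set.countable_singleton (0 : ℝ))
    hc.continuousOn (fun x hx => hd x (by simpa using hx.2))
    (intervalIntegrable_of_locallyIntegrable hf a b)).symm⟩

/-- Integrability of `f` gives `y` a limit at infinity, and an integrable function on a half-line of
infinite measure can only have the limit zero. -/
lemma integral_Ioi (hy : IsPrimitive y f) (hyi : IntegrableOn y (Set.Ioi 0))
    (hfi : IntegrableOn f (Set.Ioi 0)) : ∫ x in Set.Ioi 0, f x = - y 0 := by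
  have h1 := intervalIntegral_tendsto_integral_Ioi 0 hfi tendsto_id
  have h2 : Tendsto y atTop (𝓝 (y 0 + ∫ x in Set.Ioi 0, f x)) :=
    (h1.const_add (y 0)).congr fun x => (hy.eq_add 0 x).symm
  have h3 : y 0 + ∫ x in Set.Ioi 0, f x = 0 := by
    refine IntegrableAtFilter.eq_zero_of_tendsto (μ := volume) ⟨Set.Ioi 0, Ioi_mem_atTop 0, hyi⟩ ?_ h2
    intro s hs
    obtain ⟨b, hb⟩ := mem_atTop_sets.1 hs
    exact top_le_iff.1 ((Real.volume_Ici (a := b)).symm.le.trans (measure_mono hb))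
  linear_combination h3

lemma integral_Iio (hy : IsPrimitive y f) (hyi : IntegrableOn y (Set.Iio 0))
    (hfi : IntegrableOn f (Set.Iio 0)) : ∫ x in Set.Iio 0, f x = y 0 := by
  have hn : ∀ g : ℝ → ℂ, IntegrableOn g (Set.Iio 0) → IntegrableOn (fun x => g (-x)) (Set.Ioi 0) :=
    fun g hg => IntegrableOn.comp_neg_Ioi (by rwa [neg_zero])
  have := hy.comp_neg.integral_Ioi (hn y hyi) (hn f hfi).neg
  rw [integral_neg, neg_zero] at this
  have h2 := integral_comp_neg_Ioi (0 : ℝ) f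
  rw [neg_zero, integral_Iic_eq_integral_Iio] at h2
  rw [← h2]
  exact neg_injective this

lemma integral_eq_zero (hy : IsPrimitive y f) (hyi : Integrable y) (hfi : Integrable f) :
    ∫ x, f x = 0 := by
  rw [← integral_add_compl measurableSet_Ioi (s := Set.Ioi (0 : ℝ)) hfi, Set.compl_Ioi,
    integral_Iic_eq_integral_Iio, hy.integral_Ioi hyi.integrableOn hfi.integrableOn,
    hy.integral_Iio hyi.integrableOn hfi.integrableOn]
  ring

end IsPrimitive

end Maxwell1D

namespace Maxwell1D

/-! ### Weak derivatives -/

/-- `f` is the distributional derivative of `y`. -/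
def IsWeakDeriv (y f : ℝ → ℂ) : Prop :=
  ∀ φ : ℝ → ℂ, IsTest φ → ∫ x, y x * _root_.deriv φ x = - ∫ x, f x * φ x

lemma IsTest.hasDerivAt {φ : ℝ → ℂ} (h : IsTest φ) (x : ℝ) : HasDerivAt φ (_root_.deriv φ x) x :=
  (h.1.differentiable (by simp) x).hasDerivAt

lemma IsTest.locallyIntegrable {φ : ℝ → ℂ} (h : IsTest φ) : LocallyIntegrable φ :=
  h.1.continuous.locallyIntegrable

lemma IsTest.isPrimitive {φ : ℝ → ℂ} (h : IsTest φ) : IsPrimitive φ (_root_.deriv φ) :=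
  .of_hasDerivAt_off h.1.continuous h.deriv.locallyIntegrable fun x _ => h.hasDerivAt x

lemma IsTest.integrable {φ : ℝ → ℂ} (h : IsTest φ) : Integrable φ :=
  h.1.continuous.integrable_of_hasCompactSupport h.2

lemma IsTest.integrable_mul {φ y : ℝ → ℂ} (h : IsTest φ) (hy : LocallyIntegrable y) :
    Integrable (fun x => y x * φ x) := by
  have := hy.integrable_smul_right_of_hasCompactSupport h.1.continuous h.2
  simpa using this

lemma IsPrimitive.isWeakDeriv {y f : ℝ → ℂ} (h : IsPrimitive y f) : IsWeakDeriv y f := by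
  intro φ hφ
  have hy : LocallyIntegrable y := h.continuous.locallyIntegrable
  have h1 := (h.mul hφ.isPrimitive).integral_eq_zero (hφ.integrable_mul hy)
    ((hφ.integrable_mul h.1).add (hφ.deriv.integrable_mul hy))
  rw [integral_add (hφ.integrable_mul h.1) (hφ.deriv.integrable_mul hy)] at h1
  linear_combination h1

lemma exists_isTest_integral_eq_one : ∃ ρ : ℝ → ℂ, IsTest ρ ∧ ∫ x, ρ x = 1 := by
  let b : ContDiffBump (0 : ℝ) := default
  refine ⟨fun x => (b.normed volume x : ℂ),
    ⟨Complex.ofRealCLM.contDiff.comp b.contDiff_normed,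
      b.hasCompactSupport_normed.comp_left (g := fun r : ℝ => (r : ℂ)) (by simp)⟩, ?_⟩
  rw [integral_complex_ofReal, b.integral_normed, Complex.ofReal_one]

/-- The antiderivative starting left of the support is zero there, and it is zero right of the
support because the total integral vanishes. -/
lemma IsTest.exists_deriv_eq {χ : ℝ → ℂ} (h : IsTest χ) (h0 : ∫ x, χ x = 0) :
    ∃ ψ, IsTest ψ ∧ _root_.deriv ψ = χ := by
  obtain ⟨R, hR⟩ := h.2.isCompact.isBounded.subset_closedBall (0 : ℝ)
  have hz : ∀ x, R < |x| → χ x = 0 := fun x hx => by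
    refine image_eq_zero_of_notMem_tsupport fun hx' => ?_
    have := hR hx'
    simp only [mem_closedBall_zero_iff, Real.norm_eq_abs] at this
    linarith
  have hd : ∀ x, HasDerivAt (fun x => ∫ t in (-R)..x, χ t) (χ x) x := fun x =>
    intervalIntegral.integral_hasDerivAt_right (h.1.continuous.intervalIntegrable _ _)
      (h.1.continuous.stronglyMeasurableAtFilter _ _) h.1.continuous.continuousAt
  have hd' : _root_.deriv (fun x => ∫ t in (-R)..x, χ t) = χ := funext fun x => (hd x).deriv
  refine ⟨fun x => ∫ t in (-R)..x, χ t, ⟨?_, ?_⟩, hd'⟩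
  · rw [contDiff_infty_iff_deriv, hd']
    exact ⟨fun x => (hd x).differentiableAt, h.1⟩
  · refine HasCompactSupport.intro (isCompact_Icc (a := -R) (b := R)) fun x hx => ?_
    rcases lt_or_ge x (-R) with hx1 | hx1
    · rw [intervalIntegral.integral_symm, intervalIntegral.integral_of_le hx1.le,
        setIntegral_congr_ae (g := fun _ => 0) measurableSet_Ioc]
      · simp
      · filter_upwards [Measure.ae_ne volume (-R)] with t ht1 ht2
        refine hz t ?_
        rw [lt_abs]
        right
        have := lt_of_le_of_ne ht2.2 ht1
        linarith
    · have hx2 : R < x := by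
        by_contra hc
        exact hx ⟨hx1, not_lt.1 hc⟩
      rw [intervalIntegral.integral_of_le hx1, ← h0]
      refine setIntegral_eq_integral_of_ae_compl_eq_zero ?_
      filter_upwards [Measure.ae_ne volume (-R)] with t ht1 ht2
      refine hz t ?_
      rw [lt_abs]
      rcases lt_or_ge (-R) t with h1 | h1
      · left
        by_contra hc
        exact ht2 ⟨h1, by linarith⟩
      · right
        have := lt_of_le_of_ne h1 ht1
        linarith

lemma ae_eq_zero_of_forall_isTest {y : ℝ → ℂ} (hy : LocallyIntegrable y)
    (h : ∀ φ, IsTest φ → ∫ x, y x * φ x = 0) : ∀ᵐ x, y x = 0 := by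
  refine ae_eq_zero_of_integral_contDiff_smul_eq_zero hy fun g hg hgc => ?_
  rw [← h (fun x => (g x : ℂ)) ⟨Complex.ofRealCLM.contDiff.comp hg,
    hgc.comp_left (g := fun r : ℝ => (r : ℂ)) (by simp)⟩]
  exact integral_congr_ae (Eventually.of_forall fun x => by simp [mul_comm])

/-- The du Bois-Reymond argument: for a test function `ρ` of integral one, `φ - (∫ φ) ρ` has
integral zero and so is the derivative of a test function. Testing with it shows that `y` acts on
`φ` as the constant `∫ y ρ`. -/
lemma ae_eq_const_of_isWeakDeriv_zero {y : ℝ → ℂ} (hy : LocallyIntegrable y)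
    (h : IsWeakDeriv y 0) : ∃ c, ∀ᵐ x, y x = c := by
  obtain ⟨ρ, hρ, hρ1⟩ := exists_isTest_integral_eq_one
  refine ⟨∫ x, y x * ρ x, ?_⟩
  have hyc : LocallyIntegrable (fun x => y x - ∫ x, y x * ρ x) :=
    hy.sub (locallyIntegrable_const _)
  suffices h0 : ∀ φ, IsTest φ → ∫ x, (y x - ∫ x, y x * ρ x) * φ x = 0 from
    (ae_eq_zero_of_forall_isTest hyc h0).mono fun x hx => sub_eq_zero.1 hx
  intro φ hφ
  have hχ := hφ.sub (hρ.const_mul (∫ x, φ x))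
  obtain ⟨ψ, hψ, hψ'⟩ := hχ.exists_deriv_eq (by
    rw [integral_sub hφ.integrable (hρ.const_mul _).integrable, integral_const_mul, hρ1]; ring)
  have h1 := h ψ hψ
  rw [hψ'] at h1
  have e1 : ∫ x, y x * (φ x - (∫ x, φ x) * ρ x) =
      (∫ x, y x * φ x) - (∫ x, φ x) * ∫ x, y x * ρ x := by
    rw [← integral_const_mul, ← integral_sub (hφ.integrable_mul hy)
      ((hρ.integrable_mul hy).const_mul _)]
    exact integral_congr_ae (Eventually.of_forall fun x => by ring)
  have e2 : ∫ x, (y x - ∫ x, y x * ρ x) * φ x =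
      (∫ x, y x * φ x) - (∫ x, y x * ρ x) * ∫ x, φ x := by
    rw [← integral_const_mul, ← integral_sub (hφ.integrable_mul hy) (hφ.integrable.const_mul _)]
    exact integral_congr_ae (Eventually.of_forall fun x => by ring)
  rw [e2]
  rw [e1] at h1
  simp only [Pi.zero_apply, zero_mul, integral_zero, neg_zero] at h1
  linear_combination h1

/-- Supplies the continuous representative; only for it do values at the interface make sense. -/
lemma IsWeakDeriv.exists_isPrimitive {y f : ℝ → ℂ} (h : IsWeakDeriv y f)
    (hy : LocallyIntegrable y) (hf : LocallyIntegrable f) :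
    ∃ z, z =ᵐ[volume] y ∧ IsPrimitive z f := by
  have hP := IsPrimitive.of_locallyIntegrable hf 0
  have hPl : LocallyIntegrable (fun x => ∫ t in (0 : ℝ)..x, f t) := hP.continuous.locallyIntegrable
  obtain ⟨c, hc⟩ := ae_eq_const_of_isWeakDeriv_zero (hy.sub hPl) (fun φ hφ => by
    have h1 := h φ hφ
    have h2 := hP.isWeakDeriv φ hφ
    simp only [Pi.sub_apply, sub_mul, Pi.zero_apply, zero_mul, integral_zero, neg_zero]
    rw [integral_sub (hφ.deriv.integrable_mul hy) (hφ.deriv.integrable_mul hPl), h1, h2, sub_self])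
  refine ⟨fun x => c + ∫ t in (0 : ℝ)..x, f t, ?_, hf, fun a b => ?_⟩
  · filter_upwards [hc] with x hx
    rw [← hx]
    simp
  · rw [← hP.2 a b]; ring

lemma IsWeakDeriv.congr {y y' f f' : ℝ → ℂ} (h : IsWeakDeriv y f) (hy : y =ᵐ[volume] y')
    (hf : f =ᵐ[volume] f') : IsWeakDeriv y' f' := fun φ hφ => by
  rw [integral_congr_ae (hy.symm.mono fun x hx => by simp only [hx] : (fun x => y' x * _root_.deriv φ x)
    =ᵐ[volume] fun x => y x * _root_.deriv φ x), h φ hφ]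
  congr 1
  exact integral_congr_ae (hf.mono fun x hx => by simp only [hx])

end Maxwell1D

namespace Maxwell1D

/-! ### Energy estimates for first order systems on half-lines -/

lemma _root_.MeasureTheory.MemLp.integrable_norm_sq {μ : Measure ℝ} {f : ℝ → ℂ}
    (h : MemLp f 2 μ) : Integrable (fun x => ‖f x‖ ^ 2) μ :=
  (memLp_two_iff_integrable_sq_norm h.1).1 h

lemma norm_lincomb_sq_le (a b x y : ℂ) :
    ‖a * x + b * y‖ ^ 2 ≤ 2 * (‖a‖ ^ 2 + ‖b‖ ^ 2) * (‖x‖ ^ 2 + ‖y‖ ^ 2) := by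
  have h1 : ‖a * x + b * y‖ ≤ ‖a‖ * ‖x‖ + ‖b‖ * ‖y‖ := by
    simpa using norm_add_le (a * x) (b * y)
  have h2 : ‖a * x + b * y‖ ^ 2 ≤ (‖a‖ * ‖x‖ + ‖b‖ * ‖y‖) ^ 2 := by gcongr
  refine h2.trans ?_
  nlinarith [sq_nonneg (‖a‖ * ‖x‖ - ‖b‖ * ‖y‖), sq_nonneg (‖a‖ * ‖y‖), sq_nonneg (‖b‖ * ‖x‖),
    sq_nonneg (‖a‖ * ‖x‖), sq_nonneg (‖b‖ * ‖y‖)]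

/-- The energy identity for `g' = l g + h` on the half-line `x > 0`. -/
lemma IsPrimitive.energy_Ioi {g f h : ℝ → ℂ} {l : ℂ} (hg : IsPrimitive g f)
    (hf : ∀ x ∈ Set.Ioi (0 : ℝ), f x = l * g x + h x)
    (hg2 : MemLp g 2 (volume.restrict (Set.Ioi 0)))
    (hh2 : MemLp h 2 (volume.restrict (Set.Ioi 0))) :
    ‖g 0‖ ^ 2 + 2 * l.re * ∫ x in Set.Ioi 0, ‖g x‖ ^ 2 =
      - ∫ x in Set.Ioi 0, 2 * (h x * starRingEnd ℂ (g x)).re := by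
  have hgc : MemLp (fun x => starRingEnd ℂ (g x)) 2 (volume.restrict (Set.Ioi 0)) := hg2.star
  have hi1 : IntegrableOn (fun x => ‖g x‖ ^ 2) (Set.Ioi 0) := hg2.integrable_norm_sq
  have hi2 : IntegrableOn (fun x => (h x * starRingEnd ℂ (g x))) (Set.Ioi 0) :=
    hh2.integrable_mul hgc
  have hi3 : IntegrableOn (fun x => 2 * (h x * starRingEnd ℂ (g x)).re) (Set.Ioi 0) :=
    hi2.re.const_mul 2
  have hi4 : IntegrableOn (fun x => 2 * l.re * ‖g x‖ ^ 2 + 2 * (h x * starRingEnd ℂ (g x)).re)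
    (Set.Ioi 0) := (hi1.const_mul _).add hi3
  have heq : Set.EqOn (fun x => f x * starRingEnd ℂ (g x) + g x * starRingEnd ℂ (f x))
      (fun x => ((2 * l.re * ‖g x‖ ^ 2 + 2 * (h x * starRingEnd ℂ (g x)).re : ℝ) : ℂ))
      (Set.Ioi 0) := fun x hx => by
    have e1 : g x * starRingEnd ℂ (g x) = ((‖g x‖ ^ 2 : ℝ) : ℂ) := by
      rw [Complex.mul_conj, Complex.normSq_eq_norm_sq]
    have e2 : (2 * l.re : ℂ) = l + starRingEnd ℂ l := (Complex.add_conj l).symm ▸ by push_cast; rfl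
    have e3 : (2 * (h x * starRingEnd ℂ (g x)).re : ℂ) =
        h x * starRingEnd ℂ (g x) + starRingEnd ℂ (h x * starRingEnd ℂ (g x)) :=
      (Complex.add_conj _).symm ▸ by push_cast; rfl
    simp only [Complex.ofReal_add, Complex.ofReal_mul, Complex.ofReal_ofNat]
    rw [e3, e2, ← e1, hf x hx]
    simp only [map_add, map_mul, Complex.conj_conj]
    ring
  have key := (hg.mul hg.conj).integral_Ioi (hg2.integrable_mul hgc)
    ((integrableOn_congr_fun heq measurableSet_Ioi).2 hi4.ofReal)
  rw [setIntegral_congr_fun measurableSet_Ioi heq, integral_complex_ofReal, Complex.mul_conj,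
    Complex.normSq_eq_norm_sq, ← Complex.ofReal_neg, Complex.ofReal_inj,
    integral_add (hi1.const_mul _) hi3, integral_const_mul] at key
  linarith

lemma neg_two_re_mul_conj_le {m : ℝ} (hm : 0 < m) (a b : ℂ) :
    |2 * (a * starRingEnd ℂ b).re| ≤ m * ‖b‖ ^ 2 + m⁻¹ * ‖a‖ ^ 2 := by
  have h1 : |(a * starRingEnd ℂ b).re| ≤ ‖a‖ * ‖b‖ := by
    simpa using Complex.abs_re_le_norm (a * starRingEnd ℂ b)
  rw [abs_mul, abs_two]
  have h2 : m * ‖b‖ ^ 2 + m⁻¹ * ‖a‖ ^ 2 - 2 * (‖a‖ * ‖b‖) = m⁻¹ * (m * ‖b‖ - ‖a‖) ^ 2 := by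
    field_simp
    ring
  have h3 : 0 ≤ m⁻¹ * (m * ‖b‖ - ‖a‖) ^ 2 := by positivity
  linarith

/-- The weight `m` comes from Young's inequality. It will be `|Re l|`, so that the integral of
`‖g‖²` on the right absorbs only half of the one on the left. -/
lemma IsPrimitive.energy_Ioi_le {g f h : ℝ → ℂ} {l : ℂ} {m : ℝ} (hm : 0 < m)
    (hg : IsPrimitive g f) (hf : ∀ x ∈ Set.Ioi (0 : ℝ), f x = l * g x + h x)
    (hg2 : MemLp g 2 (volume.restrict (Set.Ioi 0)))
    (hh2 : MemLp h 2 (volume.restrict (Set.Ioi 0))) :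
    |‖g 0‖ ^ 2 + 2 * l.re * ∫ x in Set.Ioi 0, ‖g x‖ ^ 2| ≤
      m * (∫ x in Set.Ioi 0, ‖g x‖ ^ 2) + m⁻¹ * ∫ x in Set.Ioi 0, ‖h x‖ ^ 2 := by
  rw [hg.energy_Ioi hf hg2 hh2, abs_neg, ← integral_const_mul, ← integral_const_mul,
    ← integral_add (hg2.integrable_norm_sq.const_mul _) (hh2.integrable_norm_sq.const_mul _)]
  refine (abs_integral_le_integral_abs).trans (integral_mono_of_nonneg ?_ ?_ ?_)
  · exact Eventually.of_forall fun x => abs_nonneg _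
  · exact (hg2.integrable_norm_sq.const_mul _).add (hh2.integrable_norm_sq.const_mul _)
  · exact Eventually.of_forall fun x => neg_two_re_mul_conj_le hm _ _

/-- `y' = α Y + F`, `Y' = β y + G` on the set `s`, with square integrable `y`, `Y`, `F`, `G`. -/
structure SolvesOn (s : Set ℝ) (α β : ℂ) (y Y F G : ℝ → ℂ) : Prop where
  exists_isPrimitive : ∃ f g, IsPrimitive y f ∧ IsPrimitive Y g ∧
    (∀ x ∈ s, f x = α * Y x + F x) ∧ ∀ x ∈ s, g x = β * y x + G x
  memLp_fst : MemLp y 2 (volume.restrict s)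
  memLp_snd : MemLp Y 2 (volume.restrict s)
  memLp_rhs_fst : MemLp F 2 (volume.restrict s)
  memLp_rhs_snd : MemLp G 2 (volume.restrict s)

lemma memLp_comp_neg {f : ℝ → ℂ} (h : MemLp f 2 (volume.restrict (Set.Iio 0))) :
    MemLp (fun x => f (-x)) 2 (volume.restrict (Set.Ioi 0)) := by
  have h1 : MeasurePreserving (Neg.neg : ℝ → ℝ) (volume.restrict (Set.Ioi 0))
      (volume.restrict (Set.Iio 0)) := by
    have := (Measure.measurePreserving_neg (volume : Measure ℝ)).restrict_preimage
      (measurableSet_Iio (a := (0 : ℝ)))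
    simpa using this
  exact h.comp_measurePreserving h1

/-- Both derivatives change sign under `x ↦ -x`; changing the sign of `Y` as well restores `α` and
`β`, so results on the right half-line also serve on the left one. -/
lemma SolvesOn.reflect {α β : ℂ} {y Y F G : ℝ → ℂ} (h : SolvesOn (Set.Iio 0) α β y Y F G) :
    SolvesOn (Set.Ioi 0) α β (fun x => y (-x)) (fun x => - Y (-x)) (fun x => - F (-x))
      (fun x => G (-x)) := by
  obtain ⟨f, g, hy, hY, hf, hg⟩ := h.exists_isPrimitive
  refine ⟨⟨fun x => - f (-x), fun x => g (-x), hy.comp_neg, ?_, fun x hx => ?_, fun x hx => ?_⟩,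
    memLp_comp_neg h.2, (memLp_comp_neg h.3).neg, (memLp_comp_neg h.4).neg, memLp_comp_neg h.5⟩
  · simpa using hY.comp_neg.const_mul (-1)
  · change -f (-x) = _
    rw [hf (-x) (by simpa using hx)]; ring
  · exact hg (-x) (by simpa using hx)

/-- The estimates on the half-line `x > 0` for a system with an exponential dichotomy. -/
lemma SolvesOn.estimate_Ioi {α β μ : ℂ} (hα : α ≠ 0) (hμ : 0 < μ.re) (hβ : α * β = μ ^ 2) :
    ∃ C : ℝ, 0 ≤ C ∧ ∀ y Y F G : ℝ → ℂ, SolvesOn (Set.Ioi 0) α β y Y F G →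
      ‖μ * y 0 + α * Y 0‖ ^ 2 ≤ C * ∫ x in Set.Ioi 0, (‖F x‖ ^ 2 + ‖G x‖ ^ 2) ∧
      ∫ x in Set.Ioi 0, (‖y x‖ ^ 2 + ‖Y x‖ ^ 2) ≤
        C * (‖y 0‖ ^ 2 + ‖Y 0‖ ^ 2 + ∫ x in Set.Ioi 0, (‖F x‖ ^ 2 + ‖G x‖ ^ 2)) := by
  have hμ0 : μ ≠ 0 := fun h => by simp [h] at hμ
  set m := μ.re with hm
  set K := 2 * (‖μ‖ ^ 2 + ‖α‖ ^ 2) with hK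
  set K' := 2 * (‖(2 * μ)⁻¹‖ ^ 2 + ‖(2 * μ)⁻¹‖ ^ 2) + 2 * (‖(2 * α)⁻¹‖ ^ 2 + ‖(2 * α)⁻¹‖ ^ 2)
    with hK'
  have hK0 : 0 ≤ K := by positivity
  have hK0' : 0 ≤ K' := by positivity
  -- The first summand bounds the interface value (`g1`); the rest is `K'` times the coefficients
  -- collected from `g3` and `g4`.
  refine ⟨m⁻¹ * K + K' * (m⁻¹ * (m⁻¹ * K) + m⁻¹ * K + m⁻¹ * (m⁻¹ * K)), by positivity, ?_⟩
  intro y Y F G hs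
  obtain ⟨f, f', hy, hY, hf, hf'⟩ := hs.exists_isPrimitive
  have hlc : ∀ (a b : ℂ) {u v : ℝ → ℂ}, MemLp u 2 (volume.restrict (Set.Ioi 0)) →
      MemLp v 2 (volume.restrict (Set.Ioi 0)) →
      MemLp (fun x => a * u x + b * v x) 2 (volume.restrict (Set.Ioi 0)) :=
    fun a b u v hu hv => (hu.const_mul a).add (hv.const_mul b)
  -- Since `α β = μ²`, the combinations `μ y + α Y` and `-μ y + α Y` satisfy scalar equations with
  -- rates `μ` and `-μ`. For the growing one the energy identity bounds both its value at `0` and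
  -- its norm by the data; for the decaying one the value at `0` must be given.
  have hg := (hy.const_mul μ).add (hY.const_mul α)
  have hh := (hy.const_mul (-μ)).add (hY.const_mul α)
  have hg2 := hlc μ α hs.2 hs.3
  have hh2 := hlc (-μ) α hs.2 hs.3
  have hr2 := hlc μ α hs.4 hs.5
  have hq2 := hlc (-μ) α hs.4 hs.5
  have eg := hg.energy_Ioi_le (l := μ) (h := fun x => μ * F x + α * G x) hμ (fun x hx => by
    rw [hf x hx, hf' x hx]; linear_combination y x * hβ) hg2 hr2
  have eh := hh.energy_Ioi_le (l := -μ) (h := fun x => -μ * F x + α * G x) hμ (fun x hx => by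
    rw [hf x hx, hf' x hx]; linear_combination y x * hβ) hh2 hq2
  have hFG : IntegrableOn (fun x => ‖F x‖ ^ 2 + ‖G x‖ ^ 2) (Set.Ioi 0) :=
    hs.4.integrable_norm_sq.add hs.5.integrable_norm_sq
  have hr : ∀ σ : ℂ, ‖σ‖ = ‖μ‖ → ∫ x in Set.Ioi 0, ‖σ * F x + α * G x‖ ^ 2 ≤
      K * ∫ x in Set.Ioi 0, (‖F x‖ ^ 2 + ‖G x‖ ^ 2) := fun σ hσ => by
    rw [← integral_const_mul]
    refine integral_mono (hlc σ α hs.4 hs.5).integrable_norm_sq (hFG.const_mul _) fun x => ?_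
    simp only [hK, ← hσ]
    exact norm_lincomb_sq_le _ _ _ _
  have hr1 := hr μ rfl
  have hr1' := hr (-μ) (norm_neg _)
  have hyY : ∫ x in Set.Ioi 0, (‖y x‖ ^ 2 + ‖Y x‖ ^ 2) ≤
      K' * ((∫ x in Set.Ioi 0, ‖μ * y x + α * Y x‖ ^ 2) +
        ∫ x in Set.Ioi 0, ‖-μ * y x + α * Y x‖ ^ 2) := by
    rw [← integral_add hg2.integrable_norm_sq hh2.integrable_norm_sq, ← integral_const_mul]
    refine integral_mono (hs.2.integrable_norm_sq.add hs.3.integrable_norm_sq)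
      ((hg2.integrable_norm_sq.add hh2.integrable_norm_sq).const_mul _) fun x => ?_
    have e1 : y x = (2 * μ)⁻¹ * (μ * y x + α * Y x) + -(2 * μ)⁻¹ * (-μ * y x + α * Y x) := by
      field_simp; ring
    have e2 : Y x = (2 * α)⁻¹ * (μ * y x + α * Y x) + (2 * α)⁻¹ * (-μ * y x + α * Y x) := by
      field_simp; ring
    have i1 := norm_lincomb_sq_le (2 * μ)⁻¹ (-(2 * μ)⁻¹) (μ * y x + α * Y x) (-μ * y x + α * Y x)
    have i2 := norm_lincomb_sq_le (2 * α)⁻¹ ((2 * α)⁻¹) (μ * y x + α * Y x) (-μ * y x + α * Y x)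
    rw [← e1, norm_neg] at i1
    rw [← e2] at i2
    simp only [hK', add_mul]
    linarith
  have h0 := norm_lincomb_sq_le (-μ) α (y 0) (Y 0)
  rw [norm_neg] at h0
  rw [Complex.neg_re, ← hm] at eh
  rw [← hm] at eg
  set A := ∫ x in Set.Ioi 0, ‖μ * y x + α * Y x‖ ^ 2
  set B := ∫ x in Set.Ioi 0, ‖-μ * y x + α * Y x‖ ^ 2
  set R := ∫ x in Set.Ioi 0, (‖F x‖ ^ 2 + ‖G x‖ ^ 2)
  have hA0 : 0 ≤ A := integral_nonneg fun x => by positivity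
  have hB0 : 0 ≤ B := integral_nonneg fun x => by positivity
  have hR0 : 0 ≤ R := integral_nonneg fun x => by positivity
  have hmi : 0 < m⁻¹ := by positivity
  have g1 : ‖μ * y 0 + α * Y 0‖ ^ 2 + m * A ≤ m⁻¹ * (K * R) := by
    have := (abs_le.1 eg).2
    have := mul_le_mul_of_nonneg_left hr1 hmi.le
    linarith
  have g2 : m * B ≤ K * (‖y 0‖ ^ 2 + ‖Y 0‖ ^ 2) + m⁻¹ * (K * R) := by
    have := (abs_le.1 eh).1
    have := mul_le_mul_of_nonneg_left hr1' hmi.le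
    linarith
  have g3 : A ≤ m⁻¹ * (m⁻¹ * (K * R)) := by
    rw [← div_eq_inv_mul, le_div_iff₀ hμ]
    nlinarith [sq_nonneg ‖μ * y 0 + α * Y 0‖]
  have g4 : B ≤ m⁻¹ * (K * (‖y 0‖ ^ 2 + ‖Y 0‖ ^ 2) + m⁻¹ * (K * R)) := by
    rw [← div_eq_inv_mul, le_div_iff₀ hμ]
    linarith
  have hN : 0 ≤ ‖y 0‖ ^ 2 + ‖Y 0‖ ^ 2 := by positivity
  set N := ‖y 0‖ ^ 2 + ‖Y 0‖ ^ 2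
  constructor
  · have : 0 ≤ K' * (m⁻¹ * (m⁻¹ * K) + m⁻¹ * K + m⁻¹ * (m⁻¹ * K)) * R := by positivity
    have : 0 ≤ m * A := by positivity
    linarith
  · refine hyY.trans ((mul_le_mul_of_nonneg_left (add_le_add g3 g4) hK0').trans ?_)
    have p1 : 0 ≤ m⁻¹ * K * (N + R) := by positivity
    have p2 : 0 ≤ K' * (m⁻¹ * (m⁻¹ * K) + m⁻¹ * (m⁻¹ * K)) * N := by positivity
    have p3 : 0 ≤ K' * (m⁻¹ * K) * R := by positivity
    linarith

/-- A square integrable solution of an oscillatory or degenerate homogeneous system on the half-line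
`x > 0` vanishes. -/
lemma SolvesOn.eq_zero_of_oscillatory {α β : ℂ} {κ : ℝ} (hα : α ≠ 0) (hβ : α * β = -(κ : ℂ) ^ 2)
    {y Y : ℝ → ℂ} (h : SolvesOn (Set.Ioi 0) α β y Y 0 0) :
    ∀ x, 0 ≤ x → y x = 0 ∧ Y x = 0 := by
  obtain ⟨f, g, hy, hY, hf, hg⟩ := h.exists_isPrimitive
  have hαY := hY.const_mul α
  have hcint : ∀ {u : ℝ → ℂ}, MemLp u 2 (volume.restrict (Set.Ioi 0)) →
      IntegrableOn (fun x => u x * starRingEnd ℂ (u x)) (Set.Ioi 0) :=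
    fun hu => hu.integrable_mul hu.star
  -- An integrable function that is constant on the half-line vanishes there; this is applied to
  -- conserved quantities.
  have van : ∀ {P p : ℝ → ℂ}, IsPrimitive P p → IntegrableOn P (Set.Ioi 0) →
      (∀ x ∈ Set.Ioi (0 : ℝ), p x = 0) → ∀ x, 0 ≤ x → P x = 0 := by
    intro P p hP hPi hp x hx
    have e : Set.EqOn p 0 (Set.Ioi 0) := hp
    have h0 := hP.integral_Ioi hPi
      ((integrableOn_congr_fun e measurableSet_Ioi).2 integrableOn_zero)
    rw [setIntegral_congr_fun measurableSet_Ioi e] at h0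
    have h1 : P 0 = 0 := by simpa using h0.symm
    rw [hP.eq_add 0 x, h1, intervalIntegral.integral_of_le hx,
      setIntegral_congr_fun measurableSet_Ioc (e.mono Set.Ioc_subset_Ioi_self)]
    simp
  -- The energy `κ² |y|² + |α Y|²` is conserved because `α β = -κ²` is real and nonpositive.
  have hE := van (((hy.mul hy.conj).const_mul ((κ : ℂ) ^ 2)).add (hαY.mul hαY.conj))
    (((hcint h.2).const_mul _).add (hcint (h.3.const_mul α))) (fun x hx => by
      have e : α * g x = -(κ : ℂ) ^ 2 * y x := by
        rw [hg x hx, ← hβ]; simp only [Pi.zero_apply]; ring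
      rw [e, hf x hx]
      simp only [Pi.zero_apply, map_add, map_mul, map_neg, map_pow, Complex.conj_ofReal, map_zero]
      ring)
  have hE' : ∀ x, 0 ≤ x → κ ^ 2 * ‖y x‖ ^ 2 + ‖α * Y x‖ ^ 2 = 0 := fun x hx => by
    have := hE x hx
    rw [Complex.mul_conj, Complex.mul_conj, Complex.normSq_eq_norm_sq,
      Complex.normSq_eq_norm_sq] at this
    exact_mod_cast this
  have hY0 : ∀ x, 0 ≤ x → Y x = 0 := fun x hx => by
    have h1 := hE' x hx
    have h2 : 0 ≤ κ ^ 2 * ‖y x‖ ^ 2 := by positivity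
    have h3 : ‖α * Y x‖ ^ 2 = 0 := le_antisymm (by linarith) (by positivity)
    simpa [hα] using h3
  refine fun x hx => ⟨?_, hY0 x hx⟩
  -- For `κ = 0` the energy sees only `Y`; then `Y = 0` makes `y` constant, and `|y|²` is the
  -- conserved quantity.
  by_cases hκ : κ = 0
  · have := van (hy.mul hy.conj) (hcint h.2) (fun x hx => by
      rw [hf x hx, hY0 x (le_of_lt hx)]; simp) x hx
    simpa using this
  · have := hE' x hx
    rw [hY0 x hx] at this
    simpa [hκ] using this

/-- The half-line estimate with zero data bounds the norm by zero, and continuity turns the almost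
everywhere statement into a pointwise one. -/
lemma SolvesOn.eq_zero_of_dichotomy {α β μ : ℂ} (hα : α ≠ 0) (hμ : 0 < μ.re)
    (hβ : α * β = μ ^ 2) {y Y : ℝ → ℂ} (h : SolvesOn (Set.Ioi 0) α β y Y 0 0) (hy : y 0 = 0)
    (hY : Y 0 = 0) : ∀ x, 0 ≤ x → y x = 0 ∧ Y x = 0 := by
  obtain ⟨f, g, hy', hY', -, -⟩ := h.exists_isPrimitive
  obtain ⟨C, -, hC⟩ := SolvesOn.estimate_Ioi hα hμ hβ
  have h1 := (hC y Y 0 0 h).2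
  simp only [hy, hY, Pi.zero_apply, norm_zero, ne_eq, OfNat.ofNat_ne_zero, not_false_eq_true,
    zero_pow, add_zero, integral_zero, mul_zero] at h1
  have hi : IntegrableOn (fun x => ‖y x‖ ^ 2 + ‖Y x‖ ^ 2) (Set.Ioi 0) :=
    h.2.integrable_norm_sq.add h.3.integrable_norm_sq
  have h2 := (integral_eq_zero_iff_of_nonneg (fun x => by positivity) hi).1
    (le_antisymm h1 (integral_nonneg fun x => by positivity))
  have hc : Continuous fun x => ‖y x‖ ^ 2 + ‖Y x‖ ^ 2 := by
    have := hy'.continuous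
    have := hY'.continuous
    fun_prop
  have h3 := Measure.eqOn_open_of_ae_eq (U := Set.Ioi (0 : ℝ)) h2 isOpen_Ioi hc.continuousOn
    continuousOn_const
  intro x hx
  rcases hx.eq_or_lt with rfl | hx
  · exact ⟨hy, hY⟩
  · have h4 : ‖y x‖ ^ 2 + ‖Y x‖ ^ 2 = 0 := h3 hx
    have h5 : 0 ≤ ‖y x‖ ^ 2 := by positivity
    have h6 : 0 ≤ ‖Y x‖ ^ 2 := by positivity
    constructor
    · have : ‖y x‖ ^ 2 = 0 := by linarith
      simpa using this
    · have : ‖Y x‖ ^ 2 = 0 := by linarith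
      simpa using this

end Maxwell1D

namespace Maxwell1D

/-! ### First order systems with piecewise constant coefficients on the line -/

/-- `y' = A Y + F`, `Y' = B y + G` on the line, with square integrable `y`, `Y`, `F`, `G`. -/
structure SolvesSystem (A B y Y F G : ℝ → ℂ) : Prop where
  fst : IsPrimitive y (fun x => A x * Y x + F x)
  snd : IsPrimitive Y (fun x => B x * y x + G x)
  memLp_fst : MemLp y 2
  memLp_snd : MemLp Y 2
  memLp_rhs_fst : MemLp F 2
  memLp_rhs_snd : MemLp G 2

namespace SolvesSystem

variable {A B y Y F G y' Y' F' G' : ℝ → ℂ}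

lemma add (h : SolvesSystem A B y Y F G) (h' : SolvesSystem A B y' Y' F' G') :
    SolvesSystem A B (fun x => y x + y' x) (fun x => Y x + Y' x) (fun x => F x + F' x)
      (fun x => G x + G' x) := by
  refine ⟨?_, ?_, h.3.add h'.3, h.4.add h'.4, h.5.add h'.5, h.6.add h'.6⟩
  · convert h.1.add h'.1 using 2; ring
  · convert h.2.add h'.2 using 2; ring

lemma const_mul (c : ℂ) (h : SolvesSystem A B y Y F G) :
    SolvesSystem A B (fun x => c * y x) (fun x => c * Y x) (fun x => c * F x)
      (fun x => c * G x) := by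
  refine ⟨?_, ?_, h.3.const_mul c, h.4.const_mul c, h.5.const_mul c, h.6.const_mul c⟩
  · convert h.1.const_mul c using 2; ring
  · convert h.2.const_mul c using 2; ring

lemma congr_rhs (h : SolvesSystem A B y Y F G) (hF : F =ᵐ[volume] F') (hG : G =ᵐ[volume] G') :
    SolvesSystem A B y Y F' G' :=
  ⟨h.1.congr (hF.mono fun x hx => by simp only [hx]),
    h.2.congr (hG.mono fun x hx => by simp only [hx]), h.3, h.4, h.5.ae_eq hF, h.6.ae_eq hG⟩

lemma solvesOn_Ioi {αp αm βp βm : ℂ}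
    (h : SolvesSystem (pwConst αp αm) (pwConst βp βm) y Y F G) :
    SolvesOn (Set.Ioi 0) αp βp y Y F G :=
  ⟨⟨_, _, h.1, h.2, fun x hx => by simp [pwConst, Set.mem_Ioi.1 hx],
    fun x hx => by simp [pwConst, Set.mem_Ioi.1 hx]⟩, h.3.restrict _, h.4.restrict _,
    h.5.restrict _, h.6.restrict _⟩

lemma solvesOn_Iio {αp αm βp βm : ℂ}
    (h : SolvesSystem (pwConst αp αm) (pwConst βp βm) y Y F G) :
    SolvesOn (Set.Iio 0) αm βm y Y F G :=
  ⟨⟨_, _, h.1, h.2, fun x hx => by simp [pwConst, (Set.mem_Iio.1 hx).le.not_gt],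
    fun x hx => by simp [pwConst, (Set.mem_Iio.1 hx).le.not_gt]⟩, h.3.restrict _, h.4.restrict _,
    h.5.restrict _, h.6.restrict _⟩

/-- The a priori estimate. The quantity `μp * αm + μm * αp` vanishes iff the homogeneous system has
a nontrivial square integrable solution; such a solution does not vanish at the interface. -/
lemma estimate {αp αm βp βm μp μm : ℂ} (hαp : αp ≠ 0) (hαm : αm ≠ 0) (hμp : 0 < μp.re)
    (hμm : 0 < μm.re) (hβp : αp * βp = μp ^ 2) (hβm : αm * βm = μm ^ 2) :
    ∃ C : ℝ, 0 ≤ C ∧ ∀ y Y F G : ℝ → ℂ,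
      SolvesSystem (pwConst αp αm) (pwConst βp βm) y Y F G →
      (μp * αm + μm * αp ≠ 0 ∨ y 0 = 0) →
      ∫ x, (‖y x‖ ^ 2 + ‖Y x‖ ^ 2) ≤ C * ∫ x, (‖F x‖ ^ 2 + ‖G x‖ ^ 2) := by
  obtain ⟨Cp, hCp, Hp⟩ := SolvesOn.estimate_Ioi hαp hμp hβp
  obtain ⟨Cm, hCm, Hm⟩ := SolvesOn.estimate_Ioi hαm hμm hβm
  set D := μp * αm + μm * αp with hD
  -- the values at the interface
  obtain ⟨K, hK, HK⟩ : ∃ K : ℝ, 0 ≤ K ∧ ∀ a b : ℂ, (D ≠ 0 ∨ a = 0) →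
      ‖a‖ ^ 2 + ‖b‖ ^ 2 ≤ K * (‖μp * a + αp * b‖ ^ 2 + ‖μm * a - αm * b‖ ^ 2) := by
    by_cases hD0 : D = 0
    · refine ⟨‖αp⁻¹‖ ^ 2, by positivity, fun a b h => ?_⟩
      have ha : a = 0 := h.resolve_left (not_not.2 hD0)
      subst ha
      have hb : ‖b‖ ^ 2 = ‖αp⁻¹‖ ^ 2 * ‖αp * b‖ ^ 2 := by
        rw [← mul_pow, ← norm_mul, inv_mul_cancel_left₀ hαp]
      simp only [norm_zero, mul_zero, zero_add, zero_sub, norm_neg]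
      rw [mul_add, ← hb]
      have : 0 ≤ ‖αp⁻¹‖ ^ 2 * ‖αm * b‖ ^ 2 := by positivity
      simpa using this
    -- Cramer's rule for recovering `a` and `b` from `μp a + αp b` and `μm a - αm b`, a system of
    -- determinant `-D`.
    · refine ⟨2 * (‖αm / D‖ ^ 2 + ‖αp / D‖ ^ 2) + 2 * (‖μm / D‖ ^ 2 + ‖-μp / D‖ ^ 2),
        by positivity, fun a b _ => ?_⟩
      have i1 := norm_lincomb_sq_le (αm / D) (αp / D) (μp * a + αp * b) (μm * a - αm * b)
      have i2 := norm_lincomb_sq_le (μm / D) (-μp / D) (μp * a + αp * b) (μm * a - αm * b)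
      have e1 : αm / D * (μp * a + αp * b) + αp / D * (μm * a - αm * b) = a := by
        field_simp; rw [hD]; ring
      have e2 : μm / D * (μp * a + αp * b) + -μp / D * (μm * a - αm * b) = b := by
        field_simp; rw [hD]; ring
      rw [e1] at i1
      rw [e2] at i2
      rw [add_mul]
      exact add_le_add i1 i2
  refine ⟨Cp * (K * (Cp + Cm) + 1) + Cm * (K * (Cp + Cm) + 1), by positivity, ?_⟩
  intro y Y F G h h0
  obtain ⟨p1, p2⟩ := Hp y Y F G h.solvesOn_Ioi
  -- Reflection turns the controlled combination on the left into `μm y - αm Y` at the interface.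
  obtain ⟨m1, m2⟩ := Hm _ _ _ _ h.solvesOn_Iio.reflect
  simp only [norm_neg, neg_zero, mul_neg, ← sub_eq_add_neg] at m1 m2
  have refl : ∀ u v : ℝ → ℂ, ∫ x in Set.Ioi 0, (‖u (-x)‖ ^ 2 + ‖v (-x)‖ ^ 2) =
      ∫ x in Set.Iio 0, (‖u x‖ ^ 2 + ‖v x‖ ^ 2) := fun u v => by
    have := integral_comp_neg_Ioi (0 : ℝ) (fun x => ‖u x‖ ^ 2 + ‖v x‖ ^ 2)
    rwa [neg_zero, integral_Iic_eq_integral_Iio] at this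
  have spl : ∀ u v : ℝ → ℂ, MemLp u 2 → MemLp v 2 → ∫ x, (‖u x‖ ^ 2 + ‖v x‖ ^ 2) =
      (∫ x in Set.Ioi 0, (‖u x‖ ^ 2 + ‖v x‖ ^ 2)) + ∫ x in Set.Iio 0, (‖u x‖ ^ 2 + ‖v x‖ ^ 2) :=
    fun u v hu hv => by
      have hi : Integrable (fun x => ‖u x‖ ^ 2 + ‖v x‖ ^ 2) :=
        hu.integrable_norm_sq.add hv.integrable_norm_sq
      rw [← integral_add_compl measurableSet_Ioi (s := Set.Ioi (0 : ℝ)) hi, Set.compl_Ioi,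
        integral_Iic_eq_integral_Iio]
  rw [refl] at m1 m2
  rw [refl] at m2
  rw [spl y Y h.3 h.4, spl F G h.5 h.6]
  have hb := HK (y 0) (Y 0) h0
  set N := ‖y 0‖ ^ 2 + ‖Y 0‖ ^ 2
  set P := ∫ x in Set.Ioi 0, (‖F x‖ ^ 2 + ‖G x‖ ^ 2)
  set Q := ∫ x in Set.Iio 0, (‖F x‖ ^ 2 + ‖G x‖ ^ 2)
  have hP : 0 ≤ P := integral_nonneg fun x => by positivity
  have hQ : 0 ≤ Q := integral_nonneg fun x => by positivity
  have q1 : N ≤ K * (Cp + Cm) * (P + Q) := by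
    refine hb.trans ?_
    rw [mul_assoc]
    refine mul_le_mul_of_nonneg_left ?_ hK
    have : 0 ≤ Cp * Q := by positivity
    have : 0 ≤ Cm * P := by positivity
    linarith
  have q2 : N + P ≤ (K * (Cp + Cm) + 1) * (P + Q) := by linarith
  have q3 : N + Q ≤ (K * (Cp + Cm) + 1) * (P + Q) := by linarith
  have q4 := mul_le_mul_of_nonneg_left q2 hCp
  have q5 := mul_le_mul_of_nonneg_left q3 hCm
  linarith

lemma ae_eq_zero {αp αm βp βm μp μm : ℂ} (hαp : αp ≠ 0) (hαm : αm ≠ 0) (hμp : 0 < μp.re)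
    (hμm : 0 < μm.re) (hβp : αp * βp = μp ^ 2) (hβm : αm * βm = μm ^ 2)
    (h : SolvesSystem (pwConst αp αm) (pwConst βp βm) y Y 0 0)
    (h0 : μp * αm + μm * αp ≠ 0 ∨ y 0 = 0) : y =ᵐ[volume] 0 ∧ Y =ᵐ[volume] 0 := by
  obtain ⟨C, -, hC⟩ := estimate hαp hαm hμp hμm hβp hβm
  have h1 := hC y Y 0 0 h h0
  simp only [Pi.zero_apply, norm_zero, ne_eq, OfNat.ofNat_ne_zero, not_false_eq_true,
    zero_pow, add_zero, integral_zero, mul_zero] at h1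
  have hi : Integrable (fun x => ‖y x‖ ^ 2 + ‖Y x‖ ^ 2) :=
    h.3.integrable_norm_sq.add h.4.integrable_norm_sq
  have h2 := (integral_eq_zero_iff_of_nonneg (fun x => by positivity) hi).1
    (le_antisymm h1 (integral_nonneg fun x => by positivity))
  have h3 : ∀ᵐ x, y x = 0 ∧ Y x = 0 := by
    filter_upwards [h2] with x hx
    have h4 : ‖y x‖ ^ 2 + ‖Y x‖ ^ 2 = 0 := hx
    have h5 : 0 ≤ ‖y x‖ ^ 2 := by positivity
    have h6 : 0 ≤ ‖Y x‖ ^ 2 := by positivity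
    constructor
    · have : ‖y x‖ ^ 2 = 0 := by linarith
      simpa using this
    · have : ‖Y x‖ ^ 2 = 0 := by linarith
      simpa using this
  exact ⟨h3.mono fun x hx => hx.1, h3.mono fun x hx => hx.2⟩

/-- Green's formula. -/
lemma integral_sub_eq_zero (h : SolvesSystem A B y Y F G) {u v : ℝ → ℂ}
    (h' : SolvesSystem A B u v 0 0) : ∫ x, (F x * v x - G x * u x) = 0 := by
  have key := (h.1.mul h'.2).add ((h.2.mul h'.1).const_mul (-1))
  refine (integral_congr_ae (Eventually.of_forall fun x => ?_)).trans
    (key.integral_eq_zero ((h.3.integrable_mul h'.4).add ((h.4.integrable_mul h'.3).const_mul _))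
    (((h.5.integrable_mul h'.4).sub (h.6.integrable_mul h'.3)).congr
      (Eventually.of_forall fun x => ?_)))
  all_goals
    simp only [Pi.zero_apply, Pi.sub_apply, Pi.mul_apply]
    ring

lemma reflect {αp αm βp βm : ℂ}
    (h : SolvesSystem (pwConst αp αm) (pwConst βp βm) y Y 0 0) :
    SolvesSystem (pwConst αm αp) (pwConst βm βp) (fun x => y (-x)) (fun x => - Y (-x)) 0 0 := by
  have hn : ∀ {u : ℝ → ℂ}, MemLp u 2 → MemLp (fun x => u (-x)) 2 := fun hu =>
    hu.comp_measurePreserving (Measure.measurePreserving_neg volume)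
  have hpw : ∀ a b : ℂ, ∀ᵐ x, pwConst a b (-x) = pwConst b a x := fun a b => by
    filter_upwards [Measure.ae_ne volume (0 : ℝ)] with x hx
    unfold pwConst
    rcases lt_or_gt_of_ne hx with h | h
    · simp [h, h.le.not_gt]
    · simp [h, h.le]
  refine ⟨h.1.comp_neg.congr ?_, ?_, hn h.3, (hn h.4).neg, MemLp.zero, MemLp.zero⟩
  · filter_upwards [hpw αp αm] with x hx
    simp [hx]
  · refine (by simpa using h.2.comp_neg.const_mul (-1) :
      IsPrimitive (fun x => - Y (-x)) _).congr ?_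
    filter_upwards [hpw βp βm] with x hx
    simp [hx]

/-- Square integrable solutions of the homogeneous system vanish if the system is oscillatory or
degenerate on `x > 0`. -/
lemma eq_zero_of_oscillatory {αp αm βp βm : ℂ} {κ : ℝ} (hαp : αp ≠ 0) (hαm : αm ≠ 0)
    (hβp : αp * βp = -(κ : ℂ) ^ 2)
    (hβm : (∃ μ : ℂ, 0 < μ.re ∧ αm * βm = μ ^ 2) ∨ ∃ κ : ℝ, αm * βm = -(κ : ℂ) ^ 2)
    (h : SolvesSystem (pwConst αp αm) (pwConst βp βm) y Y 0 0) : y = 0 ∧ Y = 0 := by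
  have hp := h.solvesOn_Ioi.eq_zero_of_oscillatory hαp hβp
  have hr : SolvesOn (Set.Ioi 0) αm βm (fun x => y (-x)) (fun x => - Y (-x)) 0 0 := by
    have := h.solvesOn_Iio.reflect
    simpa using! this
  -- Vanishing on the right gives zero Cauchy data at the interface, which suffices when the left
  -- side has a dichotomy; otherwise the left side is excluded by its own energy.
  have hm : ∀ x, 0 ≤ x → y (-x) = 0 ∧ -Y (-x) = 0 := by
    rcases hβm with ⟨μ, hμ, hβm⟩ | ⟨κ', hβm⟩
    · exact hr.eq_zero_of_dichotomy hαm hμ hβm (by simpa using (hp 0 le_rfl).1)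
        (by simpa using (hp 0 le_rfl).2)
    · exact hr.eq_zero_of_oscillatory hαm hβm
  constructor
  · funext x
    rcases le_total 0 x with hx | hx
    · exact (hp x hx).1
    · simpa using (hm (-x) (by linarith)).1
  · funext x
    rcases le_total 0 x with hx | hx
    · exact (hp x hx).2
    · simpa using (hm (-x) (by linarith)).2

end SolvesSystem

end Maxwell1D

namespace Maxwell1D

/-! ### Solvability of first order systems in `L²` -/

/-- `L²(ℝ, ℂ)`. -/
abbrev L2C : Type := Lp ℂ 2 (volume : Measure ℝ)

lemma norm_sq_eq_integral (u : L2C) : ‖u‖ ^ 2 = ∫ x, ‖u x‖ ^ 2 := by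
  have h := inner_self_eq_norm_sq_to_K (𝕜 := ℂ) u
  rw [L2.inner_def] at h
  have h2 : ∫ x, inner ℂ (u x) (u x) = ((∫ x, ‖u x‖ ^ 2 : ℝ) : ℂ) := by
    rw [← integral_complex_ofReal]
    refine integral_congr_ae (Eventually.of_forall fun x => ?_)
    simp [inner_self_eq_norm_sq_to_K]
  rw [h2] at h
  refine Complex.ofReal_injective (h.trans ?_).symm
  push_cast
  rfl

/-- The bilinear pairing `u ↦ ∫ u ψ`. -/
noncomputable def pairing (ψ : L2C) : L2C →L[ℂ] ℂ := innerSL ℂ (star ψ)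

lemma pairing_apply (ψ u : L2C) : pairing ψ u = ∫ x, u x * ψ x := by
  rw [pairing, innerSL_apply_apply, L2.inner_def]
  refine integral_congr_ae ?_
  filter_upwards [Lp.coeFn_star ψ] with x hx
  simp [hx]

lemma pairing_toLp {ψ : ℝ → ℂ} (hψ : MemLp ψ 2) (u : L2C) :
    pairing hψ.toLp u = ∫ x, u x * ψ x := by
  rw [pairing_apply]
  refine integral_congr_ae ?_
  filter_upwards [hψ.coeFn_toLp] with x hx
  rw [hx]

lemma IsTest.memLp {φ : ℝ → ℂ} (h : IsTest φ) : MemLp φ 2 :=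
  h.1.continuous.memLp_of_hasCompactSupport h.2

lemma memLp_pwConst_mul (a b : ℂ) {f : ℝ → ℂ} (hf : MemLp f 2) :
    MemLp (fun x => pwConst a b x * f x) 2 := by
  have hm : Measurable (pwConst a b) :=
    Measurable.ite measurableSet_Ioi measurable_const measurable_const
  refine MemLp.of_le_mul (c := ‖a‖ + ‖b‖) hf
    (hm.aestronglyMeasurable.mul hf.1) (Eventually.of_forall fun x => ?_)
  rw [norm_mul]
  refine mul_le_mul_of_nonneg_right ?_ (norm_nonneg _)
  unfold pwConst
  split_ifs
  · linarith [norm_nonneg b]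
  · linarith [norm_nonneg a]

lemma _root_.MeasureTheory.MemLp.locallyIntegrable_of_two {f : ℝ → ℂ} (hf : MemLp f 2) :
    LocallyIntegrable f := hf.locallyIntegrable (by norm_num)

/-- Pairs of square integrable functions. -/
abbrev L2Pair : Type := WithLp 2 (L2C × L2C)

/-- The functional `(u, p) ↦ ∫ (u₁ φ' + a u₂ φ + p₁ φ)`. -/
noncomputable def fstFunctional (a b : ℂ) (φ : {φ : ℝ → ℂ // IsTest φ}) :
    L2Pair × L2Pair →L[ℂ] ℂ :=
  (pairing φ.2.deriv.memLp.toLp ∘L WithLp.fstL 2 ℂ L2C L2C +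
    pairing (memLp_pwConst_mul a b φ.2.memLp).toLp ∘L WithLp.sndL 2 ℂ L2C L2C) ∘L
      ContinuousLinearMap.fst ℂ L2Pair L2Pair +
  (pairing φ.2.memLp.toLp ∘L WithLp.fstL 2 ℂ L2C L2C) ∘L ContinuousLinearMap.snd ℂ L2Pair L2Pair

/-- The functional `(u, p) ↦ ∫ (u₂ φ' + a u₁ φ + p₂ φ)`. -/
noncomputable def sndFunctional (a b : ℂ) (φ : {φ : ℝ → ℂ // IsTest φ}) :
    L2Pair × L2Pair →L[ℂ] ℂ :=
  (pairing φ.2.deriv.memLp.toLp ∘L WithLp.sndL 2 ℂ L2C L2C +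
    pairing (memLp_pwConst_mul a b φ.2.memLp).toLp ∘L WithLp.fstL 2 ℂ L2C L2C) ∘L
      ContinuousLinearMap.fst ℂ L2Pair L2Pair +
  (pairing φ.2.memLp.toLp ∘L WithLp.sndL 2 ℂ L2C L2C) ∘L ContinuousLinearMap.snd ℂ L2Pair L2Pair

/-- The graph of the weak form of the system `u₁' = A u₂ + p₁`, `u₂' = B u₁ + p₂`, with
`A = pwConst αp αm` and `B = pwConst βp βm`. -/
noncomputable def systemGraph (αp αm βp βm : ℂ) : Submodule ℂ (L2Pair × L2Pair) :=
  (⨅ φ, (fstFunctional αp αm φ).ker) ⊓ ⨅ φ, (sndFunctional βp βm φ).ker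

lemma isClosed_systemGraph (αp αm βp βm : ℂ) :
    IsClosed (systemGraph αp αm βp βm : Set (L2Pair × L2Pair)) := by
  simp only [systemGraph, Submodule.coe_inf, Submodule.coe_iInf]
  exact (isClosed_iInter fun φ => (fstFunctional αp αm φ).isClosed_ker).inter
    (isClosed_iInter fun φ => (sndFunctional βp βm φ).isClosed_ker)

/-- For fixed `φ` each condition is the vanishing of a bounded functional of `(y, Y, F)`; this is
what makes `systemGraph` closed. -/
lemma isWeakDeriv_iff (a b : ℂ) (y Y F : L2C) :
    IsWeakDeriv y (fun x => pwConst a b x * Y x + F x) ↔ ∀ φ : {φ : ℝ → ℂ // IsTest φ},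
      pairing φ.2.deriv.memLp.toLp y + pairing (memLp_pwConst_mul a b φ.2.memLp).toLp Y +
        pairing φ.2.memLp.toLp F = 0 := by
  rw [IsWeakDeriv, Subtype.forall]
  refine forall₂_congr fun φ hφ => ?_
  have i1 : Integrable (fun x => Y x * (pwConst a b x * φ x)) :=
    (Lp.memLp Y).integrable_mul (memLp_pwConst_mul a b hφ.memLp)
  have i2 : Integrable (fun x => F x * φ x) := (Lp.memLp F).integrable_mul hφ.memLp
  rw [pairing_toLp, pairing_toLp, pairing_toLp, eq_neg_iff_add_eq_zero, add_assoc,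
    ← integral_add i1 i2]
  have : ∀ x, (pwConst a b x * Y x + F x) * φ x = Y x * (pwConst a b x * φ x) + F x * φ x :=
    fun x => by ring
  simp only [this]

lemma mem_systemGraph {αp αm βp βm : ℂ} {q : L2Pair × L2Pair} :
    q ∈ systemGraph αp αm βp βm ↔
      IsWeakDeriv q.1.fst (fun x => pwConst αp αm x * q.1.snd x + q.2.fst x) ∧
        IsWeakDeriv q.1.snd (fun x => pwConst βp βm x * q.1.fst x + q.2.snd x) := by
  rw [isWeakDeriv_iff, isWeakDeriv_iff, systemGraph, Submodule.mem_inf, Submodule.mem_iInf,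
    Submodule.mem_iInf]
  rfl

/-- Translates between `L²` classes, where limits are taken, and continuous representatives, where
the interface condition is imposed. -/
lemma mem_systemGraph_iff_exists {αp αm βp βm : ℂ} {q : L2Pair × L2Pair} :
    q ∈ systemGraph αp αm βp βm ↔ ∃ y Y : ℝ → ℂ, y =ᵐ[volume] q.1.fst ∧ Y =ᵐ[volume] q.1.snd ∧
      SolvesSystem (pwConst αp αm) (pwConst βp βm) y Y q.2.fst q.2.snd := by
  rw [mem_systemGraph]
  constructor
  · rintro ⟨h1, h2⟩
    have l1 := (memLp_pwConst_mul αp αm (Lp.memLp q.1.snd)).add (Lp.memLp q.2.fst)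
    have l2 := (memLp_pwConst_mul βp βm (Lp.memLp q.1.fst)).add (Lp.memLp q.2.snd)
    obtain ⟨y, hy, hy'⟩ := h1.exists_isPrimitive (Lp.memLp _).locallyIntegrable_of_two
      l1.locallyIntegrable_of_two
    obtain ⟨Y, hY, hY'⟩ := h2.exists_isPrimitive (Lp.memLp _).locallyIntegrable_of_two
      l2.locallyIntegrable_of_two
    refine ⟨y, Y, hy, hY, hy'.congr ?_, hY'.congr ?_, (Lp.memLp _).ae_eq hy.symm,
      (Lp.memLp _).ae_eq hY.symm, Lp.memLp _, Lp.memLp _⟩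
    · filter_upwards [hY] with x hx
      rw [hx]
    · filter_upwards [hy] with x hx
      rw [hx]
  · rintro ⟨y, Y, hy, hY, h⟩
    refine ⟨h.1.isWeakDeriv.congr hy ?_, h.2.isWeakDeriv.congr hY ?_⟩
    · filter_upwards [hY] with x hx
      rw [hx]
    · filter_upwards [hy] with x hx
      rw [hx]

/-- The class in `L²` of a pair of functions. -/
noncomputable def toPair {f g : ℝ → ℂ} (hf : MemLp f 2) (hg : MemLp g 2) : L2Pair :=
  WithLp.toLp 2 (hf.toLp, hg.toLp)

lemma SolvesSystem.mem_systemGraph {αp αm βp βm : ℂ} {y Y F G : ℝ → ℂ}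
    (h : SolvesSystem (pwConst αp αm) (pwConst βp βm) y Y F G) :
    (toPair h.3 h.4, toPair h.5 h.6) ∈ systemGraph αp αm βp βm :=
  mem_systemGraph_iff_exists.2 ⟨y, Y, h.3.coeFn_toLp.symm, h.4.coeFn_toLp.symm,
    h.congr_rhs h.5.coeFn_toLp.symm h.6.coeFn_toLp.symm⟩

lemma norm_sq_pair (u : L2Pair) : ‖u‖ ^ 2 = ∫ x, (‖u.fst x‖ ^ 2 + ‖u.snd x‖ ^ 2) := by
  rw [WithLp.prod_norm_sq_eq_of_L2, norm_sq_eq_integral, norm_sq_eq_integral, ← integral_add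
    (Lp.memLp _).integrable_norm_sq (Lp.memLp _).integrable_norm_sq]

/-- A closed graph together with an a priori bound for suitably chosen solutions gives a closed
range. If `D` may vanish, the kernel element in `hker`, equal to `1` at the interface, is used to
normalize solutions to `y 0 = 0`, where the bound remains valid. -/
lemma isClosed_snd_image_systemGraph {αp αm βp βm μp μm : ℂ} (hαp : αp ≠ 0) (hαm : αm ≠ 0)
    (hμp : 0 < μp.re) (hμm : 0 < μm.re) (hβp : αp * βp = μp ^ 2) (hβm : αm * βm = μm ^ 2)
    (hker : μp * αm + μm * αp ≠ 0 ∨ ∃ u v : ℝ → ℂ,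
      SolvesSystem (pwConst αp αm) (pwConst βp βm) u v 0 0 ∧ u 0 = 1) :
    IsClosed ((systemGraph αp αm βp βm).map (LinearMap.snd ℂ L2Pair L2Pair) : Set L2Pair) := by
  obtain ⟨C, hC0, hC⟩ := SolvesSystem.estimate hαp hαm hμp hμm hβp hβm
  set D := μp * αm + μm * αp
  -- The pairs to which the estimate applies. They are stable under differences, which makes the
  -- chosen solutions a Cauchy sequence.
  let Good (u p : L2Pair) : Prop := ∃ y Y : ℝ → ℂ, y =ᵐ[volume] u.fst ∧ Y =ᵐ[volume] u.snd ∧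
    SolvesSystem (pwConst αp αm) (pwConst βp βm) y Y p.fst p.snd ∧ (D ≠ 0 ∨ y 0 = 0)
  have hbound : ∀ u p, Good u p → ‖u‖ ≤ √C * ‖p‖ := by
    rintro u p ⟨y, Y, hy, hY, h, h0⟩
    have h1 := hC y Y _ _ h h0
    rw [← norm_sq_pair, integral_congr_ae (g := fun x => ‖u.fst x‖ ^ 2 + ‖u.snd x‖ ^ 2) (by
      filter_upwards [hy, hY] with x hx hX
      rw [hx, hX]), ← norm_sq_pair] at h1
    refine abs_le_of_sq_le_sq' ?_ (by positivity) |>.2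
    rwa [mul_pow, Real.sq_sqrt hC0]
  have hsub : ∀ u p u' p', Good u p → Good u' p' → Good (u - u') (p - p') := by
    rintro u p u' p' ⟨y, Y, hy, hY, h, h0⟩ ⟨y', Y', hy', hY', h', h0'⟩
    refine ⟨_, _, ?_, ?_, (h.add (h'.const_mul (-1))).congr_rhs ?_ ?_, ?_⟩
    · filter_upwards [hy, hy', Lp.coeFn_sub u.fst u'.fst] with x h1 h2 h3
      rw [WithLp.sub_fst, h3, Pi.sub_apply, h1, h2]; ring
    · filter_upwards [hY, hY', Lp.coeFn_sub u.snd u'.snd] with x h1 h2 h3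
      rw [WithLp.sub_snd, h3, Pi.sub_apply, h1, h2]; ring
    · filter_upwards [Lp.coeFn_sub p.fst p'.fst] with x h3
      rw [WithLp.sub_fst, h3, Pi.sub_apply]; ring
    · filter_upwards [Lp.coeFn_sub p.snd p'.snd] with x h3
      rw [WithLp.sub_snd, h3, Pi.sub_apply]; ring
    · rcases h0 with h0 | h0
      · exact Or.inl h0
      rcases h0' with h0' | h0'
      · exact Or.inl h0'
      right
      rw [h0, h0']; ring
  have hex : ∀ p, p ∈ (systemGraph αp αm βp βm).map (LinearMap.snd ℂ L2Pair L2Pair) →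
      ∃ u, Good u p := by
    rintro p ⟨⟨u, p⟩, hup, rfl⟩
    obtain ⟨y, Y, hy, hY, h⟩ := mem_systemGraph_iff_exists.1 hup
    rcases hker with hD | ⟨a, b, hab, ha⟩
    · exact ⟨u, y, Y, hy, hY, h, Or.inl hD⟩
    · have h' := h.add (hab.const_mul (-y 0))
      refine ⟨toPair h'.3 h'.4, _, _, h'.3.coeFn_toLp.symm, h'.4.coeFn_toLp.symm,
        h'.congr_rhs ?_ ?_, Or.inr ?_⟩
      · exact Eventually.of_forall fun x => by simp
      · exact Eventually.of_forall fun x => by simp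
      · rw [ha]; ring
  refine IsSeqClosed.isClosed fun p q hp hq => ?_
  choose u hu using fun n => hex (p n) (hp n)
  have hcau : CauchySeq u := by
    have hpc := hq.cauchySeq
    rw [Metric.cauchySeq_iff] at hpc ⊢
    intro ε hε
    -- The summand `1` keeps the denominator positive even if `C = 0`.
    obtain ⟨N, hN⟩ := hpc (ε / (√C + 1)) (by positivity)
    refine ⟨N, fun m hm n hn => ?_⟩
    rw [dist_eq_norm]
    have h1 := hbound _ _ (hsub _ _ _ _ (hu m) (hu n))
    have h2 := hN m hm n hn
    rw [dist_eq_norm, lt_div_iff₀ (by positivity)] at h2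
    nlinarith [norm_nonneg (p m - p n)]
  obtain ⟨v, hv⟩ := cauchySeq_tendsto_of_complete hcau
  refine ⟨(v, q), ?_, rfl⟩
  refine (isClosed_systemGraph αp αm βp βm).mem_of_tendsto (hv.prodMk_nhds hq)
    (Eventually.of_forall fun n => ?_)
  obtain ⟨y, Y, hy, hY, h, -⟩ := hu n
  exact mem_systemGraph_iff_exists.2 ⟨y, Y, hy, hY, h⟩

lemma integral_inner_L2C (u v : L2C) : inner ℂ u v = ∫ x, v x * starRingEnd ℂ (u x) := by
  rw [L2.inner_def]
  exact integral_congr_ae (Eventually.of_forall fun x => by simp)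

/-- The Fredholm alternative. -/
theorem SolvesSystem.exists_of_orthogonal {αp αm βp βm μp μm : ℂ} (hαp : αp ≠ 0) (hαm : αm ≠ 0)
    (hμp : 0 < μp.re) (hμm : 0 < μm.re) (hβp : αp * βp = μp ^ 2) (hβm : αm * βm = μm ^ 2)
    (hker : μp * αm + μm * αp ≠ 0 ∨ ∃ u v : ℝ → ℂ,
      SolvesSystem (pwConst αp αm) (pwConst βp βm) u v 0 0 ∧ u 0 = 1)
    {F G : ℝ → ℂ} (hF : MemLp F 2) (hG : MemLp G 2)
    (h : ∀ u v : ℝ → ℂ, SolvesSystem (pwConst αp αm) (pwConst βp βm) u v 0 0 →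
      ∫ x, (F x * v x - G x * u x) = 0) :
    ∃ y Y : ℝ → ℂ, SolvesSystem (pwConst αp αm) (pwConst βp βm) y Y F G := by
  set R := (systemGraph αp αm βp βm).map (LinearMap.snd ℂ L2Pair L2Pair) with hR
  have hcl : IsClosed (R : Set L2Pair) :=
    isClosed_snd_image_systemGraph hαp hαm hμp hμm hβp hβm hker
  have : CompleteSpace R := hcl.completeSpace_coe
  suffices hmem : toPair hF hG ∈ R by
    obtain ⟨⟨u, p⟩, hup, rfl : p = _⟩ := hmem
    obtain ⟨y, Y, -, -, hs⟩ := mem_systemGraph_iff_exists.1 hup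
    exact ⟨y, Y, hs.congr_rhs hF.coeFn_toLp hG.coeFn_toLp⟩
  -- The range is closed, so it equals its double orthogonal complement; it remains to identify the
  -- vectors `r` orthogonal to it.
  rw [← R.orthogonal_orthogonal, Submodule.mem_orthogonal]
  intro r hr
  rw [Submodule.mem_orthogonal'] at hr
  have hpair : ∀ {y Y F' G' : ℝ → ℂ}, SolvesSystem (pwConst αp αm) (pwConst βp βm) y Y F' G' →
      (∫ x, F' x * starRingEnd ℂ (r.fst x)) + ∫ x, G' x * starRingEnd ℂ (r.snd x) = 0 := by
    intro y Y F' G' hs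
    have h1 := hr (toPair hs.5 hs.6) ⟨_, hs.mem_systemGraph, rfl⟩
    rw [WithLp.prod_inner_apply, integral_inner_L2C, integral_inner_L2C] at h1
    rw [← h1]
    congr 1
    · refine integral_congr_ae ?_
      filter_upwards [hs.5.coeFn_toLp] with x hx
      simp [toPair, hx]
    · refine integral_congr_ae ?_
      filter_upwards [hs.6.coeFn_toLp] with x hx
      simp [toPair, hx]
  have hr1 : MemLp (fun x => starRingEnd ℂ (r.fst x)) 2 := (Lp.memLp r.fst).star
  have hr2 : MemLp (fun x => starRingEnd ℂ (r.snd x)) 2 := (Lp.memLp r.snd).star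
  have hzero : IsPrimitive 0 0 := ⟨locallyIntegrable_zero, fun a b => by simp⟩
  -- The pairs `(φ, 0)` and `(0, φ)` solve the system with suitable right-hand sides. Orthogonality
  -- of `r` to these says that `u = -conj r₂`, `v = conj r₁` solve the original homogeneous system,
  -- and the hypothesis `h` for this pair is the orthogonality of `(F, G)` to `r`.
  have w1 : IsWeakDeriv (fun x => starRingEnd ℂ (r.fst x))
      (fun x => pwConst βp βm x * -starRingEnd ℂ (r.snd x)) := by
    intro φ hφ
    have hs : SolvesSystem (pwConst αp αm) (pwConst βp βm) φ 0 (_root_.deriv φ)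
        (fun x => - (pwConst βp βm x * φ x)) :=
      ⟨by simpa using hφ.isPrimitive, by simpa using! hzero, hφ.memLp, MemLp.zero,
        hφ.deriv.memLp, (memLp_pwConst_mul _ _ hφ.memLp).neg⟩
    have h1 := hpair hs
    have e1 : ∫ x, pwConst βp βm x * -starRingEnd ℂ (r.snd x) * φ x =
      ∫ x, -(pwConst βp βm x * φ x) * starRingEnd ℂ (r.snd x) := by congr 1; funext x; ring
    have e2 : ∫ x, starRingEnd ℂ (r.fst x) * _root_.deriv φ x =
      ∫ x, _root_.deriv φ x * starRingEnd ℂ (r.fst x) := by congr 1; funext x; ring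
    rw [e1, e2]
    linear_combination h1
  have w2 : IsWeakDeriv (fun x => - starRingEnd ℂ (r.snd x))
      (fun x => pwConst αp αm x * starRingEnd ℂ (r.fst x)) := by
    intro φ hφ
    have hs : SolvesSystem (pwConst αp αm) (pwConst βp βm) 0 φ
        (fun x => - (pwConst αp αm x * φ x)) (_root_.deriv φ) :=
      ⟨by simpa using! hzero, by simpa using hφ.isPrimitive, MemLp.zero, hφ.memLp,
        (memLp_pwConst_mul _ _ hφ.memLp).neg, hφ.deriv.memLp⟩
    have h1 := hpair hs
    have e1 : ∫ x, pwConst αp αm x * starRingEnd ℂ (r.fst x) * φ x =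
      -∫ x, -(pwConst αp αm x * φ x) * starRingEnd ℂ (r.fst x) := by
      rw [← integral_neg]; congr 1; funext x; ring
    have e2 : ∫ x, -starRingEnd ℂ (r.snd x) * _root_.deriv φ x =
      -∫ x, _root_.deriv φ x * starRingEnd ℂ (r.snd x) := by
      rw [← integral_neg]; congr 1; funext x; ring
    rw [e1, e2]
    linear_combination -h1
  obtain ⟨v, hv, hv'⟩ := w1.exists_isPrimitive hr1.locallyIntegrable_of_two
    (memLp_pwConst_mul _ _ hr2.neg).locallyIntegrable_of_two
  obtain ⟨u, hu, hu'⟩ := w2.exists_isPrimitive hr2.neg.locallyIntegrable_of_two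
    (memLp_pwConst_mul _ _ hr1).locallyIntegrable_of_two
  have hs : SolvesSystem (pwConst αp αm) (pwConst βp βm) u v 0 0 := by
    refine ⟨hu'.congr ?_, hv'.congr ?_, hr2.neg.ae_eq hu.symm, hr1.ae_eq hv.symm,
      MemLp.zero, MemLp.zero⟩
    · filter_upwards [hv] with x hx
      simp [hx]
    · filter_upwards [hu] with x hx
      simp [hx]
  have h1 := h u v hs
  rw [WithLp.prod_inner_apply, integral_inner_L2C, integral_inner_L2C, ← integral_add, ← h1]
  · refine integral_congr_ae ?_
    filter_upwards [hu, hv, hF.coeFn_toLp, hG.coeFn_toLp] with x h1 h2 h3 h4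
    change (MemLp.toLp F hF : ℝ → ℂ) x * starRingEnd ℂ (r.fst x) +
      (MemLp.toLp G hG : ℝ → ℂ) x * starRingEnd ℂ (r.snd x) = _
    rw [h1, h2, h3, h4]
    ring
  · exact (Lp.memLp _).integrable_mul hr1
  · exact (Lp.memLp _).integrable_mul hr2

end Maxwell1D

namespace Maxwell1D

/-! ### Components of the weak differential operators -/

lemma IsTest.single {g : ℝ → ℂ} (hg : IsTest g) (i : Fin 3) :
    IsTest (fun x => (Pi.single i (g x) : Fin 3 → ℂ)) := by
  refine IsTest.of_apply fun j => ?_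
  by_cases hj : j = i
  · subst hj; simpa using hg
  · simpa [Pi.single_apply, hj] using isTest_zero

lemma integrable_apply_mul (u : L2C3) (i : Fin 3) {φ : ℝ → ℂ} (h : IsTest φ) :
    Integrable (fun x => u x i * φ x) := (memLp_apply u i).integrable_mul h.memLp

lemma isDivFree_iff {k : ℝ} {u : L2C3} :
    IsDivFree k u ↔ IsWeakDeriv (fun x => u x 0) (fun x => -(Complex.I * k * u x 1)) := by
  refine forall₂_congr fun φ hφ => ?_
  rw [pair_eq_sum u (hφ.gradK _), Fin.sum_univ_three, eq_neg_iff_add_eq_zero]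
  have e1 : ∫ x, u x 1 * gradK (-k) φ x 1 = ∫ x, -(Complex.I * k * u x 1) * φ x := by
    congr 1; funext x; simp [gradK]; ring
  rw [e1]
  simp [gradK]

/-- Test functions with a single nonzero component separate the rows. The first row carries no
derivative in `x` and therefore holds pointwise almost everywhere. -/
lemma isWeakCurl_iff {k : ℝ} {u v : L2C3} :
    IsWeakCurl k u v ↔ (∀ᵐ x, v x 0 = Complex.I * k * u x 2) ∧
      IsWeakDeriv (fun x => u x 2) (fun x => - v x 1) ∧
      IsWeakDeriv (fun x => u x 1) (fun x => v x 2 + Complex.I * k * u x 0) := by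
  have hik : ∀ (i : Fin 3) {φ : ℝ → ℂ}, IsTest φ →
      Integrable (fun x => Complex.I * k * u x i * φ x) := fun i φ hφ => by
    simpa [mul_assoc] using (integrable_apply_mul u i hφ).const_mul (Complex.I * k)
  -- the three scalar forms of the integrals
  have a0 : ∀ φ : ℝ → Fin 3 → ℂ, ∫ x, u x 0 * curlK (-k) φ x 0 =
      - ∫ x, Complex.I * k * u x 0 * φ x 2 := fun φ => by
    rw [← integral_neg]; congr 1; funext x; simp [curlK]; ring
  have a1 : ∀ φ : ℝ → Fin 3 → ℂ, ∫ x, u x 1 * curlK (-k) φ x 1 =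
      - ∫ x, u x 1 * deriv (fun y => φ y 2) x := fun φ => by
    rw [← integral_neg]; congr 1; funext x; simp [curlK]
  have a2 : ∀ φ : ℝ → Fin 3 → ℂ, IsTest φ → ∫ x, u x 2 * curlK (-k) φ x 2 =
      (∫ x, u x 2 * deriv (fun y => φ y 1) x) + ∫ x, Complex.I * k * u x 2 * φ x 0 :=
    fun φ hφ => by
      rw [← integral_add (integrable_apply_mul u 2 (hφ.comp_apply 1).deriv)
        (hik 2 (hφ.comp_apply 0))]
      congr 1; funext x; simp [curlK]; ring
  have full : ∀ φ : ℝ → Fin 3 → ℂ, IsTest φ → (pair u (curlK (-k) φ) = pair v φ ↔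
      - (∫ x, Complex.I * k * u x 0 * φ x 2) + - (∫ x, u x 1 * deriv (fun y => φ y 2) x) +
        ((∫ x, u x 2 * deriv (fun y => φ y 1) x) + ∫ x, Complex.I * k * u x 2 * φ x 0) =
      (∫ x, v x 0 * φ x 0) + (∫ x, v x 1 * φ x 1) + ∫ x, v x 2 * φ x 2) := fun φ hφ => by
    rw [pair_eq_sum u (hφ.curlK _), pair_eq_sum v hφ, Fin.sum_univ_three, Fin.sum_univ_three,
      a0, a1, a2 φ hφ]
  have b1 : ∀ φ, IsTest φ → (∫ x, u x 1 * deriv φ x = -∫ x, (v x 2 + Complex.I * k * u x 0) * φ x ↔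
      ∫ x, u x 1 * deriv φ x = -((∫ x, v x 2 * φ x) + ∫ x, Complex.I * k * u x 0 * φ x)) :=
    fun φ hφ => by
      rw [← integral_add (integrable_apply_mul v 2 hφ) (hik 0 hφ)]
      simp only [add_mul]
  have b2 : ∀ φ : ℝ → ℂ, ∫ x, - v x 1 * φ x = - ∫ x, v x 1 * φ x := fun φ => by
    rw [← integral_neg]; congr 1; funext x; ring
  constructor
  · intro h
    have h' : ∀ φ (hφ : IsTest φ) (i : Fin 3), _ := fun φ hφ i =>
      (full _ (IsTest.single hφ i)).1 (h _ (IsTest.single hφ i))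
    refine ⟨?_, fun φ hφ => ?_, fun φ hφ => ?_⟩
    · have hz := ae_eq_zero_of_forall_isTest
        (y := fun x => v x 0 - Complex.I * k * u x 2)
        (((memLp_apply v 0).sub ((memLp_apply u 2).const_mul _)).locallyIntegrable_of_two)
        (fun φ hφ => by
          have := h' φ hφ 0
          simp only [Pi.single_apply] at this
          simp only [sub_mul]
          rw [integral_sub (integrable_apply_mul v 0 hφ) (hik 2 hφ), sub_eq_zero]
          simpa using this.symm)
      exact hz.mono fun x hx => sub_eq_zero.1 hx
    · have := h' φ hφ 1
      simp only [Pi.single_apply] at this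
      rw [b2, neg_neg]
      simpa using this
    · have := h' φ hφ 2
      simp only [Pi.single_apply] at this
      rw [b1 φ hφ]
      simp only [Fin.isValue, ↓reduceIte, Fin.reduceEq, deriv_const', mul_zero, integral_zero,
        add_zero, zero_add] at this
      linear_combination -this
  · rintro ⟨h0, h1, h2⟩ φ hφ
    rw [full φ hφ, h1 _ (hφ.comp_apply 1), (b1 _ (hφ.comp_apply 2)).1 (h2 _ (hφ.comp_apply 2)), b2]
    have : ∫ x, v x 0 * φ x 0 = ∫ x, Complex.I * k * u x 2 * φ x 0 :=
      integral_congr_ae (h0.mono fun x hx => by simp only [hx])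
    rw [this]
    ring

/-- The element of `L²(ℝ, ℂ³)` with given components. -/
noncomputable def mkL2C3 {f g h : ℝ → ℂ} (hf : MemLp f 2) (hg : MemLp g 2) (hh : MemLp h 2) :
    L2C3 :=
  MemLp.toLp (fun x => !₂[f x, g x, h x])
    (MemLp.of_eval_piLp fun i => by fin_cases i <;> simpa)

lemma mkL2C3_ae {f g h : ℝ → ℂ} (hf : MemLp f 2) (hg : MemLp g 2) (hh : MemLp h 2) :
    ∀ᵐ x, mkL2C3 hf hg hh x 0 = f x ∧ mkL2C3 hf hg hh x 1 = g x ∧ mkL2C3 hf hg hh x 2 = h x := by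
  filter_upwards [MemLp.coeFn_toLp (f := fun x => !₂[f x, g x, h x])
    (MemLp.of_eval_piLp fun i => by fin_cases i <;> simpa)] with x hx
  unfold mkL2C3
  rw [hx]
  simp

lemma mulPW_ae (a b : ℂ) (u : L2C3) : ∀ᵐ x, ∀ i, mulPW a b u x i = pwConst a b x * u x i := by
  filter_upwards [(memLp_pwConst_smul a b u).coeFn_toLp] with x hx i
  have h2 : mulPW a b u = (memLp_pwConst_smul a b u).toLp := rfl
  rw [h2, hx]
  simp

lemma pwConst_inv_mul {p q : ℂ} (hp : p ≠ 0) (hq : q ≠ 0) (x : ℝ) :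
    pwConst p⁻¹ q⁻¹ x * pwConst p q x = 1 := by
  unfold pwConst
  split_ifs <;> simp [hp, hq]

/-- `∇_k × u = v` and `∇_k × v - W u = f` with `W = pwConst p q`. -/
def SolvesMaxwell (k : ℝ) (p q : ℂ) (u v f : L2C3) : Prop :=
  IsWeakCurl k u v ∧ IsWeakCurl k v (f + mulPW p q u)

/-- `(k² - W) / W`. -/
noncomputable def tmCoeff (k : ℝ) (p q : ℂ) : ℝ → ℂ :=
  pwConst (((k : ℂ) ^ 2 - p) / p) (((k : ℂ) ^ 2 - q) / q)

/-- `k² - W`. -/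
noncomputable def teCoeff (k : ℝ) (p q : ℂ) : ℝ → ℂ :=
  pwConst ((k : ℂ) ^ 2 - p) ((k : ℂ) ^ 2 - q)

lemma tmCoeff_eq {k : ℝ} {p q : ℂ} (hp : p ≠ 0) (hq : q ≠ 0) (x : ℝ) :
    tmCoeff k p q x = (k : ℂ) ^ 2 * pwConst p⁻¹ q⁻¹ x - 1 := by
  unfold tmCoeff pwConst
  split_ifs <;> field_simp

lemma teCoeff_eq {k : ℝ} {p q : ℂ} (x : ℝ) :
    teCoeff k p q x = (k : ℂ) ^ 2 - pwConst p q x := by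
  unfold teCoeff pwConst
  split_ifs <;> rfl

lemma coeFn_add_mulPW (p q : ℂ) (u f : L2C3) :
    ∀ᵐ x, ∀ i, (f + mulPW p q u) x i = f x i + pwConst p q x * u x i := by
  filter_upwards [Lp.coeFn_add f (mulPW p q u), mulPW_ae p q u] with x h1 h2 i
  rw [h1, Pi.add_apply, PiLp.add_apply, h2]

namespace SolvesMaxwell

variable {k : ℝ} {p q : ℂ} {u v f : L2C3}

/-- The derivative-free row of the second curl equation determines `u 0` once `W` can be inverted.
-/
lemma apply_zero_ae (h : SolvesMaxwell k p q u v f) (hp : p ≠ 0) (hq : q ≠ 0) :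
    ∀ᵐ x, u x 0 = pwConst p⁻¹ q⁻¹ x * (Complex.I * k * v x 2 - f x 0) := by
  filter_upwards [(isWeakCurl_iff.1 h.2).1, coeFn_add_mulPW p q u f] with x h1 h2
  rw [h2] at h1
  linear_combination pwConst p⁻¹ q⁻¹ x * h1 - u x 0 * (pwConst_inv_mul hp hq x)

/-- The TM polarization. Eliminating `u 0` from the equation for `u 1` creates the term `k² / W`,
and the sign in `Y = -u 1` makes the first coefficient `W` itself. -/
lemma exists_tm (h : SolvesMaxwell k p q u v f) (hp : p ≠ 0) (hq : q ≠ 0) :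
    ∃ y Y : ℝ → ℂ, (∀ᵐ x, y x = v x 2) ∧ (∀ᵐ x, Y x = - u x 1) ∧
      SolvesSystem (pwConst p q) (tmCoeff k p q) y Y (fun x => - f x 1)
        (fun x => pwConst p⁻¹ q⁻¹ x * (Complex.I * k * f x 0)) := by
  obtain ⟨-, h1, -⟩ := isWeakCurl_iff.1 h.2
  obtain ⟨-, -, h2⟩ := isWeakCurl_iff.1 h.1
  have hu0 := h.apply_zero_ae hp hq
  obtain ⟨y, hy, hy'⟩ := h1.exists_isPrimitive (memLp_apply v 2).locallyIntegrable_of_two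
    (memLp_apply (f + mulPW p q u) 1).neg.locallyIntegrable_of_two
  obtain ⟨Y, hY, hY'⟩ := h2.exists_isPrimitive (memLp_apply u 1).locallyIntegrable_of_two
    ((memLp_apply v 2).add ((memLp_apply u 0).const_mul _)).locallyIntegrable_of_two
  refine ⟨y, fun x => -1 * Y x, hy, hY.mono fun x hx => by simp [hx], hy'.congr ?_,
    (hY'.const_mul (-1)).congr ?_, (memLp_apply v 2).ae_eq hy.symm,
    ((memLp_apply u 1).ae_eq hY.symm).const_mul _, (memLp_apply f 1).neg,
    memLp_pwConst_mul _ _ ((memLp_apply f 0).const_mul _)⟩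
  · filter_upwards [hY, coeFn_add_mulPW p q u f] with x h1 h2
    rw [h1, h2]; ring
  · filter_upwards [hy, hu0] with x h1 h2
    rw [h1, h2, tmCoeff_eq hp hq]
    linear_combination (-(k : ℂ) ^ 2 * pwConst p⁻¹ q⁻¹ x * v x 2) * Complex.I_sq

/-- The TE polarization. The remaining component `v 0 = i k u 2` contributes the `k²`; as the first
coefficient is `1`, the interface is invisible in the transmission conditions. -/
lemma exists_te (h : SolvesMaxwell k p q u v f) :
    ∃ y Y : ℝ → ℂ, (∀ᵐ x, y x = u x 2) ∧ (∀ᵐ x, Y x = - v x 1) ∧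
      SolvesSystem (pwConst 1 1) (teCoeff k p q) y Y 0 (fun x => - f x 2) := by
  obtain ⟨-, -, h1⟩ := isWeakCurl_iff.1 h.2
  obtain ⟨h0, h2, -⟩ := isWeakCurl_iff.1 h.1
  obtain ⟨y, hy, hy'⟩ := h2.exists_isPrimitive (memLp_apply u 2).locallyIntegrable_of_two
    (memLp_apply v 1).neg.locallyIntegrable_of_two
  obtain ⟨Y, hY, hY'⟩ := h1.exists_isPrimitive (memLp_apply v 1).locallyIntegrable_of_two
    ((memLp_apply (f + mulPW p q u) 2).add
      ((memLp_apply v 0).const_mul _)).locallyIntegrable_of_two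
  refine ⟨y, fun x => -1 * Y x, hy, hY.mono fun x hx => by simp [hx], hy'.congr ?_,
    (hY'.const_mul (-1)).congr ?_, (memLp_apply u 2).ae_eq hy.symm,
    ((memLp_apply v 1).ae_eq hY.symm).const_mul _, MemLp.zero, (memLp_apply f 2).neg⟩
  · filter_upwards [hY] with x h1
    rw [h1]; simp [pwConst]
  · filter_upwards [hy, h0, coeFn_add_mulPW p q u f] with x h1 h2 h3
    rw [h1, h2, h3, teCoeff_eq]
    linear_combination (-(k : ℂ) ^ 2 * u x 2) * Complex.I_sq

end SolvesMaxwell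

/-- Solutions of the two systems yield a solution of the Maxwell problem. -/
lemma exists_solvesMaxwell {k : ℝ} {p q : ℂ} (hp : p ≠ 0) (hq : q ≠ 0) {f : L2C3}
    {y Y z Z : ℝ → ℂ} (hy : SolvesSystem (pwConst p q) (tmCoeff k p q) y Y (fun x => - f x 1)
      (fun x => pwConst p⁻¹ q⁻¹ x * (Complex.I * k * f x 0)))
    (hz : SolvesSystem (pwConst 1 1) (teCoeff k p q) z Z 0 (fun x => - f x 2)) :
    ∃ u v, SolvesMaxwell k p q u v f ∧
      (∀ᵐ x, u x 0 = pwConst p⁻¹ q⁻¹ x * (Complex.I * k * y x - f x 0)) ∧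
      (∀ᵐ x, u x 1 = - Y x) ∧ (∀ᵐ x, v x 2 = y x) := by
  have m0 : MemLp (fun x => pwConst p⁻¹ q⁻¹ x * (Complex.I * k * y x - f x 0)) 2 :=
    memLp_pwConst_mul _ _ ((hy.3.const_mul _).sub (memLp_apply f 0))
  have hu := mkL2C3_ae m0 hy.4.neg hz.3
  have hv := mkL2C3_ae (hz.3.const_mul (Complex.I * k)) hz.4.neg hy.3
  set u := mkL2C3 m0 hy.4.neg hz.3
  set v := mkL2C3 (hz.3.const_mul (Complex.I * k)) hz.4.neg hy.3
  refine ⟨u, v, ⟨isWeakCurl_iff.2 ⟨?_, ?_, ?_⟩, isWeakCurl_iff.2 ⟨?_, ?_, ?_⟩⟩,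
    hu.mono fun x hx => hx.1, hu.mono fun x hx => hx.2.1, hv.mono fun x hx => hx.2.2⟩
  · filter_upwards [hu, hv] with x h1 h2
    rw [h1.2.2, h2.1]
  · refine hz.1.isWeakDeriv.congr ?_ ?_
    · filter_upwards [hu] with x h1
      rw [h1.2.2]
    · filter_upwards [hv] with x h1
      rw [h1.2.1]; simp [pwConst]
  · refine (hy.2.const_mul (-1)).isWeakDeriv.congr ?_ ?_
    · filter_upwards [hu] with x h1
      rw [h1.2.1]; simp
    · filter_upwards [hu, hv] with x h1 h2
      rw [h1.1, h2.2.2, tmCoeff_eq hp hq]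
      linear_combination (-(k : ℂ) ^ 2 * pwConst p⁻¹ q⁻¹ x * y x) * Complex.I_sq
  · filter_upwards [hu, hv, coeFn_add_mulPW p q u f] with x h1 h2 h3
    rw [h3, h1.1, h2.2.2]
    linear_combination (Complex.I * k * y x - f x 0) * pwConst_inv_mul hp hq x
  · refine hy.1.isWeakDeriv.congr ?_ ?_
    · filter_upwards [hv] with x h1
      rw [h1.2.2]
    · filter_upwards [hu, coeFn_add_mulPW p q u f] with x h1 h3
      rw [h3, h1.2.1, Pi.neg_apply]; ring
  · refine (hz.2.const_mul (-1)).isWeakDeriv.congr ?_ ?_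
    · filter_upwards [hv] with x h1
      rw [h1.2.1]; simp
    · filter_upwards [hu, hv, coeFn_add_mulPW p q u f] with x h1 h2 h3
      rw [h3, h1.2.2, h2.1, teCoeff_eq]
      linear_combination (-(k : ℂ) ^ 2 * z x) * Complex.I_sq

end Maxwell1D

namespace Maxwell1D

/-! ### The pencil in terms of the Maxwell problem -/

section Pencil

variable {m : Media} {k : ℝ} {ω l : ℂ}

lemma coe_pencil_op (u : (m.pencil k).dom ω) :
    ((m.pencil k).op ω l u : L2C3) =
      curlCurl (k := k) (a := m.WtPlus ω) (b := m.WtMinus ω) u -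
        mulPW (l * m.WPlus ω) (l * m.WMinus ω) u := by
  rw [mulPW_mul]
  rfl

lemma exists_solvesMaxwell_op (u : (m.pencil k).dom ω) :
    ∃ v, SolvesMaxwell k (l * m.WPlus ω) (l * m.WMinus ω) u v ((m.pencil k).op ω l u) := by
  obtain ⟨w, v, hv, hw⟩ := exists_curlCurl (k := k) (a := m.WtPlus ω) (b := m.WtMinus ω) u
  refine ⟨v, hv, ?_⟩
  rw [coe_pencil_op, sub_add_cancel, curlCurl_eq u hv hw]
  exact hw

/-- The divergence constraint is automatic: `l ω² W̃ u = ∇_k × v - f` is a difference of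
divergence-free fields, and `l ω² ≠ 0`. -/
lemma exists_dom_of_solvesMaxwell (hω : ω ≠ 0) (hl : l ≠ 0) {u v : L2C3} {f : rangeSpace k}
    (h : SolvesMaxwell k (l * m.WPlus ω) (l * m.WMinus ω) u v f) :
    ∃ u' : (m.pencil k).dom ω, (u' : L2C3) = u ∧ (m.pencil k).op ω l u' = f := by
  have hc : l * ω ^ 2 ≠ 0 := mul_ne_zero hl (pow_ne_zero 2 hω)
  have hdiv : mulPW (m.WtPlus ω) (m.WtMinus ω) u ∈ rangeSpace k := by
    have h1 : f + mulPW (l * m.WPlus ω) (l * m.WMinus ω) u ∈ rangeSpace k := h.2.isDivFree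
    have h2 := (rangeSpace k).sub_mem h1 f.2
    rw [add_sub_cancel_left, Media.WPlus, Media.WMinus, ← mul_assoc, ← mul_assoc, mulPW_mul] at h2
    exact (Submodule.smul_mem_iff _ hc).1 h2
  let u' : domSpace k (m.WtPlus ω) (m.WtMinus ω) := ⟨u, ⟨v, _, h.1, h.2⟩, hdiv⟩
  refine ⟨(u' : (m.pencil k).dom ω), rfl, Subtype.ext ((coe_pencil_op _).trans ?_)⟩
  exact (congrArg (· - mulPW (l * m.WPlus ω) (l * m.WMinus ω) u)
    (curlCurl_eq u' h.1 h.2)).trans (add_sub_cancel_right _ _)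

end Pencil

/-! ### Characteristic exponents -/

/-- A complex number off `(-∞, 0]` has a square root with positive real part. -/
lemma exists_sq_eq_of_notMem {z : ℂ} (hz : ∀ r : ℝ, 0 ≤ r → z ≠ -(r : ℂ)) :
    ∃ μ : ℂ, 0 < μ.re ∧ z = μ ^ 2 := by
  obtain ⟨w, hw⟩ := IsAlgClosed.exists_pow_nat_eq z (n := 2) two_pos
  rcases lt_trichotomy w.re 0 with h | h | h
  · exact ⟨-w, by simpa using h, by rw [neg_sq, hw]⟩
  · refine absurd ?_ (hz (w.im ^ 2) (sq_nonneg _))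
    have : w = w.im * Complex.I := by
      apply Complex.ext <;> simp [h]
    rw [← hw, this]
    simp only [mul_pow, Complex.I_sq]
    simp
  · exact ⟨w, h, hw.symm⟩

lemma exists_exponent {k : ℝ} {p : ℂ} (hp : p ∉ Media.ray k) :
    ∃ μ : ℂ, 0 < μ.re ∧ (k : ℂ) ^ 2 - p = μ ^ 2 := by
  refine exists_sq_eq_of_notMem fun r hr h => hp ⟨k ^ 2 + r, ?_, ?_⟩
  · simpa using hr
  · push_cast
    linear_combination h

lemma exists_kappa {k : ℝ} {p : ℂ} (hp : p ∈ Media.ray k) :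
    ∃ κ : ℝ, (k : ℂ) ^ 2 - p = -(κ : ℂ) ^ 2 := by
  obtain ⟨r, hr, rfl⟩ := hp
  have hr' : k ^ 2 ≤ r := hr
  refine ⟨√(r - k ^ 2), ?_⟩
  rw [← Complex.ofReal_pow, ← Complex.ofReal_pow, Real.sq_sqrt (by linarith)]
  push_cast
  ring

/-- The dispersion relation. -/
lemma dispersion_iff {k : ℝ} {p q μp μm : ℂ} (hp : p ≠ 0) (hq : q ≠ 0) (hμp : 0 < μp.re)
    (hμm : 0 < μm.re) (hp' : (k : ℂ) ^ 2 - p = μp ^ 2) (hq' : (k : ℂ) ^ 2 - q = μm ^ 2) :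
    μp * q + μm * p = 0 ↔ (k : ℂ) ^ 2 * (p + q) = p * q := by
  have hne : μp + μm ≠ 0 := fun h => by
    have := congrArg Complex.re h
    simp at this
    linarith
  constructor
  · intro h
    have hpq : p - q ≠ 0 := fun h0 => by
      have h1 : p = q := sub_eq_zero.1 h0
      subst h1
      have : (μp + μm) * p = 0 := by linear_combination h
      rcases mul_eq_zero.1 this with h2 | h2
      · exact hne h2
      · exact hp h2
    -- Squaring `μp q = -μm p` gives `(k² - p) q² = (k² - q) p²`, which contains the spurious factor
    -- `p - q`.
    have h2 : (p - q) * ((k : ℂ) ^ 2 * (p + q) - p * q) = 0 := by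
      linear_combination (p ^ 2) * hq' - q ^ 2 * hp' - (μp * q - μm * p) * h
    rcases mul_eq_zero.1 h2 with h3 | h3
    · exact absurd h3 hpq
    · exact sub_eq_zero.1 h3
  · intro h
    -- The squared relation leaves two signs; the positive real parts must rule out the wrong one.
    have h1 : (μp * q + μm * p) * (μp * q - μm * p) = 0 := by
      linear_combination (q - p) * h - q ^ 2 * hp' + p ^ 2 * hq'
    rcases mul_eq_zero.1 h1 with h2 | h2
    · exact h2
    · exfalso
      have h3 : μp * q = μm * p := sub_eq_zero.1 h2
      -- then `k ^ 2 = -μp * μm`, which is impossible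
      have h4 : q * ((k : ℂ) ^ 2 + μp * μm) = 0 := by
        linear_combination h + μm * h3 - p * hq'
      have h5 : (k : ℂ) ^ 2 + μp * μm = 0 := (mul_eq_zero.1 h4).resolve_left hq
      have hre := congrArg Complex.re h5
      have him := congrArg Complex.im h5
      rw [← Complex.ofReal_pow] at hre him
      simp only [Complex.add_re, Complex.mul_re, Complex.ofReal_re, Complex.zero_re] at hre
      simp only [Complex.add_im, Complex.mul_im, Complex.ofReal_im, Complex.zero_im] at him
      -- A real product `μp μm` makes `μm` a positive multiple of `conj μp`; the left side is that
      -- product, which is positive, whereas `-k²` is not.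
      have h6 : μp.re * μm.re * (1 + (μp.im / μp.re) ^ 2) = - k ^ 2 := by
        have : μm.im = - μp.im * μm.re / μp.re := by
          field_simp
          linarith
        rw [this] at hre
        field_simp at hre ⊢
        linarith
      have h7 : 0 < μp.re * μm.re * (1 + (μp.im / μp.re) ^ 2) := by positivity
      have := sq_nonneg k
      linarith

/-! ### The estimate for the Maxwell problem off the rays -/

lemma norm_sq_eq_integral_L2C3 (u : L2C3) :
    ‖u‖ ^ 2 = ∫ x, (‖u x 0‖ ^ 2 + ‖u x 1‖ ^ 2 + ‖u x 2‖ ^ 2) := by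
  have h := inner_self_eq_norm_sq_to_K (𝕜 := ℂ) u
  rw [L2.inner_def] at h
  have h2 : ∫ x, inner ℂ (u x) (u x) =
      ((∫ x, (‖u x 0‖ ^ 2 + ‖u x 1‖ ^ 2 + ‖u x 2‖ ^ 2) : ℝ) : ℂ) := by
    rw [← integral_complex_ofReal]
    refine integral_congr_ae (Eventually.of_forall fun x => ?_)
    simp only [inner_self_eq_norm_sq_to_K, ← Fin.sum_univ_three (fun i => ‖u x i‖ ^ 2),
      ← EuclideanSpace.norm_sq_eq]
    push_cast
    rfl
  rw [h2] at h
  refine Complex.ofReal_injective (h.trans ?_).symm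
  push_cast
  rfl

lemma norm_pwConst_sq_le (a b : ℂ) (x : ℝ) : ‖pwConst a b x‖ ^ 2 ≤ ‖a‖ ^ 2 + ‖b‖ ^ 2 := by
  unfold pwConst
  split_ifs
  · linarith [sq_nonneg ‖b‖]
  · linarith [sq_nonneg ‖a‖]

/-- The TM system controls `u 1` and `v 2`, the TE system controls `u 2`, and `u 0` follows
algebraically. The representatives `y`, `Y` are arguments because the condition `y 0 = 0` has no
meaning for the class `v 2`. -/
lemma SolvesMaxwell.estimate {k : ℝ} {p q μp μm : ℂ} (hp : p ≠ 0) (hq : q ≠ 0) (hμp : 0 < μp.re)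
    (hμm : 0 < μm.re) (hp' : (k : ℂ) ^ 2 - p = μp ^ 2) (hq' : (k : ℂ) ^ 2 - q = μm ^ 2) :
    ∃ C : ℝ, 0 ≤ C ∧ ∀ u v f, SolvesMaxwell k p q u v f → ∀ y Y : ℝ → ℂ,
      (∀ᵐ x, y x = v x 2) → (∀ᵐ x, Y x = - u x 1) →
      SolvesSystem (pwConst p q) (tmCoeff k p q) y Y (fun x => - f x 1)
        (fun x => pwConst p⁻¹ q⁻¹ x * (Complex.I * k * f x 0)) →
      (μp * q + μm * p ≠ 0 ∨ y 0 = 0) → ‖u‖ ≤ C * ‖f‖ := by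
  obtain ⟨C₁, hC₁, H₁⟩ := SolvesSystem.estimate hp hq hμp hμm
    (βp := ((k : ℂ) ^ 2 - p) / p) (βm := ((k : ℂ) ^ 2 - q) / q)
    (by rw [← hp']; field_simp) (by rw [← hq']; field_simp)
  obtain ⟨C₂, hC₂, H₂⟩ := SolvesSystem.estimate (αp := 1) (αm := 1) one_ne_zero one_ne_zero hμp hμm
    (βp := (k : ℂ) ^ 2 - p) (βm := (k : ℂ) ^ 2 - q) (by rw [← hp', one_mul])
    (by rw [← hq', one_mul])
  set K := ‖p⁻¹‖ ^ 2 + ‖q⁻¹‖ ^ 2 with hK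
  set K₁ := ‖Complex.I * (k : ℂ)‖ ^ 2 with hK₁
  have hK0 : 0 ≤ K := by positivity
  have hK10 : 0 ≤ K₁ := by positivity
  set M := K * (2 * (K₁ + 1)) with hM
  have hM0 : 0 ≤ M := by positivity
  refine ⟨√((M + 1) * (C₁ * (1 + K * K₁) + C₂ + 1)), by positivity, ?_⟩
  intro u v f h y Y hy hY hs h0
  obtain ⟨z, Z, hz, hZ, ht⟩ := h.exists_te
  have e1 := H₁ y Y _ _ hs h0
  -- The TE determinant is `μp + μm`, of positive real part.
  have e2 := H₂ z Z _ _ ht (Or.inl fun h => by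
    have := congrArg Complex.re h
    simp at this
    linarith)
  have hu0 := h.apply_zero_ae hp hq
  have hfi : Integrable (fun x => ‖f x 0‖ ^ 2 + ‖f x 1‖ ^ 2 + ‖f x 2‖ ^ 2) :=
    ((memLp_apply f 0).integrable_norm_sq.add (memLp_apply f 1).integrable_norm_sq).add
      (memLp_apply f 2).integrable_norm_sq
  have hui : Integrable (fun x => ‖u x 0‖ ^ 2 + ‖u x 1‖ ^ 2 + ‖u x 2‖ ^ 2) :=
    ((memLp_apply u 0).integrable_norm_sq.add (memLp_apply u 1).integrable_norm_sq).add
      (memLp_apply u 2).integrable_norm_sq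
  have hyi : Integrable (fun x => ‖y x‖ ^ 2 + ‖Y x‖ ^ 2) :=
    hs.3.integrable_norm_sq.add hs.4.integrable_norm_sq
  have hzi : Integrable (fun x => ‖z x‖ ^ 2 + ‖Z x‖ ^ 2) :=
    ht.3.integrable_norm_sq.add ht.4.integrable_norm_sq
  have e3 : ∫ x, (‖y x‖ ^ 2 + ‖Y x‖ ^ 2) ≤ C₁ * ((1 + K * K₁) * ‖f‖ ^ 2) := by
    refine e1.trans (mul_le_mul_of_nonneg_left ?_ hC₁)
    rw [norm_sq_eq_integral_L2C3, ← integral_const_mul]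
    refine integral_mono (hs.5.integrable_norm_sq.add hs.6.integrable_norm_sq)
      (hfi.const_mul _) fun x => ?_
    have i1 : ‖pwConst p⁻¹ q⁻¹ x * (Complex.I * k * f x 0)‖ ^ 2 ≤ K * (K₁ * ‖f x 0‖ ^ 2) := by
      rw [norm_mul, norm_mul, mul_pow, mul_pow]
      exact mul_le_mul_of_nonneg_right (norm_pwConst_sq_le _ _ _) (by positivity)
    have i2 : 0 ≤ ‖f x 0‖ ^ 2 := by positivity
    have i3 : 0 ≤ K * K₁ * (‖f x 1‖ ^ 2 + ‖f x 2‖ ^ 2) := by positivity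
    have i4 : 0 ≤ ‖f x 2‖ ^ 2 := by positivity
    simp only [norm_neg]
    linarith
  have e4 : ∫ x, (‖z x‖ ^ 2 + ‖Z x‖ ^ 2) ≤ C₂ * ‖f‖ ^ 2 := by
    refine e2.trans (mul_le_mul_of_nonneg_left ?_ hC₂)
    rw [norm_sq_eq_integral_L2C3]
    refine integral_mono (ht.5.integrable_norm_sq.add ht.6.integrable_norm_sq) hfi fun x => ?_
    have i2 : 0 ≤ ‖f x 0‖ ^ 2 := by positivity
    have i3 : 0 ≤ ‖f x 1‖ ^ 2 := by positivity
    simp only [Pi.zero_apply, norm_zero, norm_neg]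
    linarith
  have e5 : ‖u‖ ^ 2 ≤ (M + 1) * ((∫ x, (‖y x‖ ^ 2 + ‖Y x‖ ^ 2)) +
      (∫ x, (‖z x‖ ^ 2 + ‖Z x‖ ^ 2)) + ‖f‖ ^ 2) := by
    have hyzi : Integrable (fun x => ‖y x‖ ^ 2 + ‖Y x‖ ^ 2 + (‖z x‖ ^ 2 + ‖Z x‖ ^ 2)) :=
      hyi.add hzi
    rw [norm_sq_eq_integral_L2C3, norm_sq_eq_integral_L2C3, ← integral_add hyi hzi,
      ← integral_add hyzi hfi, ← integral_const_mul]
    refine integral_mono_ae hui ((hyzi.add hfi).const_mul _) ?_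
    filter_upwards [hu0, hy, hY, hz] with x h1 h2 h3 h4
    have i1 : ‖u x 0‖ ^ 2 ≤ M * (‖y x‖ ^ 2 + ‖f x 0‖ ^ 2) := by
      rw [h1, norm_mul, mul_pow, hM, mul_assoc K]
      refine mul_le_mul (norm_pwConst_sq_le _ _ _) ?_ (by positivity) hK0
      have := norm_lincomb_sq_le (Complex.I * k) (-1) (v x 2) (f x 0)
      rw [norm_neg, norm_one, one_pow, neg_one_mul, ← sub_eq_add_neg, ← h2] at this
      rw [← h2]
      exact this
    have i2 : ‖u x 1‖ ^ 2 = ‖Y x‖ ^ 2 := by rw [h3, norm_neg]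
    have i3 : ‖u x 2‖ ^ 2 = ‖z x‖ ^ 2 := by rw [h4]
    change ‖u x 0‖ ^ 2 + ‖u x 1‖ ^ 2 + ‖u x 2‖ ^ 2 ≤ (M + 1) * (‖y x‖ ^ 2 + ‖Y x‖ ^ 2 +
      (‖z x‖ ^ 2 + ‖Z x‖ ^ 2) + (‖f x 0‖ ^ 2 + ‖f x 1‖ ^ 2 + ‖f x 2‖ ^ 2))
    rw [i2, i3]
    have j1 : 0 ≤ M * (‖Y x‖ ^ 2 + (‖z x‖ ^ 2 + ‖Z x‖ ^ 2) + (‖f x 1‖ ^ 2 + ‖f x 2‖ ^ 2)) := by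
      positivity
    have j2 : 0 ≤ ‖Z x‖ ^ 2 + (‖f x 0‖ ^ 2 + ‖f x 1‖ ^ 2 + ‖f x 2‖ ^ 2) + ‖y x‖ ^ 2 := by
      positivity
    linarith
  refine abs_le_of_sq_le_sq' ?_ (by positivity) |>.2
  rw [mul_pow, Real.sq_sqrt (by positivity)]
  refine e5.trans ?_
  rw [mul_assoc]
  refine mul_le_mul_of_nonneg_left ?_ (by positivity)
  linarith

end Maxwell1D

namespace Maxwell1D

/-! ### The interface mode -/

/-- The function equal to `exp (-μp x)` for `x > 0` and to `exp (μm x)` for `x ≤ 0`. -/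
noncomputable def interfaceMode (μp μm : ℂ) : ℝ → ℂ :=
  fun x => if 0 < x then Complex.exp (-μp * x) else Complex.exp (μm * x)

lemma interfaceMode_zero (μp μm : ℂ) : interfaceMode μp μm 0 = 1 := by simp [interfaceMode]

lemma continuous_interfaceMode (μp μm : ℂ) : Continuous (interfaceMode μp μm) := by
  unfold interfaceMode
  simp_rw [← not_le, ite_not]
  refine Continuous.if_le (by fun_prop) (by fun_prop) continuous_id continuous_const ?_
  rintro x rfl
  simp

lemma hasDerivAt_interfaceMode (μp μm : ℂ) {x : ℝ} (hx : x ≠ 0) :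
    HasDerivAt (interfaceMode μp μm) (pwConst (-μp) μm x * interfaceMode μp μm x) x := by
  have hexp : ∀ a : ℂ, HasDerivAt (fun x : ℝ => Complex.exp (a * x)) (a * Complex.exp (a * x)) x :=
    fun a => by
      have := ((hasDerivAt_id x).ofReal_comp.const_mul a).cexp
      simpa [mul_comm] using this
  rcases lt_or_gt_of_ne hx with h | h
  · have : interfaceMode μp μm =ᶠ[𝓝 x] fun x => Complex.exp (μm * x) := by
      filter_upwards [Iio_mem_nhds h] with t ht
      simp [interfaceMode, (Set.mem_Iio.1 ht).le.not_gt]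
    simpa [pwConst, interfaceMode, h.le.not_gt] using (hexp μm).congr_of_eventuallyEq this
  · have : interfaceMode μp μm =ᶠ[𝓝 x] fun x => Complex.exp (-μp * x) := by
      filter_upwards [Ioi_mem_nhds h] with t ht
      simp [interfaceMode, Set.mem_Ioi.1 ht]
    simpa [pwConst, interfaceMode, h] using (hexp (-μp)).congr_of_eventuallyEq this

lemma interfaceMode_sq_Ioi (μp μm : ℂ) : Set.EqOn (fun x => interfaceMode μp μm x ^ 2)
    (fun x : ℝ => Complex.exp ((-(2 * μp)) * x)) (Set.Ioi 0) := fun x hx => by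
  simp only [interfaceMode, if_pos (Set.mem_Ioi.1 hx), ← Complex.exp_nat_mul]
  congr 1; push_cast; ring

lemma interfaceMode_sq_Iic (μp μm : ℂ) : Set.EqOn (fun x => interfaceMode μp μm x ^ 2)
    (fun x : ℝ => Complex.exp ((2 * μm) * x)) (Set.Iic 0) := fun x hx => by
  simp only [interfaceMode, if_neg (Set.mem_Iic.1 hx).not_gt, ← Complex.exp_nat_mul]
  congr 1; push_cast; ring

section

variable {μp μm : ℂ}

lemma neg_two_mul_re (hμp : 0 < μp.re) : (-(2 * μp)).re < 0 := by simpa using hμp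

lemma two_mul_re (hμm : 0 < μm.re) : 0 < (2 * μm).re := by simpa using hμm

lemma integrable_interfaceMode_sq (hμp : 0 < μp.re) (hμm : 0 < μm.re) :
    Integrable (fun x => interfaceMode μp μm x ^ 2) := by
  rw [← integrableOn_univ, ← Set.Iic_union_Ioi (a := (0 : ℝ))]
  exact ((integrableOn_congr_fun (interfaceMode_sq_Iic μp μm) measurableSet_Iic).2
    (integrableOn_exp_mul_complex_Iic (two_mul_re hμm) 0)).union
    ((integrableOn_congr_fun (interfaceMode_sq_Ioi μp μm) measurableSet_Ioi).2
      (integrableOn_exp_mul_complex_Ioi (neg_two_mul_re hμp) 0))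

lemma memLp_interfaceMode (hμp : 0 < μp.re) (hμm : 0 < μm.re) :
    MemLp (interfaceMode μp μm) 2 := by
  rw [memLp_two_iff_integrable_sq_norm (continuous_interfaceMode μp μm).aestronglyMeasurable]
  simpa using (integrable_interfaceMode_sq hμp hμm).norm

/-- The square is taken without modulus because Green's formula is bilinear; this integral decides
algebraic simplicity. -/
lemma integral_pwConst_mul_interfaceMode_sq (hμp : 0 < μp.re) (hμm : 0 < μm.re) (a b : ℂ) :
    ∫ x, pwConst a b x * interfaceMode μp μm x ^ 2 = a / (2 * μp) + b / (2 * μm) := by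
  have hi := integrable_interfaceMode_sq hμp hμm
  have e1 : Set.EqOn (fun x => pwConst a b x * interfaceMode μp μm x ^ 2)
      (fun x : ℝ => a * Complex.exp ((-(2 * μp)) * x)) (Set.Ioi 0) := fun x hx => by
    have := interfaceMode_sq_Ioi μp μm hx
    simp only at this
    simp only [this, pwConst, if_pos (Set.mem_Ioi.1 hx)]
  have e2 : Set.EqOn (fun x => pwConst a b x * interfaceMode μp μm x ^ 2)
      (fun x : ℝ => b * Complex.exp ((2 * μm) * x)) (Set.Iic 0) := fun x hx => by
    have := interfaceMode_sq_Iic μp μm hx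
    simp only at this
    simp only [this, pwConst, if_neg (Set.mem_Iic.1 hx).not_gt]
  have i1 := (integrableOn_congr_fun e1 measurableSet_Ioi).2
    ((integrableOn_exp_mul_complex_Ioi (neg_two_mul_re hμp) 0).const_mul a)
  have i2 := (integrableOn_congr_fun e2 measurableSet_Iic).2
    ((integrableOn_exp_mul_complex_Iic (two_mul_re hμm) 0).const_mul b)
  rw [← intervalIntegral.integral_Iic_add_Ioi i2 i1, setIntegral_congr_fun measurableSet_Iic e2,
    setIntegral_congr_fun measurableSet_Ioi e1, integral_const_mul, integral_const_mul,
    integral_exp_mul_complex_Ioi (neg_two_mul_re hμp),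
    integral_exp_mul_complex_Iic (two_mul_re hμm)]
  simp
  ring

end

/-! ### The Maxwell problem off the rays -/

section

variable {k : ℝ} {p q μp μm : ℂ}

lemma tm_exponent (hp : p ≠ 0) (hp' : (k : ℂ) ^ 2 - p = μp ^ 2) :
    p * (((k : ℂ) ^ 2 - p) / p) = μp ^ 2 := by
  rw [← hp']; field_simp

/-- There are no TE interface modes, so the orthogonality condition of the Fredholm alternative is
vacuous. -/
lemma exists_te_solution (hμp : 0 < μp.re) (hμm : 0 < μm.re)
    (hp' : (k : ℂ) ^ 2 - p = μp ^ 2) (hq' : (k : ℂ) ^ 2 - q = μm ^ 2) (f : L2C3) :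
    ∃ z Z : ℝ → ℂ, SolvesSystem (pwConst 1 1) (teCoeff k p q) z Z 0 (fun x => - f x 2) := by
  have hD : μp * 1 + μm * 1 ≠ 0 := fun h => by
    have := congrArg Complex.re h
    simp at this
    linarith
  refine SolvesSystem.exists_of_orthogonal one_ne_zero one_ne_zero hμp hμm
    (by rw [← hp', one_mul]) (by rw [← hq', one_mul]) (Or.inl hD) MemLp.zero (memLp_apply f 2).neg
    fun u v h => ?_
  obtain ⟨h1, h2⟩ := h.ae_eq_zero one_ne_zero one_ne_zero hμp hμm
    (by rw [← hp', one_mul]) (by rw [← hq', one_mul]) (Or.inl hD)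
  refine integral_eq_zero_of_ae ?_
  filter_upwards [h1, h2] with x h1 h2
  simp [h1, h2]

lemma memLp_tm_rhs (f : L2C3) :
    MemLp (fun x => pwConst p⁻¹ q⁻¹ x * (Complex.I * k * f x 0)) 2 :=
  memLp_pwConst_mul _ _ ((memLp_apply f 0).const_mul _)

/-- Off the rays and off the dispersion relation the Maxwell problem is uniquely solvable. -/
theorem SolvesMaxwell.wellposed (hp : p ≠ 0) (hq : q ≠ 0) (hpr : p ∉ Media.ray k)
    (hqr : q ∉ Media.ray k) (h : (k : ℂ) ^ 2 * (p + q) ≠ p * q) :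
    (∀ f, ∃ u v, SolvesMaxwell k p q u v f) ∧
      ∃ C : ℝ, ∀ u v f, SolvesMaxwell k p q u v f → ‖u‖ ≤ C * ‖f‖ := by
  obtain ⟨μp, hμp, hp'⟩ := exists_exponent hpr
  obtain ⟨μm, hμm, hq'⟩ := exists_exponent hqr
  have hD : μp * q + μm * p ≠ 0 := fun h0 => h ((dispersion_iff hp hq hμp hμm hp' hq').1 h0)
  constructor
  · intro f
    obtain ⟨z, Z, hz⟩ := exists_te_solution hμp hμm hp' hq' f
    obtain ⟨y, Y, hy⟩ := SolvesSystem.exists_of_orthogonal hp hq hμp hμm (tm_exponent hp hp')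
      (tm_exponent hq hq') (Or.inl hD) (memLp_apply f 1).neg (memLp_tm_rhs f) fun u v h => by
        obtain ⟨h1, h2⟩ := h.ae_eq_zero hp hq hμp hμm (tm_exponent hp hp')
          (tm_exponent hq hq') (Or.inl hD)
        refine integral_eq_zero_of_ae ?_
        filter_upwards [h1, h2] with x h1 h2
        simp [h1, h2]
    obtain ⟨u, v, h, -⟩ := exists_solvesMaxwell hp hq hy hz
    exact ⟨u, v, h⟩
  · obtain ⟨C, -, hC⟩ := SolvesMaxwell.estimate hp hq hμp hμm hp' hq'
    refine ⟨C, fun u v f hs => ?_⟩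
    obtain ⟨y, Y, hy, hY, h⟩ := hs.exists_tm hp hq
    exact hC u v f hs y Y hy hY h (Or.inl hD)

lemma IsWeakCurl.sub_smul {k : ℝ} {u v u' v' : L2C3} (h : IsWeakCurl k u v)
    (h' : IsWeakCurl k u' v') (c : ℂ) : IsWeakCurl k (u - c • u') (v - c • v') := by
  simpa [sub_eq_add_neg] using h.add (h'.smul (-c))

lemma SolvesMaxwell.sub_smul {u v f u' v' f' : L2C3} (h : SolvesMaxwell k p q u v f)
    (h' : SolvesMaxwell k p q u' v' f') (c : ℂ) :
    SolvesMaxwell k p q (u - c • u') (v - c • v') (f - c • f') := by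
  refine ⟨h.1.sub_smul h'.1 c, ?_⟩
  have := h.2.sub_smul h'.2 c
  rw [map_sub, map_smul]
  convert this using 1
  rw [smul_add]
  abel

/-- Off the rays and on the dispersion relation the kernel is spanned by an interface mode `u₀`,
the range is the kernel of a bounded functional `Λ`, and `W u₀` is not in the range. -/
theorem SolvesMaxwell.resonant (hp : p ≠ 0) (hq : q ≠ 0) (hpr : p ∉ Media.ray k)
    (hqr : q ∉ Media.ray k) (h : (k : ℂ) ^ 2 * (p + q) = p * q) :
    ∃ (u₀ v₀ : L2C3) (Λ : L2C3 →L[ℂ] ℂ) (C : ℝ), SolvesMaxwell k p q u₀ v₀ 0 ∧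
      (∀ f, (∃ u v, SolvesMaxwell k p q u v f) ↔ Λ f = 0) ∧ Λ (mulPW p q u₀) ≠ 0 ∧
      ∀ u v f, SolvesMaxwell k p q u v f → ∃ c : ℂ, ‖u - c • u₀‖ ≤ C * ‖f‖ := by
  obtain ⟨μp, hμp, hp'⟩ := exists_exponent hpr
  obtain ⟨μm, hμm, hq'⟩ := exists_exponent hqr
  have hμp0 : μp ≠ 0 := fun h => by simp [h] at hμp
  have hμm0 : μm ≠ 0 := fun h => by simp [h] at hμm
  have hD : μp * q + μm * p = 0 := (dispersion_iff hp hq hμp hμm hp' hq').2 h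
  have hk : (k : ℂ) ≠ 0 := fun h0 => by
    rw [h0] at h
    exact mul_ne_zero hp hq (by rw [← h]; ring)
  set e := interfaceMode μp μm with he
  -- With `Y = τ e`, the equation `e' = W Y` requires `τ p = -μp` on the right and `τ q = μm` on the
  -- left; the two are compatible precisely because `D = 0`.
  set τ : ℂ := -μp / p with hτ
  have hτp : τ * p = -μp := by rw [hτ]; field_simp
  have hτq : τ * q = μm := by rw [hτ]; field_simp; linear_combination -hD
  have he2 : MemLp e 2 := memLp_interfaceMode hμp hμm
  have hτe2 : MemLp (fun x => τ * e x) 2 := he2.const_mul τ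
  have hprim : IsPrimitive e (fun x => pwConst (-μp) μm x * e x) :=
    .of_hasDerivAt_off (continuous_interfaceMode μp μm)
      (memLp_pwConst_mul _ _ he2).locallyIntegrable_of_two
      fun x hx => hasDerivAt_interfaceMode μp μm hx
  have hsys : SolvesSystem (pwConst p q) (tmCoeff k p q) e (fun x => τ * e x) 0 0 := by
    refine ⟨hprim.congr (Eventually.of_forall fun x => ?_),
      (hprim.const_mul τ).congr (Eventually.of_forall fun x => ?_), he2, hτe2, MemLp.zero,
      MemLp.zero⟩
    · simp only [Pi.zero_apply, add_zero]
      unfold pwConst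
      split_ifs
      · rw [← hτp]; ring
      · rw [← hτq]; ring
    · simp only [Pi.zero_apply, add_zero]
      unfold tmCoeff pwConst
      split_ifs
      · rw [hp', hτ]; field_simp
      · rw [hq', eq_div_of_mul_eq hq hτq]
        field_simp
  -- every homogeneous solution is a multiple of the interface mode
  have hker : ∀ u v : ℝ → ℂ, SolvesSystem (pwConst p q) (tmCoeff k p q) u v 0 0 →
      ∀ᵐ x, u x = u 0 * e x ∧ v x = u 0 * (τ * e x) := fun u v huv => by
    have h1 := (huv.add (hsys.const_mul (-u 0))).congr_rhs (F' := 0) (G' := 0)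
      (Eventually.of_forall fun x => by simp) (Eventually.of_forall fun x => by simp)
    obtain ⟨h2, h3⟩ := h1.ae_eq_zero hp hq hμp hμm (tm_exponent hp hp') (tm_exponent hq hq')
      (Or.inr (by rw [he, interfaceMode_zero]; ring))
    filter_upwards [h2, h3] with x h2 h3
    simp only [Pi.zero_apply] at h2 h3
    exact ⟨by linear_combination h2, by linear_combination h3⟩
  -- the functional
  have hη0 : MemLp (fun x => starRingEnd ℂ (pwConst p⁻¹ q⁻¹ x * (Complex.I * k * e x))) 2 :=
    (memLp_pwConst_mul _ _ (he2.const_mul _)).star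
  have hη1 : MemLp (fun x => starRingEnd ℂ (τ * e x)) 2 := hτe2.star
  set η := mkL2C3 hη0 hη1 (MemLp.zero (p := 2) (μ := volume)) with hη
  -- Up to sign, `Λ` is Green's pairing of the TM data of `f` with the interface mode; the
  -- conjugations in `η` undo the one in the inner product.
  have hΛ : ∀ f : L2C3, innerSL ℂ η f =
      ∫ x, (f x 1 * (τ * e x) + pwConst p⁻¹ q⁻¹ x * (Complex.I * k * f x 0) * e x) := fun f => by
    rw [innerSL_apply_apply, L2.inner_def]
    refine integral_congr_ae ?_
    filter_upwards [mkL2C3_ae hη0 hη1 (MemLp.zero (p := 2) (μ := volume))] with x hx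
    rw [PiLp.inner_apply, Fin.sum_univ_three]
    simp only [RCLike.inner_apply, hη, hx.1, hx.2.1, hx.2.2, Complex.conj_conj, Pi.zero_apply,
      map_zero, mul_zero, add_zero]
    ring
  -- the interface mode as a Maxwell field
  have hsys0 : SolvesSystem (pwConst p q) (tmCoeff k p q) e (fun x => τ * e x)
      (fun x => - (0 : L2C3) x 1)
      (fun x => pwConst p⁻¹ q⁻¹ x * (Complex.I * k * (0 : L2C3) x 0)) := by
    refine hsys.congr_rhs ?_ ?_ <;> exact Eventually.of_forall fun x => by simp
  have hte0 : SolvesSystem (pwConst 1 1) (teCoeff k p q) 0 0 0 (fun x => - (0 : L2C3) x 2) := by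
    have hzero : IsPrimitive 0 0 := ⟨locallyIntegrable_zero, fun a b => by simp⟩
    refine SolvesSystem.congr_rhs (F := 0) (G := 0) ⟨by simpa using! hzero, by simpa using! hzero,
      MemLp.zero, MemLp.zero, MemLp.zero, MemLp.zero⟩ (Eventually.of_forall fun x => rfl)
      (Eventually.of_forall fun x => by simp)
  obtain ⟨u₀, v₀, hs₀, hu0, hu1, hv2⟩ := exists_solvesMaxwell hp hq hsys0 hte0
  obtain ⟨C, -, hC⟩ := SolvesMaxwell.estimate hp hq hμp hμm hp' hq'
  refine ⟨u₀, v₀, innerSL ℂ η, C, hs₀, fun f => ⟨?_, ?_⟩, ?_, ?_⟩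
  · rintro ⟨u, v, hs⟩
    obtain ⟨y, Y, -, -, hy⟩ := hs.exists_tm hp hq
    have h1 := hy.integral_sub_eq_zero hsys
    rw [hΛ, ← neg_eq_zero, ← integral_neg, ← h1]
    exact integral_congr_ae (Eventually.of_forall fun x => by ring)
  · intro h0
    rw [hΛ] at h0
    obtain ⟨z, Z, hz⟩ := exists_te_solution hμp hμm hp' hq' f
    obtain ⟨y, Y, hy⟩ := SolvesSystem.exists_of_orthogonal hp hq hμp hμm (tm_exponent hp hp')
      (tm_exponent hq hq') (Or.inr ⟨e, _, hsys, interfaceMode_zero μp μm⟩) (memLp_apply f 1).neg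
      (memLp_tm_rhs f) fun u v huv => by
        have h1 : ∫ x, ((fun x => - f x 1) x * v x -
            pwConst p⁻¹ q⁻¹ x * (Complex.I * k * f x 0) * u x) = ∫ x, -u 0 *
            (f x 1 * (τ * e x) + pwConst p⁻¹ q⁻¹ x * (Complex.I * k * f x 0) * e x) := by
          refine integral_congr_ae ?_
          filter_upwards [hker u v huv] with x hx
          simp only [hx.1, hx.2]
          ring
        refine h1.trans ?_
        rw [integral_const_mul, h0, mul_zero]
    obtain ⟨u, v, h, -⟩ := exists_solvesMaxwell hp hq hy hz
    exact ⟨u, v, h⟩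
  · rw [hΛ]
    -- Here `u₀` has the components `u 0 = i k e / W` and `u 1 = -τ e`, so the integrand is `-(τ² W
    -- + k² / W) e²`.
    have h1 : ∫ x, (mulPW p q u₀ x 1 * (τ * e x) +
        pwConst p⁻¹ q⁻¹ x * (Complex.I * k * mulPW p q u₀ x 0) * e x) =
        ∫ x, pwConst (-(τ ^ 2 * p + k ^ 2 / p)) (-(τ ^ 2 * q + k ^ 2 / q)) x * e x ^ 2 := by
      refine integral_congr_ae ?_
      filter_upwards [mulPW_ae p q u₀, hu0, hu1,
        Lp.coeFn_zero (EuclideanSpace ℂ (Fin 3)) 2 (volume : Measure ℝ)] with x h1 h2 h3 h4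
      rw [h1, h1, h2, h3, h4]
      simp only [Pi.zero_apply, PiLp.zero_apply, sub_zero]
      unfold pwConst
      split_ifs
      · field_simp
        linear_combination ((k : ℂ) ^ 2 * e x ^ 2) * Complex.I_sq
      · field_simp
        linear_combination ((k : ℂ) ^ 2 * e x ^ 2) * Complex.I_sq
    rw [h1, he, integral_pwConst_mul_interfaceMode_sq hμp hμm]
    intro h0
    have hq0 : q * μp = -(μm * p) := by linear_combination hD
    -- the value is `-k² (p μp + q μm) / (2 p q μp μm)`
    have h2 : (k : ℂ) ^ 2 * (p * μp + q * μm) = 0 := by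
      have e1 : τ ^ 2 * p = -(τ * μp) := by linear_combination τ * hτp
      have e2 : τ ^ 2 * q = τ * μm := by linear_combination τ * hτq
      rw [e1, e2] at h0
      field_simp at h0
      linear_combination -h0
    have h3 : p * μp + q * μm = 0 := (mul_eq_zero.1 h2).resolve_left (pow_ne_zero 2 hk)
    -- Both `p μp + q μm` and `q μp + p μm` would vanish; eliminating the exponents forces `p = q`,
    -- and then `D = p (μp + μm) ≠ 0`.
    have h4 : p * (q - p) = 0 := by
      linear_combination μp * h3 - μm * hD + p * hp' - p * hq'
    have h5 : p = q := (sub_eq_zero.1 ((mul_eq_zero.1 h4).resolve_left hp)).symm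
    subst h5
    have h6 : μp + μm = 0 := (mul_eq_zero.1 (by linear_combination hD :
      p * (μp + μm) = 0)).resolve_left hp
    have := congrArg Complex.re h6
    simp at this
    linarith
  · intro u v f hs
    obtain ⟨y, Y, hy, hY, ht⟩ := hs.exists_tm hp hq
    -- The mode has the value `1` at the interface, so subtracting `y 0` times it brings the
    -- solution under the estimate for `y 0 = 0`.
    refine ⟨y 0, ?_⟩
    have hss := hs.sub_smul hs₀ (y 0)
    rw [smul_zero, sub_zero] at hss
    have ht' := (ht.add (hsys.const_mul (-y 0))).congr_rhs (F' := fun x => - f x 1)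
      (G' := fun x => pwConst p⁻¹ q⁻¹ x * (Complex.I * k * f x 0))
      (Eventually.of_forall fun x => by simp) (Eventually.of_forall fun x => by simp)
    refine hC _ _ _ hss _ _ ?_ ?_ ht' (Or.inr (by rw [he, interfaceMode_zero]; ring))
    · filter_upwards [hy, hv2, Lp.coeFn_sub v (y 0 • v₀), Lp.coeFn_smul (y 0) v₀] with x h1 h2 h3 h4
      rw [h3, Pi.sub_apply, h4, h1]
      simp [h2]
      ring
    · filter_upwards [hY, hu1, Lp.coeFn_sub u (y 0 • u₀), Lp.coeFn_smul (y 0) u₀] with x h1 h2 h3 h4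
      rw [h3, Pi.sub_apply, h4, h1]
      simp [h2]
      ring

end

end Maxwell1D

/-! ### Abstract criteria for the Weyl, Fredholm and algebraic properties of a pencil -/

namespace OperatorPencil

variable {H R : Type*} [NormedAddCommGroup H] [InnerProductSpace ℂ H]
  [NormedAddCommGroup R] [InnerProductSpace ℂ R] {P : OperatorPencil H R} {ω l : ℂ}

/-- Along a Weyl sequence the part `u - c • e` tends to zero in norm, while `c • e` stays bounded
and its inner product with `u` tends to zero because `u` converges weakly to zero; this contradicts
`‖u‖ = 1`. Taking `e = 0` covers a plain lower bound. -/
lemma notMem_weylSpectrum (e : H) (C : ℝ)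
    (h : ∀ u : P.dom ω, ∃ c : ℂ, ‖(u : H) - c • e‖ ≤ C * ‖P.op ω 1 u‖) : ω ∉ P.weylSpectrum := by
  rintro ⟨-, u, hu1, hu2, hu3⟩
  have hle : ∀ n, 1 ≤ C * ‖P.op ω 1 (u n)‖ +
      (1 + C * ‖P.op ω 1 (u n)‖) / ‖e‖ * ‖inner ℂ e (u n : H)‖ := fun n => by
    obtain ⟨c, hc⟩ := h (u n)
    have h1 : inner ℂ (u n : H) (u n : H) = inner ℂ ((u n : H) - c • e) (u n : H) +
        starRingEnd ℂ c * inner ℂ e (u n : H) := by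
      rw [← inner_smul_left, ← inner_add_left, sub_add_cancel]
    have h2 : ‖inner ℂ (u n : H) (u n : H)‖ = 1 := by
      rw [inner_self_eq_norm_sq_to_K, hu1]; simp
    have h3 : ‖inner ℂ ((u n : H) - c • e) (u n : H)‖ ≤ C * ‖P.op ω 1 (u n)‖ := by
      refine (norm_inner_le_norm _ _).trans ?_
      rwa [hu1, mul_one]
    have h4 : ‖starRingEnd ℂ c * inner ℂ e (u n : H)‖ ≤
        (1 + C * ‖P.op ω 1 (u n)‖) / ‖e‖ * ‖inner ℂ e (u n : H)‖ := by
      rw [norm_mul, RCLike.norm_conj]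
      rcases eq_or_ne e 0 with rfl | he
      · simp
      · refine mul_le_mul_of_nonneg_right ?_ (norm_nonneg _)
        rw [le_div_iff₀ (norm_pos_iff.2 he), ← norm_smul]
        have h5 : c • e = (u n : H) - ((u n : H) - c • e) := by abel
        have h6 := norm_sub_le (u n : H) ((u n : H) - c • e)
        rw [← h5, hu1] at h6
        linarith
    have h5 := norm_add_le (inner ℂ ((u n : H) - c • e) (u n : H))
      (starRingEnd ℂ c * inner ℂ e (u n : H))
    rw [← h1, h2] at h5
    linarith
  have hlim : Tendsto (fun n => C * ‖P.op ω 1 (u n)‖ +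
      (1 + C * ‖P.op ω 1 (u n)‖) / ‖e‖ * ‖inner ℂ e (u n : H)‖) atTop (𝓝 0) := by
    have t1 := hu3.const_mul C
    have t2 := ((t1.const_add 1).div_const ‖e‖).mul (hu2 e).norm
    simpa using t1.add t2
  exact absurd (ge_of_tendsto' hlim hle) (by norm_num)

lemma notMem_weylSpectrum_of_mem_innerResolventSet (h : 1 ∈ P.innerResolventSet ω) :
    ω ∉ P.weylSpectrum := by
  obtain ⟨C, hC⟩ := h.2
  exact notMem_weylSpectrum 0 C fun u => ⟨0, by simpa using hC u⟩

lemma isFredholm_of_mem_innerResolventSet (h : l ∈ P.innerResolventSet ω) :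
    P.IsFredholm ω l ∧ P.index ω l = 0 := by
  have hk : LinearMap.ker (P.op ω l) = ⊥ := LinearMap.ker_eq_bot.2 h.1.1
  have hr : LinearMap.range (P.op ω l) = ⊤ := LinearMap.range_eq_top.2 h.1.2
  refine ⟨⟨?_, ?_, ?_⟩, ?_⟩
  · simp [HasClosedRange, hr]
  · rw [HasFinKer, hk]; infer_instance
  · rw [HasFinCoker, hr]; infer_instance
  · rw [index, hk, hr]
    have : Module.finrank ℂ (R ⧸ (⊤ : Submodule ℂ R)) = 0 := Module.finrank_zero_of_subsingleton
    simp [this]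

lemma IsFredholm.isSemiFredholm (h : P.IsFredholm ω l) : P.IsSemiFredholm ω l := ⟨h.1, Or.inl h.2.1⟩

lemma one_mem_Delta_of_mem_innerResolventSet (h : 1 ∈ P.innerResolventSet ω) : 1 ∈ P.Delta ω := by
  have hs := (isFredholm_of_mem_innerResolventSet h).1.isSemiFredholm
  exact ⟨hs, 1, mem_connectedComponentIn hs, h⟩

/-- The whole ball is semi-Fredholm and connected, so the component of `1` contains nearby resolvent
points. -/
lemma one_mem_Delta_of_punctured (hs : P.IsSemiFredholm ω 1) {δ : ℝ} (hδ : 0 < δ)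
    (h : ∀ l : ℂ, l ≠ 1 → ‖l - 1‖ < δ → l ∈ P.innerResolventSet ω) : 1 ∈ P.Delta ω := by
  have hsub : Metric.ball (1 : ℂ) δ ⊆ {m | P.IsSemiFredholm ω m} := fun l hl => by
    by_cases h1 : l = 1
    · rw [h1]; exact hs
    · exact (isFredholm_of_mem_innerResolventSet (h l h1 (by
        rwa [← dist_eq_norm]))).1.isSemiFredholm
  refine ⟨hs, 1 + (δ / 2 : ℝ), ?_, h _ ?_ ?_⟩
  · refine (convex_ball (1 : ℂ) δ).isPreconnected.subset_connectedComponentIn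
      (Metric.mem_ball_self hδ) hsub ?_
    rw [Metric.mem_ball, dist_eq_norm, add_sub_cancel_left, Complex.norm_real, Real.norm_eq_abs,
      abs_of_pos (by positivity)]
    linarith
  · intro h0
    have : (δ / 2 : ℝ) = 0 := by
      have := add_eq_left.1 h0
      exact_mod_cast this
    linarith
  · rw [add_sub_cancel_left, Complex.norm_real, Real.norm_eq_abs, abs_of_pos (by positivity)]
    linarith

/-- `ω` lies in none of the essential spectra. -/
lemma notMem_essSpectrum (hF : P.IsFredholm ω 1) (hi : P.index ω 1 = 0) (hΔ : 1 ∈ P.Delta ω)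
    (j : Fin 5) : ω ∉ P.essSpectrum j := by
  fin_cases j
  · exact fun h => h.2 hF.isSemiFredholm
  · exact fun h => h.2 ⟨hF.1, hF.2.1⟩
  · exact fun h => h.2 hF
  · exact fun h => h.2 ⟨hF, hi⟩
  · exact fun h => h.2 hΔ

/-- A closed range is part of each of the five conditions, `Delta` included. -/
lemma mem_essSpectrum (hω : ω ∈ P.Ω) (h : ¬ P.HasClosedRange ω 1) (j : Fin 5) :
    ω ∈ P.essSpectrum j := by
  fin_cases j
  · exact ⟨hω, fun h' => h h'.1⟩
  · exact ⟨hω, fun h' => h h'.1⟩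
  · exact ⟨hω, fun h' => h h'.1⟩
  · exact ⟨hω, fun h' => h h'.1.1⟩
  · exact ⟨hω, fun h' => h h'.1.1⟩

section Simple

variable {e : P.dom ω} {Λ : R →L[ℂ] ℂ}

/-- The range is the kernel of a bounded functional, hence closed; the functional is nonzero because
of `hB`, so the codimension is one and balances the kernel. -/
lemma isFredholm_of_functional (he : e ≠ 0) (he0 : P.op ω l e = 0)
    (hker : ∀ u : P.dom ω, P.op ω l u = 0 → ∃ c : ℂ, u = c • e)
    (hrange : ∀ f, (∃ u, P.op ω l u = f) ↔ Λ f = 0) (hB : Λ (P.B ω e) ≠ 0) :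
    P.IsGeomSimple ω l ∧ P.IsFredholm ω l ∧ P.index ω l = 0 := by
  have hk : Module.finrank ℂ (LinearMap.ker (P.op ω l)) = 1 := by
    refine finrank_eq_one (⟨e, he0⟩ : LinearMap.ker (P.op ω l)) (fun h => he ?_) ?_
    · exact congrArg Subtype.val h
    · rintro ⟨w, hw⟩
      obtain ⟨c, hc⟩ := hker w hw
      exact ⟨c, Subtype.ext hc.symm⟩
  have hr : LinearMap.range (P.op ω l) = LinearMap.ker (Λ : R →ₗ[ℂ] ℂ) := by
    ext f
    exact hrange f
  have hsurj : Function.Surjective (Λ : R →ₗ[ℂ] ℂ) := fun z =>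
    ⟨(z / Λ (P.B ω e)) • P.B ω e, by simp [hB]⟩
  have eqv : (R ⧸ LinearMap.range (P.op ω l)) ≃ₗ[ℂ] ℂ :=
    (Submodule.quotEquivOfEq _ _ hr).trans (LinearMap.quotKerEquivOfSurjective _ hsurj)
  refine ⟨hk, ⟨?_, ?_, ?_⟩, ?_⟩
  · rw [HasClosedRange, hr]
    exact Λ.isClosed_ker
  · exact FiniteDimensional.of_finrank_pos (by rw [hk]; norm_num)
  · exact Module.Finite.equiv eqv.symm
  · rw [index, hk, eqv.finrank_eq, Module.finrank_self]
    norm_num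

/-- A generalized eigenvector over `c • e` would place `c • B e` in the range, that is, in the
kernel of `Λ`. -/
lemma isAlgSimple_of_functional (hg : P.IsGeomSimple ω l)
    (hker : ∀ u : P.dom ω, P.op ω l u = 0 → ∃ c : ℂ, u = c • e)
    (hrange : ∀ f, (∃ u, P.op ω l u = f) ↔ Λ f = 0) (hB : Λ (P.B ω e) ≠ 0) :
    P.IsAlgSimple ω l := by
  refine ⟨hg, fun v hv hv0 => ?_⟩
  rintro ⟨u, hu, -⟩
  obtain ⟨c, rfl⟩ := hker v hv
  have h1 := (hrange _).1 ⟨u, hu⟩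
  rw [map_smul, map_smul, smul_eq_zero] at h1
  rcases h1 with rfl | h1
  · exact hv0 (zero_smul ℂ e)
  · exact hB h1

/-- The first two members of an infinite chain already contradict simplicity. -/
lemma IsAlgSimple.not_hasInfiniteAlgMult (h : P.IsAlgSimple ω l) : ¬ P.HasInfiniteAlgMult ω l := by
  rintro (h1 | ⟨u, hli, hu0, hk, hs⟩)
  · exact h1 (FiniteDimensional.of_finrank_pos (by
      have := h.1
      rw [IsGeomSimple] at this
      rw [this]; norm_num))
  · refine h.2 (u 0) hk hu0 ⟨u 1, hs 0, ?_⟩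
    have := hli.comp ![1, 0] (by decide)
    convert this using 1
    funext i
    fin_cases i <;> rfl

end Simple

end OperatorPencil

namespace Maxwell1D

/-! ### The closed graph -/

lemma exists_pair_eq {φ : ℝ → Fin 3 → ℂ} (h : IsTest φ) :
    ∃ T : L2C3 →L[ℂ] ℂ, ∀ u, T u = pair u φ := by
  have hs : ∀ i, MemLp (fun x => starRingEnd ℂ (φ x i)) 2 := fun i => (h.comp_apply i).memLp.star
  refine ⟨innerSL ℂ (mkL2C3 (hs 0) (hs 1) (hs 2)), fun u => ?_⟩
  rw [innerSL_apply_apply, L2.inner_def]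
  refine integral_congr_ae ?_
  filter_upwards [mkL2C3_ae (hs 0) (hs 1) (hs 2)] with x hx
  rw [PiLp.inner_apply, Fin.sum_univ_three, Fin.sum_univ_three]
  simp only [RCLike.inner_apply, hx.1, hx.2.1, hx.2.2, Complex.conj_conj]

lemma continuous_pair {φ : ℝ → Fin 3 → ℂ} (h : IsTest φ) : Continuous fun u => pair u φ := by
  obtain ⟨T, hT⟩ := exists_pair_eq h
  exact T.continuous.congr hT

lemma continuous_mulPW (a b : ℂ) : Continuous (mulPW a b) := by
  refine AddMonoidHomClass.continuous_of_bound (mulPW a b) (‖a‖ + ‖b‖) fun u => ?_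
  refine Lp.norm_le_mul_norm_of_ae_le_mul ?_
  filter_upwards [(memLp_pwConst_smul a b u).coeFn_toLp] with x hx
  have h2 : mulPW a b u = (memLp_pwConst_smul a b u).toLp := rfl
  rw [h2, hx, norm_smul]
  refine mul_le_mul_of_nonneg_right ?_ (norm_nonneg _)
  unfold pwConst
  split_ifs
  · linarith [norm_nonneg b]
  · linarith [norm_nonneg a]

lemma isClosed_rangeSpace (k : ℝ) : IsClosed (rangeSpace k : Set L2C3) := by
  have : (rangeSpace k : Set L2C3) =
      ⋂ (φ : ℝ → ℂ) (_ : IsTest φ), {u | pair u (gradK (-k) φ) = 0} := by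
    ext u
    simp only [Set.mem_iInter]
    rfl
  rw [this]
  exact isClosed_iInter fun φ => isClosed_iInter fun hφ =>
    isClosed_eq (continuous_pair (hφ.gradK _)) continuous_const

instance (k : ℝ) : CompleteSpace (rangeSpace k) := (isClosed_rangeSpace k).completeSpace_coe

/-- The graph of the weak curl. -/
def curlGraph (k : ℝ) : Submodule ℂ (L2C3 × L2C3) where
  carrier := {q | IsWeakCurl k q.1 q.2}
  zero_mem' := isWeakCurl_zero k
  add_mem' h h' := h.add h'
  smul_mem' c _ h := h.smul c

lemma isClosed_curlGraph (k : ℝ) : IsClosed (curlGraph k : Set (L2C3 × L2C3)) := by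
  have : (curlGraph k : Set (L2C3 × L2C3)) =
      ⋂ (φ : ℝ → Fin 3 → ℂ) (_ : IsTest φ), {q | pair q.1 (curlK (-k) φ) = pair q.2 φ} := by
    ext u
    simp only [Set.mem_iInter]
    rfl
  rw [this]
  exact isClosed_iInter fun φ => isClosed_iInter fun hφ =>
    isClosed_eq ((continuous_pair (hφ.curlK _)).comp continuous_fst)
      ((continuous_pair hφ).comp continuous_snd)

/-- The triples `(u, v, f)` with `v = ∇_k × u`, `f = ∇_k × v - W u`, `∇_k · f = 0`. -/
noncomputable def maxwellGraph (k : ℝ) (p q : ℂ) : Submodule ℂ ((L2C3 × L2C3) × rangeSpace k) :=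
  (curlGraph k).comap (LinearMap.fst ℂ (L2C3 × L2C3) (rangeSpace k)) ⊓
    (curlGraph k).comap ((LinearMap.snd ℂ L2C3 L2C3 ∘ₗ LinearMap.fst ℂ _ _).prod
      ((rangeSpace k).subtype ∘ₗ LinearMap.snd ℂ _ _ +
        mulPW p q ∘ₗ LinearMap.fst ℂ L2C3 L2C3 ∘ₗ LinearMap.fst ℂ _ _))

lemma mem_maxwellGraph {k : ℝ} {p q : ℂ} {x : (L2C3 × L2C3) × rangeSpace k} :
    x ∈ maxwellGraph k p q ↔ SolvesMaxwell k p q x.1.1 x.1.2 x.2 := Iff.rfl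

lemma isClosed_maxwellGraph (k : ℝ) (p q : ℂ) :
    IsClosed (maxwellGraph k p q : Set ((L2C3 × L2C3) × rangeSpace k)) := by
  have hc : Continuous fun x : (L2C3 × L2C3) × rangeSpace k =>
      (x.1.2, (x.2 : L2C3) + mulPW p q x.1.1) := by
    have := continuous_mulPW p q
    fun_prop
  exact ((isClosed_curlGraph k).preimage continuous_fst).inter ((isClosed_curlGraph k).preimage hc)

instance (k : ℝ) (p q : ℂ) : CompleteSpace (maxwellGraph k p q) :=
  (isClosed_maxwellGraph k p q).completeSpace_coe

/-- The open mapping theorem for the projection of the complete graph onto its closed range. It is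
the graph that must be complete, not `E`. -/
lemma exists_lift_norm_le {E F : Type*} [NormedAddCommGroup E] [NormedSpace ℂ E]
    [NormedAddCommGroup F] [NormedSpace ℂ F] [CompleteSpace F] (Γ : Submodule ℂ (E × F))
    [CompleteSpace Γ] (S : Submodule ℂ F) (hS : IsClosed (S : Set F)) (hΓ : ∀ x ∈ Γ, x.2 ∈ S)
    (hs : ∀ f ∈ S, ∃ e, (e, f) ∈ Γ) : ∃ C : ℝ, ∀ f ∈ S, ∃ e, (e, f) ∈ Γ ∧ ‖e‖ ≤ C * ‖f‖ := by
  have : CompleteSpace S := hS.completeSpace_coe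
  let ρ : Γ →L[ℂ] S := (ContinuousLinearMap.snd ℂ E F ∘L Γ.subtypeL).codRestrict S
    fun x => hΓ x x.2
  have hsurj : Function.Surjective ρ := fun f => by
    obtain ⟨e, he⟩ := hs f f.2
    exact ⟨⟨(e, f), he⟩, rfl⟩
  obtain ⟨C, -, hC⟩ := ρ.exists_preimage_norm_le hsurj
  refine ⟨C, fun f hf => ?_⟩
  obtain ⟨⟨⟨e, f'⟩, he⟩, hx, hn⟩ := hC ⟨f, hf⟩
  obtain rfl : f' = f := congrArg Subtype.val hx
  exact ⟨e, he, (norm_fst_le (e, f')).trans hn⟩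

/-- The open mapping theorem yields some preimage with a bound, and injectivity identifies it with
`u`. Keeping the intermediate field `v` as a coordinate of `maxwellGraph` expresses the second order
operator by two closed first order conditions. -/
lemma exists_bound_of_hasClosedRange {m : Media} {k : ℝ} {ω : ℂ} (hω : ω ≠ 0)
    (hinj : ∀ u : (m.pencil k).dom ω, (m.pencil k).op ω 1 u = 0 → u = 0)
    (hcl : (m.pencil k).HasClosedRange ω 1) :
    ∃ C : ℝ, ∀ u : (m.pencil k).dom ω, ‖(u : L2C3)‖ ≤ C * ‖(m.pencil k).op ω 1 u‖ := by
  obtain ⟨C, hC⟩ := exists_lift_norm_le (maxwellGraph k (1 * m.WPlus ω) (1 * m.WMinus ω))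
    (LinearMap.range ((m.pencil k).op ω 1)) hcl
    (fun x hx => by
      obtain ⟨u, -, hu⟩ := exists_dom_of_solvesMaxwell hω one_ne_zero (mem_maxwellGraph.1 hx)
      exact ⟨u, hu⟩)
    (by
      rintro _ ⟨u, rfl⟩
      obtain ⟨v, hv⟩ := exists_solvesMaxwell_op (l := 1) u
      exact ⟨(u, v), mem_maxwellGraph.2 hv⟩)
  refine ⟨C, fun u => ?_⟩
  obtain ⟨⟨w, v⟩, hx, hn⟩ := hC _ ⟨u, rfl⟩
  obtain ⟨u', hu', hTu'⟩ := exists_dom_of_solvesMaxwell hω one_ne_zero (mem_maxwellGraph.1 hx)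
  have h2 : u' = u := sub_eq_zero.1 (hinj _ (by rw [map_sub, hTu', sub_self]))
  rw [← h2, hu', hTu']
  exact (norm_fst_le (w, v)).trans hn

/-! ### Absence of eigenvalues on the rays -/

lemma SolvesSystem.exists_exponent_or {k : ℝ} (p : ℂ) :
    (∃ μ : ℂ, 0 < μ.re ∧ (k : ℂ) ^ 2 - p = μ ^ 2) ∨ ∃ κ : ℝ, (k : ℂ) ^ 2 - p = -(κ : ℂ) ^ 2 := by
  by_cases h : p ∈ Media.ray k
  · exact Or.inr (exists_kappa h)
  · exact Or.inl (exists_exponent h)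

/-- One half-line is oscillatory; by reflection it may be taken to be the right one. -/
lemma SolvesSystem.eq_zero_of_ray {αp αm βp βm p q : ℂ} {k : ℝ} (hαp : αp ≠ 0) (hαm : αm ≠ 0)
    (hβp : αp * βp = (k : ℂ) ^ 2 - p) (hβm : αm * βm = (k : ℂ) ^ 2 - q)
    (hpq : p ∈ Media.ray k ∨ q ∈ Media.ray k) {y Y : ℝ → ℂ}
    (h : SolvesSystem (pwConst αp αm) (pwConst βp βm) y Y 0 0) : y = 0 ∧ Y = 0 := by
  rcases hpq with hp | hq
  · obtain ⟨κ, hκ⟩ := exists_kappa hp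
    refine h.eq_zero_of_oscillatory hαp hαm (hβp.trans hκ) ?_
    rw [hβm]
    exact SolvesSystem.exists_exponent_or q
  · obtain ⟨κ, hκ⟩ := exists_kappa hq
    have := h.reflect.eq_zero_of_oscillatory hαm hαp (hβm.trans hκ) (by
      rw [hβp]
      exact SolvesSystem.exists_exponent_or p)
    constructor
    · funext x
      simpa using congrFun this.1 (-x)
    · funext x
      simpa using congrFun this.2 (-x)

lemma SolvesMaxwell.eq_zero_of_ray {k : ℝ} {p q : ℂ} (hp : p ≠ 0) (hq : q ≠ 0)
    (hpq : p ∈ Media.ray k ∨ q ∈ Media.ray k) {u v : L2C3} (h : SolvesMaxwell k p q u v 0) :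
    u = 0 := by
  obtain ⟨y, Y, hy, hY, hs⟩ := h.exists_tm hp hq
  obtain ⟨z, Z, hz, -, ht⟩ := h.exists_te
  obtain ⟨h1, h2⟩ := SolvesSystem.eq_zero_of_ray hp hq (by field_simp) (by field_simp) hpq
    (hs.congr_rhs (F' := 0) (G' := 0) (Eventually.of_forall fun x => by simp)
      (Eventually.of_forall fun x => by simp))
  obtain ⟨h3, -⟩ := SolvesSystem.eq_zero_of_ray one_ne_zero one_ne_zero (by ring) (by ring) hpq
    (ht.congr_rhs (F' := 0) (G' := 0) (Eventually.of_forall fun x => by simp)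
      (Eventually.of_forall fun x => by simp))
  rw [Lp.eq_zero_iff_ae_eq_zero]
  filter_upwards [h.apply_zero_ae hp hq, hy, hY, hz] with x e0 e1 e2 e3
  rw [h1] at e1
  rw [h2] at e2
  rw [h3] at e3
  ext i
  fin_cases i
  · simp [e0, ← e1]
  · simpa using e2.symm
  · simpa using e3.symm

end Maxwell1D

namespace Maxwell1D

/-! ### Weyl sequences -/

/-- Only the tail of `η` over `|x| ≥ n` meets the support of `y n`, and its norm tends to zero;
Young's inequality with weight `ε` replaces Cauchy-Schwarz. -/
lemma tendsto_integral_mul_conj_of_escaping {y : ℕ → ℝ → ℂ} (hy : ∀ n, MemLp (y n) 2)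
    (h1 : ∀ n, ∫ x, ‖y n x‖ ^ 2 = 1) (h0 : ∀ (n : ℕ) (x : ℝ), |x| < n → y n x = 0) {η : ℝ → ℂ}
    (hη : MemLp η 2) : Tendsto (fun n => ∫ x, y n x * starRingEnd ℂ (η x)) atTop (𝓝 0) := by
  have hs : ∀ n : ℕ, MeasurableSet {x : ℝ | (n : ℝ) ≤ |x|} := fun n =>
    measurableSet_le measurable_const measurable_norm
  have htail : Tendsto (fun n : ℕ => ∫ x, Set.indicator {x : ℝ | (n : ℝ) ≤ |x|}
      (fun x => ‖η x‖ ^ 2) x) atTop (𝓝 0) := by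
    have := tendsto_integral_of_dominated_convergence (μ := volume)
      (F := fun n : ℕ => Set.indicator {x : ℝ | (n : ℝ) ≤ |x|} (fun x => ‖η x‖ ^ 2))
      (f := fun _ => (0 : ℝ)) (fun x => ‖η x‖ ^ 2)
      (fun n => hη.integrable_norm_sq.1.indicator (hs n)) hη.integrable_norm_sq
      (fun n => Eventually.of_forall fun x => by
        refine (norm_indicator_le_norm_self _ _).trans ?_
        simp)
      (Eventually.of_forall fun x => by
        obtain ⟨N, hN⟩ := exists_nat_gt |x|
        refine tendsto_const_nhds.congr' ?_
        filter_upwards [eventually_ge_atTop N] with n hn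
        have : (N : ℝ) ≤ n := by exact_mod_cast hn
        rw [Set.indicator_of_notMem]
        exact not_le.2 (hN.trans_le this))
    simpa using this
  rw [Metric.tendsto_nhds]
  intro ε hε
  filter_upwards [htail.eventually_lt_const (show 0 < ε ^ 2 by positivity)] with n hn
  rw [dist_zero_right]
  calc ‖∫ x, y n x * starRingEnd ℂ (η x)‖
      ≤ ∫ x, (ε / 2 * ‖y n x‖ ^ 2 + ε⁻¹ / 2 * Set.indicator {x : ℝ | (n : ℝ) ≤ |x|}
          (fun x => ‖η x‖ ^ 2) x) := by
        refine norm_integral_le_of_norm_le (((hy n).integrable_norm_sq.const_mul _).add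
          ((hη.integrable_norm_sq.indicator (hs n)).const_mul _)) (Eventually.of_forall fun x => ?_)
        by_cases hx : (n : ℝ) ≤ |x|
        · rw [Set.indicator_of_mem (by exact hx), norm_mul, RCLike.norm_conj]
          have : 0 ≤ ε⁻¹ * (ε * ‖y n x‖ - ‖η x‖) ^ 2 := by positivity
          have h2 : ε⁻¹ * (ε * ‖y n x‖ - ‖η x‖) ^ 2 =
              ε * ‖y n x‖ ^ 2 - 2 * (‖y n x‖ * ‖η x‖) + ε⁻¹ * ‖η x‖ ^ 2 := by
            field_simp; ring
          linarith
        · rw [Set.indicator_of_notMem (by exact hx), h0 n x (not_le.1 hx)]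
          simp
    _ = ε / 2 + ε⁻¹ / 2 * ∫ x, Set.indicator {x : ℝ | (n : ℝ) ≤ |x|} (fun x => ‖η x‖ ^ 2) x := by
        rw [integral_add ((hy n).integrable_norm_sq.const_mul _)
          ((hη.integrable_norm_sq.indicator (hs n)).const_mul _), integral_const_mul,
          integral_const_mul, h1, mul_one]
    _ < ε / 2 + ε⁻¹ / 2 * ε ^ 2 := by gcongr
    _ = ε := by field_simp; ring

/-- The field `(0, 0, y)` is purely TE and trivially divergence-free. The coefficient matters only
where `y ≠ 0`, so the operator sends this field to `(0, 0, -(y'' + κ² y))`. -/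
lemma exists_solvesMaxwell_of_isTest {k κ : ℝ} {p q : ℂ} {y : ℝ → ℂ} (hy : IsTest y)
    (h : ∀ x, ((k : ℂ) ^ 2 - pwConst p q x) * y x = -(κ : ℂ) ^ 2 * y x) :
    ∃ u v f : L2C3, SolvesMaxwell k p q u v f ∧ f ∈ rangeSpace k ∧ ‖u‖ ^ 2 = ∫ x, ‖y x‖ ^ 2 ∧
      ‖f‖ ^ 2 = ∫ x, ‖deriv (deriv y) x + (κ : ℂ) ^ 2 * y x‖ ^ 2 ∧
      ∀ η : L2C3, inner ℂ η u = ∫ x, y x * starRingEnd ℂ (η x 2) := by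
  have hz : MemLp (fun _ : ℝ => (0 : ℂ)) 2 := MemLp.zero'
  have hr : MemLp (fun x => -(deriv (deriv y) x + (κ : ℂ) ^ 2 * y x)) 2 :=
    (hy.deriv.deriv.memLp.add (hy.memLp.const_mul _)).neg
  have hu := mkL2C3_ae hz hz hy.memLp
  have hv := mkL2C3_ae (hy.memLp.const_mul (Complex.I * k)) hy.deriv.memLp.neg hz
  have hf := mkL2C3_ae hz hz hr
  set u := mkL2C3 hz hz hy.memLp
  set v := mkL2C3 (hy.memLp.const_mul (Complex.I * k)) hy.deriv.memLp.neg hz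
  set f := mkL2C3 hz hz hr
  have hzero : IsWeakDeriv 0 0 := fun φ _ => by simp
  refine ⟨u, v, f, ⟨isWeakCurl_iff.2 ⟨?_, ?_, ?_⟩, isWeakCurl_iff.2 ⟨?_, ?_, ?_⟩⟩,
    isDivFree_iff.2 ?_, ?_, ?_, fun η => ?_⟩
  · filter_upwards [hu, hv] with x h1 h2
    rw [h1.2.2, h2.1]
  · refine hy.isPrimitive.isWeakDeriv.congr ?_ ?_
    · filter_upwards [hu] with x h1
      rw [h1.2.2]
    · filter_upwards [hv] with x h1
      rw [h1.2.1, Pi.neg_apply, neg_neg]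
  · refine hzero.congr ?_ ?_
    · filter_upwards [hu] with x h1
      rw [h1.2.1, Pi.zero_apply]
    · filter_upwards [hu, hv] with x h1 h2
      rw [h1.1, h2.2.2]; simp
  · filter_upwards [hu, hv, coeFn_add_mulPW p q u f, hf] with x h1 h2 h3 h4
    rw [h3, h1.1, h2.2.2, h4.1]; simp
  · refine hzero.congr ?_ ?_
    · filter_upwards [hv] with x h1
      rw [h1.2.2, Pi.zero_apply]
    · filter_upwards [hu, coeFn_add_mulPW p q u f, hf] with x h1 h3 h4
      rw [h3, h1.2.1, h4.2.1]; simp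
  · refine (hy.deriv.isPrimitive.const_mul (-1)).isWeakDeriv.congr ?_ ?_
    · filter_upwards [hv] with x h1
      rw [h1.2.1]; simp
    · filter_upwards [hu, hv, coeFn_add_mulPW p q u f, hf] with x h1 h2 h3 h4
      rw [h3, h1.2.2, h2.1, h4.2.2]
      linear_combination h x - (k : ℂ) ^ 2 * y x * Complex.I_sq
  · refine hzero.congr ?_ ?_
    · filter_upwards [hf] with x h1
      rw [h1.1, Pi.zero_apply]
    · filter_upwards [hf] with x h1
      rw [h1.2.1]; simp
  · rw [norm_sq_eq_integral_L2C3]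
    refine integral_congr_ae ?_
    filter_upwards [hu] with x h1
    rw [h1.1, h1.2.1, h1.2.2]; simp
  · rw [norm_sq_eq_integral_L2C3]
    refine integral_congr_ae ?_
    filter_upwards [hf] with x h1
    rw [h1.1, h1.2.1, h1.2.2, norm_neg]; simp
  · rw [L2.inner_def]
    refine integral_congr_ae ?_
    filter_upwards [hu] with x h1
    rw [PiLp.inner_apply, Fin.sum_univ_three]
    simp only [RCLike.inner_apply, h1.1, h1.2.1, h1.2.2]
    simp

/-- The plane wave `exp(iκx)` modulated by the slowly varying amplitude `h(x / a)`. -/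
noncomputable def wavePacket (h : ℝ → ℂ) (a κ : ℝ) : ℝ → ℂ :=
  fun x => h (x / a) * Complex.exp (Complex.I * κ * x)

lemma norm_wavePacket (h : ℝ → ℂ) (a κ x : ℝ) : ‖wavePacket h a κ x‖ = ‖h (x / a)‖ := by
  have : Complex.I * κ * x = ((κ * x : ℝ) : ℂ) * Complex.I := by push_cast; ring
  rw [wavePacket, norm_mul, this, Complex.norm_exp_ofReal_mul_I, mul_one]

lemma integral_norm_wavePacket_sq (h : ℝ → ℂ) (a κ : ℝ) :
    ∫ x, ‖wavePacket h a κ x‖ ^ 2 = |a| * ∫ x, ‖h x‖ ^ 2 := by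
  simp only [norm_wavePacket]
  rw [Measure.integral_comp_div (fun x => ‖h x‖ ^ 2), smul_eq_mul]

lemma IsTest.wavePacket {h : ℝ → ℂ} (hh : IsTest h) {a : ℝ} (ha : a ≠ 0) (κ : ℝ) :
    IsTest (wavePacket h a κ) := by
  have h1 : ContDiff ℝ ((⊤ : ℕ∞) : WithTop ℕ∞) fun x : ℝ => h (x / a) :=
    hh.1.comp (contDiff_id.div_const a)
  have h2 : ContDiff ℝ ((⊤ : ℕ∞) : WithTop ℕ∞) fun x : ℝ => Complex.exp (Complex.I * κ * x) :=
    (contDiff_const.mul Complex.ofRealCLM.contDiff).cexp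
  refine ⟨h1.mul h2, HasCompactSupport.mul_right ?_⟩
  simpa [div_eq_inv_mul, smul_eq_mul] using hh.2.comp_smul (inv_ne_zero ha)

lemma IsTest.deriv_wavePacket {h : ℝ → ℂ} (hh : IsTest h) (a κ : ℝ) :
    _root_.deriv (Maxwell1D.wavePacket h a κ) = fun x =>
      (a : ℂ)⁻¹ * Maxwell1D.wavePacket (_root_.deriv h) a κ x +
        Complex.I * κ * Maxwell1D.wavePacket h a κ x := by
  funext x
  have h1 : HasDerivAt (fun x : ℝ => h (x / a)) ((1 / a) • _root_.deriv h (x / a)) x :=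
    (hh.hasDerivAt (x / a)).scomp x ((hasDerivAt_id x).div_const a)
  have h2 : HasDerivAt (fun x : ℝ => Complex.exp (Complex.I * κ * x))
      (Complex.exp (Complex.I * κ * x) * (Complex.I * κ * 1)) x :=
    (((hasDerivAt_id (x : ℂ)).const_mul (Complex.I * κ)).comp_ofReal).cexp
  have h3 := (h1.mul h2).deriv
  unfold Maxwell1D.wavePacket
  refine h3.trans ?_
  rw [Complex.real_smul]
  push_cast
  ring

/-- The plane wave cancels `κ²`; in every remaining term the amplitude is differentiated at least
once, which costs a factor `1 / a`. -/
lemma IsTest.deriv_deriv_wavePacket {h : ℝ → ℂ} (hh : IsTest h) {a : ℝ} (ha : a ≠ 0) (κ x : ℝ) :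
    _root_.deriv (_root_.deriv (Maxwell1D.wavePacket h a κ)) x +
      (κ : ℂ) ^ 2 * Maxwell1D.wavePacket h a κ x =
      (a : ℂ)⁻¹ * ((a : ℂ)⁻¹ * Maxwell1D.wavePacket (_root_.deriv (_root_.deriv h)) a κ x +
        2 * Complex.I * κ * Maxwell1D.wavePacket (_root_.deriv h) a κ x) := by
  have h1 := (hh.wavePacket ha κ).hasDerivAt x
  have h2 := (hh.deriv.wavePacket ha κ).hasDerivAt x
  have h3 := ((h2.const_mul (a : ℂ)⁻¹).add (h1.const_mul (Complex.I * κ))).deriv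
  rw [hh.deriv_wavePacket a κ]
  refine (congrArg (· + (κ : ℂ) ^ 2 * Maxwell1D.wavePacket h a κ x) h3).trans ?_
  rw [hh.deriv.deriv_wavePacket a κ, hh.deriv_wavePacket a κ]
  linear_combination (κ : ℂ) ^ 2 * Maxwell1D.wavePacket h a κ x * Complex.I_sq

/-- The squared residual carries `a⁻²` and stretching the amplitude contributes `|a|`, so it is of
order `|a|⁻¹`, against a squared norm of order `|a|`. -/
lemma integral_norm_wavePacket_residual_le {h : ℝ → ℂ} (hh : IsTest h) {a : ℝ} (ha : 1 ≤ |a|)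
    (κ : ℝ) :
    ∫ x, ‖deriv (deriv (wavePacket h a κ)) x + (κ : ℂ) ^ 2 * wavePacket h a κ x‖ ^ 2 ≤
      |a|⁻¹ * ((2 + 8 * κ ^ 2) * ((∫ x, ‖deriv (deriv h) x‖ ^ 2) + ∫ x, ‖deriv h x‖ ^ 2)) := by
  have ha0 : a ≠ 0 := fun h0 => by simp [h0] at ha; linarith
  have ha1 : |a|⁻¹ ≤ 1 := inv_le_one_of_one_le₀ ha
  have i1 := (hh.deriv.deriv.wavePacket ha0 κ).memLp.integrable_norm_sq
  have i2 := (hh.deriv.wavePacket ha0 κ).memLp.integrable_norm_sq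
  have i3 := (((hh.wavePacket ha0 κ).deriv.deriv.memLp).add
    ((hh.wavePacket ha0 κ).memLp.const_mul ((κ : ℂ) ^ 2))).integrable_norm_sq
  calc _ ≤ ∫ x, |a|⁻¹ ^ 2 * (2 + 8 * κ ^ 2) * (‖wavePacket (deriv (deriv h)) a κ x‖ ^ 2 +
        ‖wavePacket (deriv h) a κ x‖ ^ 2) := by
        refine integral_mono i3 ((i1.add i2).const_mul _) fun x => ?_
        rw [hh.deriv_deriv_wavePacket ha0, norm_mul, mul_pow, norm_inv, Complex.norm_real,
          Real.norm_eq_abs, mul_assoc (|a|⁻¹ ^ 2)]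
        refine mul_le_mul_of_nonneg_left ?_ (sq_nonneg _)
        refine (norm_lincomb_sq_le _ _ _ _).trans ?_
        refine mul_le_mul_of_nonneg_right ?_ (by positivity)
        have e1 : ‖2 * Complex.I * (κ : ℂ)‖ ^ 2 = 4 * κ ^ 2 := by
          simp [mul_pow]; norm_num
        have e2 : ‖((a : ℂ))⁻¹‖ ^ 2 ≤ 1 := by
          rw [norm_inv, Complex.norm_real, Real.norm_eq_abs]
          exact pow_le_one₀ (by positivity) ha1
        rw [e1]
        linarith
    _ = _ := by
        rw [integral_const_mul, integral_add i1 i2, integral_norm_wavePacket_sq,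
          integral_norm_wavePacket_sq]
        have : |a| ≠ 0 := abs_ne_zero.2 ha0
        field_simp

/-- An amplitude living beyond `1` is moved by the dilation `x / a` to distances beyond `|a|` from
the interface. -/
lemma exists_isTest_support_subset_Ioo :
    ∃ g : ℝ → ℂ, IsTest g ∧ (∀ x, g x ≠ 0 → 1 < x) ∧ 0 < ∫ x, ‖g x‖ ^ 2 := by
  let b : ContDiffBump (3 / 2 : ℝ) := ⟨1 / 4, 1 / 2, by norm_num, by norm_num⟩
  have hg : IsTest fun x => (b x : ℂ) := ⟨Complex.ofRealCLM.contDiff.comp b.contDiff,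
    b.hasCompactSupport.comp_left (g := fun r : ℝ => (r : ℂ)) (by simp)⟩
  refine ⟨fun x => (b x : ℂ), hg, fun x hx => ?_, ?_⟩
  · by_contra h
    refine hx ?_
    refine Complex.ofReal_eq_zero.2 (b.zero_of_le_dist ?_)
    rw [Real.dist_eq]
    have : (1 / 2 : ℝ) ≤ 3 / 2 - x := by linarith [not_lt.1 h]
    rw [abs_sub_comm]
    exact this.trans (le_abs_self _)
  · have hc : Continuous fun x => ‖(b x : ℂ)‖ ^ 2 := by
      have := hg.1.continuous
      fun_prop
    refine hc.integral_pos_of_hasCompactSupport_nonneg_nonzero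
      (hg.2.comp_left (g := fun z : ℂ => ‖z‖ ^ 2) (by simp)) (fun x => by positivity)
      (x := 3 / 2) ?_
    have := (b.pos_of_mem_ball (Metric.mem_ball_self b.rOut_pos)).ne'
    simpa using this

/-- Wave packets with the frequency `κ` of the oscillatory side spread out and run off to infinity
on that side. They are TE fields and never meet the interface. -/
lemma mem_weylSpectrum {m : Media} {k : ℝ} {ω : ℂ} (hω : ω ∈ m.D) (h0 : ω ≠ 0)
    (h : m.WPlus ω ∈ Media.ray k ∨ m.WMinus ω ∈ Media.ray k) : ω ∈ (m.pencil k).weylSpectrum := by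
  obtain ⟨g, hg, hgs, hA⟩ := exists_isTest_support_subset_Ioo
  set A := ∫ x, ‖g x‖ ^ 2
  -- The sign `σ` selects the half-line on which `W` is on the ray.
  obtain ⟨σ, κ, hσ, hpw⟩ : ∃ σ κ : ℝ, |σ| = 1 ∧ ∀ x, 0 < σ * x →
      (k : ℂ) ^ 2 - pwConst (1 * m.WPlus ω) (1 * m.WMinus ω) x = -(κ : ℂ) ^ 2 := by
    rcases h with h | h
    · obtain ⟨κ, hκ⟩ := exists_kappa h
      refine ⟨1, κ, by simp, fun x hx => ?_⟩
      rw [one_mul] at hx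
      simp [pwConst, hx, hκ]
    · obtain ⟨κ, hκ⟩ := exists_kappa h
      refine ⟨-1, κ, by simp, fun x hx => ?_⟩
      have : ¬ 0 < x := by linarith
      simp [pwConst, this, hκ]
  -- A negative dilation places the packet on the left half-line; the summand `1` ensures `|a n| ≥
  -- 1`.
  set a : ℕ → ℝ := fun n => σ * (n + 1)
  have habs : ∀ n, |a n| = n + 1 := fun n => by
    rw [abs_mul, hσ, one_mul, abs_of_pos (by positivity)]
  have ha0 : ∀ n, a n ≠ 0 := fun n => by
    rw [← abs_pos, habs]; positivity
  -- Normalization: the dilation multiplies the squared norm `A` of the amplitude by `n + 1`.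
  set s : ℕ → ℝ := fun n => (√((n + 1) * A))⁻¹
  have hs : ∀ n, s n ^ 2 = ((n + 1) * A)⁻¹ := fun n => by
    rw [inv_pow, Real.sq_sqrt (by positivity)]
  set y : ℕ → ℝ → ℂ := fun n => wavePacket (fun x => (s n : ℂ) * g x) (a n) κ
  have hgt : ∀ n, IsTest fun x => (s n : ℂ) * g x := fun n => hg.const_mul _
  have hyt : ∀ n, IsTest (y n) := fun n => (hgt n).wavePacket (ha0 n) κ
  have hmul : ∀ (n : ℕ) (φ : ℝ → ℂ), ∫ x, ‖(s n : ℂ) * φ x‖ ^ 2 =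
      ((n + 1) * A)⁻¹ * ∫ x, ‖φ x‖ ^ 2 := fun n φ => by
    rw [← integral_const_mul]
    refine integral_congr_ae (Eventually.of_forall fun x => ?_)
    simp only [norm_mul, mul_pow, Complex.norm_real, Real.norm_eq_abs, sq_abs, hs]
  have hsupp : ∀ n x, y n x ≠ 0 → (n : ℝ) + 1 < σ * x := fun n x hx => by
    have h1 : g (x / a n) ≠ 0 := fun h => hx (by simp [y, wavePacket, h])
    have h2 := hgs _ h1
    have h3 : x / a n = σ * x / (n + 1) := by
      have : σ ^ 2 = 1 := by rw [← sq_abs, hσ, one_pow]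
      have hσ0 : σ ≠ 0 := fun h => by simp [h] at hσ
      simp only [a]
      field_simp
      rw [this, mul_one]
    rw [h3, lt_div_iff₀ (by positivity), one_mul] at h2
    exact h2
  have hnorm : ∀ n, ∫ x, ‖y n x‖ ^ 2 = 1 := fun n => by
    rw [integral_norm_wavePacket_sq, hmul, habs]
    have : A ≠ 0 := hA.ne'
    field_simp
    rfl
  choose u v f huv hf hun hfn hin using fun n => exists_solvesMaxwell_of_isTest (k := k) (κ := κ)
    (p := 1 * m.WPlus ω) (q := 1 * m.WMinus ω) (hyt n) fun x => by
      by_cases hx : y n x = 0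
      · simp [hx]
      · rw [hpw x (lt_trans (by positivity) (hsupp n x hx))]
  choose w hw hwf using fun n => exists_dom_of_solvesMaxwell (f := ⟨f n, hf n⟩) h0 one_ne_zero
    (huv n)
  refine ⟨hω, w, fun n => ?_, fun η => ?_, ?_⟩
  · rw [hw, ← sq_eq_sq₀ (norm_nonneg _) zero_le_one, hun, hnorm, one_pow]
  · simp only [hw, hin]
    refine tendsto_integral_mul_conj_of_escaping (fun n => (hyt n).memLp) hnorm (fun n x hx => ?_)
      (memLp_apply η 2)
    by_contra h
    have h1 := hsupp n x h
    have h2 : σ * x ≤ |x| := by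
      have := le_abs_self (σ * x)
      rwa [abs_mul, hσ, one_mul] at this
    linarith
  · simp only [hwf]
    set B := (∫ x, ‖deriv (deriv g) x‖ ^ 2) + ∫ x, ‖deriv g x‖ ^ 2
    have hd : ∀ n, deriv (fun x => (s n : ℂ) * g x) = fun x => (s n : ℂ) * deriv g x := fun n =>
      funext fun x => deriv_const_mul_field _
    have hdd : ∀ n, deriv (fun x => (s n : ℂ) * deriv g x) =
        fun x => (s n : ℂ) * deriv (deriv g) x := fun n =>
      funext fun x => deriv_const_mul_field _
    have hb : ∀ n : ℕ, ‖f n‖ ^ 2 ≤ (1 / ((n : ℝ) + 1)) * (A⁻¹ * ((2 + 8 * κ ^ 2) * B)) := fun n => by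
      rw [hfn]
      refine (integral_norm_wavePacket_residual_le (hgt n) (by rw [habs]; linarith
        [(Nat.cast_nonneg n : (0 : ℝ) ≤ n)]) κ).trans ?_
      rw [hd, hdd, hmul, hmul, habs, ← mul_add]
      have hB : 0 ≤ B := add_nonneg (integral_nonneg fun x => by positivity)
        (integral_nonneg fun x => by positivity)
      have hn1 : ((n : ℝ) + 1)⁻¹ ≤ 1 := inv_le_one_of_one_le₀ (by
        linarith [(Nat.cast_nonneg n : (0 : ℝ) ≤ n)])
      calc _ = ((n : ℝ) + 1)⁻¹ * (((n : ℝ) + 1)⁻¹ * (A⁻¹ * ((2 + 8 * κ ^ 2) * B))) := by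
            rw [mul_inv]; ring
        _ ≤ 1 * (((n : ℝ) + 1)⁻¹ * (A⁻¹ * ((2 + 8 * κ ^ 2) * B))) := by gcongr
        _ = _ := by rw [one_mul, one_div]
    have hsq : Tendsto (fun n => ‖f n‖ ^ 2) atTop (𝓝 0) := by
      refine squeeze_zero (fun n => by positivity) hb ?_
      have := (tendsto_one_div_add_atTop_nhds_zero_nat (𝕜 := ℝ)).mul_const
        (A⁻¹ * ((2 + 8 * κ ^ 2) * B))
      rwa [zero_mul] at this
    have := hsq.sqrt
    simpa [Real.sqrt_sq (norm_nonneg _)] using this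

end Maxwell1D

namespace Maxwell1D

/-! ### The spectrum of the Maxwell pencil -/

variable {m : Media} {k : ℝ} {ω l : ℂ}

/-- For `k = 0` the two sets differ only in the point `0`, a value of `W` excluded by removing `Ω₀`.
-/
lemma mem_rayM_iff {p : ℂ} (hp : p ≠ 0) : p ∈ Media.rayM k ↔ p ∈ Media.ray k := by
  unfold Media.rayM Media.ray
  split_ifs with hk
  · subst hk
    constructor
    · rintro ⟨r, hr, rfl⟩
      exact ⟨r, by simpa using le_of_lt hr, rfl⟩
    · rintro ⟨r, hr, rfl⟩
      refine ⟨r, lt_of_le_of_ne (by simpa using hr) fun h => hp ?_, rfl⟩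
      rw [← h, Complex.ofReal_zero]
  · rfl

lemma isClosed_ray (k : ℝ) : IsClosed (Media.ray k) :=
  Complex.isometry_ofReal.isClosedEmbedding.isClosedMap _ isClosed_Ici

/-- The operator at `l` is the Maxwell problem with `l W` in place of `W`; one factor `l` cancels
from its dispersion relation. -/
lemma mem_innerResolventSet (hω : ω ≠ 0) (hl : l ≠ 0) (hp : m.WPlus ω ≠ 0) (hq : m.WMinus ω ≠ 0)
    (hpr : l * m.WPlus ω ∉ Media.ray k) (hqr : l * m.WMinus ω ∉ Media.ray k)
    (h : (k : ℂ) ^ 2 * (m.WPlus ω + m.WMinus ω) ≠ l * (m.WPlus ω * m.WMinus ω)) :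
    l ∈ (m.pencil k).innerResolventSet ω := by
  obtain ⟨hex, C, hC⟩ := SolvesMaxwell.wellposed (mul_ne_zero hl hp) (mul_ne_zero hl hq) hpr hqr
    fun h' => h (mul_left_cancel₀ hl (by linear_combination h'))
  have hb : ∀ u : (m.pencil k).dom ω, ‖(u : L2C3)‖ ≤ C * ‖(m.pencil k).op ω l u‖ := fun u => by
    obtain ⟨v, hv⟩ := exists_solvesMaxwell_op (l := l) u
    exact hC _ _ _ hv
  refine ⟨⟨(injective_iff_map_eq_zero _).2 fun u hu => ?_, fun f => ?_⟩, C, hb⟩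
  · have := hb u
    rw [hu, norm_zero, mul_zero] at this
    exact Subtype.ext (norm_le_zero_iff.1 this)
  · obtain ⟨u, v, huv⟩ := hex f
    obtain ⟨u', -, hu'⟩ := exists_dom_of_solvesMaxwell hω hl huv
    exact ⟨u', hu'⟩

lemma eq_zero_of_op_eq_zero (hp : m.WPlus ω ≠ 0) (hq : m.WMinus ω ≠ 0)
    (hpq : m.WPlus ω ∈ Media.ray k ∨ m.WMinus ω ∈ Media.ray k) (u : (m.pencil k).dom ω)
    (hu : (m.pencil k).op ω 1 u = 0) : u = 0 := by
  obtain ⟨v, hv⟩ := exists_solvesMaxwell_op (l := 1) u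
  rw [one_mul, one_mul, hu] at hv
  exact Subtype.ext (SolvesMaxwell.eq_zero_of_ray hp hq hpq hv)

/-- On the rays `1` is in every essential spectrum, and it is not an eigenvalue. -/
lemma spectra_of_mem_ray (hω : ω ∈ m.D) (h0 : ω ≠ 0) (hp : m.WPlus ω ≠ 0) (hq : m.WMinus ω ≠ 0)
    (hpq : m.WPlus ω ∈ Media.ray k ∨ m.WMinus ω ∈ Media.ray k) :
    ω ∈ (m.pencil k).spectrum ∧ ω ∉ (m.pencil k).pointSpectrum ∧
      (∀ j, ω ∈ (m.pencil k).essSpectrum j) ∧ ω ∈ (m.pencil k).weylSpectrum := by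
  have hW := mem_weylSpectrum hω h0 hpq
  have hinj := eq_zero_of_op_eq_zero hp hq hpq
  refine ⟨⟨hω, fun h => OperatorPencil.notMem_weylSpectrum_of_mem_innerResolventSet h.2 hW⟩,
    fun ⟨_, u, hu, hu0⟩ => hu (hinj u hu0), OperatorPencil.mem_essSpectrum hω fun hcl => ?_, hW⟩
  -- If the range were closed, injectivity would give a lower bound, which a Weyl sequence violates.
  obtain ⟨C, hC⟩ := exists_bound_of_hasClosedRange h0 hinj hcl
  exact OperatorPencil.notMem_weylSpectrum 0 C (fun u => ⟨0, by simpa using hC u⟩) hW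

lemma spectra_of_mem_innerResolventSet (h : 1 ∈ (m.pencil k).innerResolventSet ω) :
    ω ∉ (m.pencil k).spectrum ∧ ω ∉ (m.pencil k).pointSpectrum ∧
      (∀ j, ω ∉ (m.pencil k).essSpectrum j) ∧ ω ∉ (m.pencil k).weylSpectrum := by
  obtain ⟨hF, hi⟩ := OperatorPencil.isFredholm_of_mem_innerResolventSet h
  refine ⟨fun h' => h'.2 ⟨h'.1, h⟩, fun ⟨_, u, hu, hu0⟩ => hu ?_,
    OperatorPencil.notMem_essSpectrum hF hi
      (OperatorPencil.one_mem_Delta_of_mem_innerResolventSet h),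
    OperatorPencil.notMem_weylSpectrum_of_mem_innerResolventSet h⟩
  exact (injective_iff_map_eq_zero _).1 h.1.1 u hu0

/-- The rays are closed, so `l W±` stays off them for `l` near `1`; the relations for `W` and for `l
W` together give `W₊ W₋ = l W₊ W₋`, that is, `l = 1`. -/
lemma exists_punctured_mem_innerResolventSet (h0 : ω ≠ 0) (hp : m.WPlus ω ≠ 0)
    (hq : m.WMinus ω ≠ 0) (hpr : m.WPlus ω ∉ Media.ray k) (hqr : m.WMinus ω ∉ Media.ray k)
    (h : (k : ℂ) ^ 2 * (m.WPlus ω + m.WMinus ω) = m.WPlus ω * m.WMinus ω) :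
    ∃ δ : ℝ, 0 < δ ∧ ∀ l : ℂ, l ≠ 1 → ‖l - 1‖ < δ → l ∈ (m.pencil k).innerResolventSet ω := by
  have hev : ∀ {p : ℂ}, p ∉ Media.ray k → ∀ᶠ l : ℂ in 𝓝 1, l * p ∉ Media.ray k := fun {p} hp => by
    have hc : ContinuousAt (fun l : ℂ => l * p) 1 := by fun_prop
    exact hc.eventually_mem ((isClosed_ray k).isOpen_compl.mem_nhds (by simpa using hp))
  obtain ⟨δ, hδ, hb⟩ := Metric.eventually_nhds_iff.1
    (((hev hpr).and (hev hqr)).and (eventually_ne_nhds (one_ne_zero (α := ℂ))))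
  refine ⟨δ, hδ, fun l hl hld => ?_⟩
  obtain ⟨⟨h1, h2⟩, h3⟩ := hb (by rwa [dist_eq_norm])
  refine mem_innerResolventSet h0 h3 hp hq h1 h2 fun h' => hl ?_
  rw [h] at h'
  exact mul_right_cancel₀ (mul_ne_zero hp hq) (by rw [← h', one_mul])

/-- At a solution of the dispersion relation off the rays `1` is a simple, isolated eigenvalue. -/
lemma spectra_of_resonant (hω : ω ∈ m.D) (h0 : ω ≠ 0) (hp : m.WPlus ω ≠ 0) (hq : m.WMinus ω ≠ 0)
    (hpr : m.WPlus ω ∉ Media.ray k) (hqr : m.WMinus ω ∉ Media.ray k)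
    (h : (k : ℂ) ^ 2 * (m.WPlus ω + m.WMinus ω) = m.WPlus ω * m.WMinus ω) :
    ω ∈ (m.pencil k).spectrum ∧ (m.pencil k).IsAlgSimple ω 1 ∧
      ω ∈ (m.pencil k).discreteSpectrum ∧ (∀ j, ω ∉ (m.pencil k).essSpectrum j) ∧
      ω ∉ (m.pencil k).weylSpectrum := by
  obtain ⟨u₀, v₀, Λ, C, hu₀, hΛ, hne, hC⟩ := SolvesMaxwell.resonant hp hq hpr hqr h
  rw [← one_mul (m.WPlus ω), ← one_mul (m.WMinus ω)] at hu₀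
  obtain ⟨e, rfl, he0⟩ := exists_dom_of_solvesMaxwell (f := 0) h0 one_ne_zero hu₀
  have hsol : ∀ u : (m.pencil k).dom ω, ∃ v,
      SolvesMaxwell k (m.WPlus ω) (m.WMinus ω) u v ((m.pencil k).op ω 1 u) := fun u => by
    simpa only [one_mul] using exists_solvesMaxwell_op (l := 1) u
  have hest : ∀ u : (m.pencil k).dom ω, ∃ c : ℂ,
      ‖(u : L2C3) - c • (e : L2C3)‖ ≤ C * ‖(m.pencil k).op ω 1 u‖ := fun u => by
    obtain ⟨v, hv⟩ := hsol u
    exact hC _ _ _ hv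
  have he : e ≠ 0 := fun h => hne (by rw [h]; simp)
  have hker : ∀ u : (m.pencil k).dom ω, (m.pencil k).op ω 1 u = 0 → ∃ c : ℂ, u = c • e :=
    fun u hu => by
      obtain ⟨c, hc⟩ := hest u
      rw [hu, norm_zero, mul_zero] at hc
      exact ⟨c, Subtype.ext (sub_eq_zero.1 (norm_le_zero_iff.1 hc))⟩
  have hrange : ∀ f : rangeSpace k, (∃ u, (m.pencil k).op ω 1 u = f) ↔
      (Λ ∘L (rangeSpace k).subtypeL) f = 0 := fun f => by
    refine Iff.trans ⟨?_, ?_⟩ (hΛ f)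
    · rintro ⟨u, rfl⟩
      exact ⟨u, hsol u⟩
    · rintro ⟨u, v, huv⟩
      rw [← one_mul (m.WPlus ω), ← one_mul (m.WMinus ω)] at huv
      obtain ⟨u', -, hu'⟩ := exists_dom_of_solvesMaxwell h0 one_ne_zero huv
      exact ⟨u', hu'⟩
  have hB : (Λ ∘L (rangeSpace k).subtypeL) ((m.pencil k).B ω e) ≠ 0 := hne
  obtain ⟨hg, hF, hi⟩ := OperatorPencil.isFredholm_of_functional he he0 hker hrange hB
  have hA := OperatorPencil.isAlgSimple_of_functional hg hker hrange hB
  obtain ⟨δ, hδ, hres⟩ := exists_punctured_mem_innerResolventSet h0 hp hq hpr hqr h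
  refine ⟨⟨hω, fun h' => he ?_⟩, hA, ⟨⟨⟨hω, e, he, he0⟩, hA.not_hasInfiniteAlgMult⟩, δ, hδ, hres⟩,
    OperatorPencil.notMem_essSpectrum hF hi
      (OperatorPencil.one_mem_Delta_of_punctured hF.isSemiFredholm hδ hres),
    OperatorPencil.notMem_weylSpectrum (e : L2C3) C hest⟩
  exact (injective_iff_map_eq_zero _).1 h'.2.1.1 e he0

lemma mem_D_of_mem_essSpectrum {j : Fin 5} (h : ω ∈ (m.pencil k).essSpectrum j) : ω ∈ m.D := by
  fin_cases j <;> exact h.1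

/-- The factor `ω²` in `W` puts `ω = 0` into `Ω₀` whenever it belongs to the domain. -/
lemma Media.ne_zero_of_notMem_Omega0 (hω : ω ∈ m.D) (h : ω ∉ m.Omega0) :
    ω ≠ 0 ∧ m.WPlus ω ≠ 0 ∧ m.WMinus ω ≠ 0 := by
  refine ⟨?_, fun h' => h ⟨hω, Or.inl h'⟩, fun h' => h ⟨hω, Or.inr h'⟩⟩
  rintro rfl
  exact h ⟨hω, Or.inl (by simp [Media.WPlus])⟩

/-- The three alternatives for a frequency outside `Ω₀`. -/
lemma spectra_trichotomy (hω : ω ∈ m.D) (h : ω ∉ m.Omega0) :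
    (ω ∈ m.MPlus k ∪ m.MMinus k ∧ ω ∉ m.N k ∧
      ω ∈ (m.pencil k).spectrum ∧ ω ∉ (m.pencil k).pointSpectrum ∧
      (∀ j, ω ∈ (m.pencil k).essSpectrum j) ∧ ω ∈ (m.pencil k).weylSpectrum) ∨
    (ω ∉ m.MPlus k ∪ m.MMinus k ∧ ω ∉ m.N k ∧
      ω ∉ (m.pencil k).spectrum ∧ ω ∉ (m.pencil k).pointSpectrum ∧
      (∀ j, ω ∉ (m.pencil k).essSpectrum j) ∧ ω ∉ (m.pencil k).weylSpectrum) ∨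
    (ω ∉ m.MPlus k ∪ m.MMinus k ∧ ω ∈ m.N k ∧
      ω ∈ (m.pencil k).spectrum ∧ (m.pencil k).IsAlgSimple ω 1 ∧
      ω ∈ (m.pencil k).discreteSpectrum ∧ (∀ j, ω ∉ (m.pencil k).essSpectrum j) ∧
      ω ∉ (m.pencil k).weylSpectrum) := by
  obtain ⟨h0, hp, hq⟩ := Media.ne_zero_of_notMem_Omega0 hω h
  have hM : ω ∈ m.MPlus k ∪ m.MMinus k ↔
      m.WPlus ω ∈ Media.ray k ∨ m.WMinus ω ∈ Media.ray k := by
    rw [← mem_rayM_iff hp, ← mem_rayM_iff hq]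
    exact ⟨Or.imp And.right And.right, Or.imp (⟨⟨hω, h⟩, ·⟩) (⟨⟨hω, h⟩, ·⟩)⟩
  by_cases hr : m.WPlus ω ∈ Media.ray k ∨ m.WMinus ω ∈ Media.ray k
  · refine Or.inl ⟨hM.2 hr, fun hN => ?_, spectra_of_mem_ray hω h0 hp hq hr⟩
    exact hr.elim hN.2.1 hN.2.2.1
  · have hM' := mt hM.1 hr
    rw [not_or] at hr
    by_cases hd : (k : ℂ) ^ 2 * (m.WPlus ω + m.WMinus ω) = m.WPlus ω * m.WMinus ω
    · exact Or.inr (Or.inr ⟨hM', ⟨⟨hω, h⟩, hr.1, hr.2, hd⟩,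
        spectra_of_resonant hω h0 hp hq hr.1 hr.2 hd⟩)
    · refine Or.inr (Or.inl ⟨hM', fun hN => hd hN.2.2.2, spectra_of_mem_innerResolventSet
        (mem_innerResolventSet h0 one_ne_zero hp hq ?_ ?_ ?_)⟩)
      · rw [one_mul]; exact hr.1
      · rw [one_mul]; exact hr.2
      · rw [one_mul]; exact hd

lemma sdiff_Omega0_eq {s t : Set ℂ} (hs : s ⊆ m.D) (ht : t ⊆ m.D \ m.Omega0)
    (h : ∀ ω, ω ∈ m.D → ω ∉ m.Omega0 → (ω ∈ s ↔ ω ∈ t)) : s \ m.Omega0 = t := by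
  ext ω
  exact ⟨fun hω => (h ω (hs hω.1) hω.2).1 hω.1,
    fun hω => ⟨(h ω (ht hω).1 (ht hω).2).2 hω, (ht hω).2⟩⟩

lemma Media.N_zero : m.N 0 = ∅ := by
  refine Set.eq_empty_of_forall_notMem fun ω hω => ?_
  obtain ⟨-, hp, hq⟩ := Media.ne_zero_of_notMem_Omega0 hω.1.1 hω.1.2
  have := hω.2.2.2
  simp [hp, hq] at this

end Maxwell1D

/-! ### The reduced spectra, read off from the trichotomy -/

theorem theorem2p1 (m : Maxwell1D.Media) (k : ℝ) :
    -- spectrum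
    ((m.pencil k).spectrum \ m.Omega0 = (m.MPlus k ∪ m.MMinus k) ∪ m.N k ∧
      Disjoint (m.MPlus k ∪ m.MMinus k) (m.N k)) ∧
    -- point and discrete spectrum
    ((m.pencil k).pointSpectrum \ m.Omega0 = m.N k ∧
      (m.pencil k).finPointSpectrum \ m.Omega0 = m.N k ∧
      m.N 0 = ∅ ∧
      (∀ ω ∈ (m.pencil k).pointSpectrum \ m.Omega0,
        (m.pencil k).IsAlgSimple ω 1 ∧ (m.pencil k).IsGeomSimple ω 1) ∧
      (m.pencil k).discreteSpectrum \ m.Omega0 = m.N k) ∧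
    -- essential and Weyl spectrum
    ((∀ j : Fin 5, (m.pencil k).essSpectrum j \ m.Omega0 = m.MPlus k ∪ m.MMinus k) ∧
      (m.pencil k).weylSpectrum \ m.Omega0 = m.MPlus k ∪ m.MMinus k) := by

  have hMD : m.MPlus k ∪ m.MMinus k ⊆ m.D \ m.Omega0 :=
    Set.union_subset (fun ω h => h.1) fun ω h => h.1
  have hND : m.N k ⊆ m.D \ m.Omega0 := fun ω h => h.1
  have hpt : (m.pencil k).pointSpectrum \ m.Omega0 = m.N k := by
    refine Maxwell1D.sdiff_Omega0_eq (fun ω h => h.1) hND fun ω hω h0 => ?_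
    rcases Maxwell1D.spectra_trichotomy (k := k) hω h0 with h | h | h
    · exact iff_of_false h.2.2.2.1 h.2.1
    · exact iff_of_false h.2.2.2.1 h.2.1
    · exact iff_of_true h.2.2.2.2.1.1.1 h.2.1
  refine ⟨⟨?_, ?_⟩, ⟨hpt, ?_, Maxwell1D.Media.N_zero, ?_, ?_⟩, fun j => ?_, ?_⟩
  · refine Maxwell1D.sdiff_Omega0_eq (fun ω h => h.1) (Set.union_subset hMD hND) fun ω hω h0 => ?_
    rcases Maxwell1D.spectra_trichotomy (k := k) hω h0 with h | h | h
    · exact iff_of_true h.2.2.1 (Or.inl h.1)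
    · exact iff_of_false h.2.2.1 fun h' => h'.elim h.1 h.2.1
    · exact iff_of_true h.2.2.1 (Or.inr h.2.1)
  · refine Set.disjoint_left.2 fun ω hM hN => ?_
    rcases Maxwell1D.spectra_trichotomy (k := k) hN.1.1 hN.1.2 with h | h | h
    · exact h.2.1 hN
    · exact h.1 hM
    · exact h.1 hM
  · refine Maxwell1D.sdiff_Omega0_eq (fun ω h => h.1.1) hND fun ω hω h0 => ?_
    rcases Maxwell1D.spectra_trichotomy (k := k) hω h0 with h | h | h
    · exact iff_of_false (fun h' => h.2.2.2.1 h'.1) h.2.1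
    · exact iff_of_false (fun h' => h.2.2.2.1 h'.1) h.2.1
    · exact iff_of_true h.2.2.2.2.1.1 h.2.1
  · intro ω hω
    rcases Maxwell1D.spectra_trichotomy (k := k) hω.1.1 hω.2 with h | h | h
    · exact absurd hω.1 h.2.2.2.1
    · exact absurd hω.1 h.2.2.2.1
    · exact ⟨h.2.2.2.1, h.2.2.2.1.1⟩
  · refine Maxwell1D.sdiff_Omega0_eq (fun ω h => h.1.1.1) hND fun ω hω h0 => ?_
    rcases Maxwell1D.spectra_trichotomy (k := k) hω h0 with h | h | h
    · exact iff_of_false (fun h' => h.2.2.2.1 h'.1.1) h.2.1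
    · exact iff_of_false (fun h' => h.2.2.2.1 h'.1.1) h.2.1
    · exact iff_of_true h.2.2.2.2.1 h.2.1
  · refine Maxwell1D.sdiff_Omega0_eq (fun ω h => Maxwell1D.mem_D_of_mem_essSpectrum h) hMD
      fun ω hω h0 => ?_
    rcases Maxwell1D.spectra_trichotomy (k := k) hω h0 with h | h | h
    · exact iff_of_true (h.2.2.2.2.1 j) h.1
    · exact iff_of_false (h.2.2.2.2.1 j) h.1
    · exact iff_of_false (h.2.2.2.2.2.1 j) h.1
  · refine Maxwell1D.sdiff_Omega0_eq (fun ω h => h.1) hMD fun ω hω h0 => ?_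
    rcases Maxwell1D.spectra_trichotomy (k := k) hω h0 with h | h | h
    · exact iff_of_true h.2.2.2.2.2 h.1
    · exact iff_of_false h.2.2.2.2.2 h.1
    · exact iff_of_false h.2.2.2.2.2.2 h.1
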